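/- \textbf{Model.} A network is a connected undirected graph on $n$ nodes with unique identifiers from $[n]$; each node $v$ numbers its incident links by ports $1,\dots,\deg(v)$ (port numbering model). Every node is initially asleep or awake; an adversary chooses the nonempty set $A$ of initially awake nodes. A node that starts executing knows only $n$, its identifier, its degree and its advice. Computation proceeds in synchronous rounds. In each round every awake node that has not terminated performs an arbitrary local quantum operation (possibly with measurements and private randomness) on its private memory and on its communication registers. Then the messages are exchanged: every link carries, in each direction, at most one classical message of $O(\log n)$ bits, and at most one quantum message of $O(\log n)$ qubits, where the emission register at each end of a link is swapped with the receive register at the other end; registers may be empty, also in superposition (quantum routing). A sleeping node wakes up at the start of the next round if it receives a classical message. A quantum message that reaches a sleeping node does not wake it, but is sent back with a phase of $-1$. The number of messages of an execution is the sum over all rounds of the number of classical messages sent and the maximum, over all configurations in the support of the current joint quantum state, of the number of quantum messages in transit. The \emph{awake distance} $\rho_{\mathrm{awake}}$ is the maximum, over all initially sleeping nodes, of the distance to the closest initially awake node ($0$ if there is none). \textbf{Theorem.} For every constant $c$ there is a constant $C>0$ such that, for all integers $n\ge 1$ and $0\le\alpha\le\log_2 n$, there are a quantum distributed algorithm and an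 oracle, which sees the whole network including its port numbering and the set $A$ and assigns a string of at most $\alpha$ bits of advice to each node, such that, for every network on $n$ nodes and every nonempty $A$, with probability at least $1-n^{-c}$ all of the following hold: all nodes are awake after at most $C\,\rho_{\mathrm{awake}}\,n^2\log n$ rounds; all nodes have terminated after at most $C\max\{\rho_{\mathrm{awake}},1\}\,n^2\log n$ rounds; and the total number of messages is at most $$C\sqrt{\frac{n^3}{2^{\max\{\lfloor(\alpha-1)/2\rfloor,0\}}}}\;\log n .$$ -/

import Mathlib

open scoped Matrix

noncomputable section

/-- Bit strings of length `k`. They are the classical messages of `k` bits and also index the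
computational basis of a quantum message of `k` qubits. -/
abbrev Bits (k : ℕ) : Type := Fin k → Bool

/-- A connected port-numbered network on `n` nodes. A node is named by its identifier in `Fin n`.
Node `v` has the ports `0, …, deg v - 1`, which are in bijection with its neighbours. -/
structure Network (n : ℕ) where
  graph : SimpleGraph (Fin n)
  connected : graph.Connected
  deg : Fin n → ℕ
  port : (v : Fin n) → Fin (deg v) ≃ graph.neighborSet v

namespace Network

variable {n : ℕ}

/-- The node at the other end of port `i` of `v`. -/
def peer (N : Network n) (v : Fin n) (i : Fin (N.deg v)) : Fin n := (N.port v i).1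

/-- The port of the node `peer v i` that leads back to `v`. -/
def backPort (N : Network n) (v : Fin n) (i : Fin (N.deg v)) : Fin (N.deg (N.peer v i)) :=
  (N.port (N.peer v i)).symm ⟨v, SimpleGraph.Adj.symm (N.port v i).2⟩

/-- The awake distance: the maximum, over the nodes that are initially asleep, of the distance to
the closest initially awake node (`0` if all nodes are initially awake). -/
def awakeDist (N : Network n) (A : Finset (Fin n)) : ℕ :=
  Aᶜ.sup fun v => sInf {d : ℕ | ∃ a ∈ A, d = N.graph.dist v a}

end Network

/-- The computational basis of all quantum registers at a node of degree `d`. A communication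
register holds a message of `k` qubits or is empty (`none`). -/
@[ext]
structure LocalBasis (Mem : Type) (k d : ℕ) where
  /-- the content of the private memory -/
  mem : Mem
  /-- the content of the quantum emission register of each port -/
  emit : Fin d → Option (Bits k)
  /-- the content of the quantum receive register of each port -/
  recv : Fin d → Option (Bits k)
  deriving DecidableEq, Fintype

/-- The number of nonempty quantum communication registers at a node. -/
def LocalBasis.load {Mem : Type} {k d : ℕ} (x : LocalBasis Mem k d) : ℕ :=
  (Finset.univ.filter fun i => (x.emit i).isSome).card +
    (Finset.univ.filter fun i => (x.recv i).isSome).card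

/-- The action of the quantum network card of a sleeping node: every message in a receive register
is sent back, through the emission register of the same port, with a phase `-1`. The private memory
is not touched. -/
def sleepNIC (Mem : Type) [DecidableEq Mem] (k d : ℕ) :
    Matrix (LocalBasis Mem k d) (LocalBasis Mem k d) ℂ :=
  fun x y =>
    if x = ⟨y.mem, y.recv, y.emit⟩ then
      (-1) ^ (Finset.univ.filter fun i => (y.recv i).isSome).card
    else 0

/-- A quantum distributed algorithm for networks with `n` nodes and messages of `k` (qu)bits.
Every node has a classical state, a finite-dimensional private quantum memory with basis `Mem`, and
its communication registers. When a node starts, it knows only its identifier, its degree and its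
advice string (and `n`). In each round an awake node applies to its quantum registers a quantum
instrument, given by one Kraus operator per outcome; the instrument depends on its classical state
and on the classical messages that it received at the end of the previous round. The outcome
determines its next classical state and the classical messages that it sends. (Unitary operations,
measurements and private random bits are all of this form.) -/
structure Algorithm (n k : ℕ) where
  State : Type
  Mem : Type
  Outcome : Type
  [memFintype : Fintype Mem]
  [memDecidableEq : DecidableEq Mem]
  [outcomeFintype : Fintype Outcome]
  /-- the initial basis state of the private quantum memory -/
  mem₀ : Mem
  /-- the classical state in which a node with the given identifier, degree and advice starts -/
  start : Fin n → ℕ → List Bool → State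
  /-- the Kraus operators of the local quantum operation -/
  op : (d : ℕ) → State → (Fin d → Option (Bits k)) → Outcome →
    Matrix (LocalBasis Mem k d) (LocalBasis Mem k d) ℂ
  op_complete : ∀ (d : ℕ) (s : State) (inbox : Fin d → Option (Bits k)),
    ∑ o, (op d s inbox o)ᴴ * op d s inbox o = 1
  /-- the next classical state -/
  next : (d : ℕ) → State → (Fin d → Option (Bits k)) → Outcome → State
  /-- the classical message (if any) sent through each port -/
  send : (d : ℕ) → State → (Fin d → Option (Bits k)) → Outcome → Fin d → Option (Bits k)
  /-- the states in which a node has terminated -/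
  halted : State → Prop

attribute [instance] Algorithm.memFintype Algorithm.memDecidableEq Algorithm.outcomeFintype

namespace Algorithm

variable {n k : ℕ}

/-- The computational basis of all quantum registers of the network. -/
abbrev GlobalBasis (𝒜 : Algorithm n k) (N : Network n) : Type :=
  (v : Fin n) → LocalBasis 𝒜.Mem k (N.deg v)

/-- One classical branch of an execution, at the beginning of a round. -/
structure Config (𝒜 : Algorithm n k) (N : Network n) where
  /-- the classical state of each node; `none` means that the node is asleep -/
  state : Fin n → Option 𝒜.State
  /-- the classical messages in the classical receive registers -/
  inbox : (v : Fin n) → Fin (N.deg v) → Option (Bits k)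
  /-- the (unnormalised) joint quantum state; its squared norm is the probability of the branch -/
  amp : 𝒜.GlobalBasis N → ℂ
  /-- the number of classical and quantum messages sent so far -/
  msgs : ℕ

/-- The outcomes of the local operations of all nodes in one round. A node that is asleep or has
terminated performs no measurement and has the outcome `none`. -/
abbrev Outcomes (𝒜 : Algorithm n k) : Type := Fin n → Option 𝒜.Outcome

section Execution

variable (𝒜 : Algorithm n k) (N : Network n)

open scoped Classical in
/-- The initial configuration: exactly the nodes of `A` are awake, there are no messages, and all
quantum registers are in their initial states. -/
def initial (A : Finset (Fin n)) (advice : Fin n → List Bool) : 𝒜.Config N where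
  state v := if v ∈ A then some (𝒜.start v (N.deg v) (advice v)) else none
  inbox _ _ := none
  amp x := if x = (fun _ => ⟨𝒜.mem₀, fun _ => none, fun _ => none⟩) then 1 else 0
  msgs := 0

open scoped Classical in
/-- The operator applied to the quantum registers of a node of degree `d`, for each outcome. -/
def nodeOp (d : ℕ) (inbox : Fin d → Option (Bits k)) :
    Option 𝒜.State → Option 𝒜.Outcome → Matrix (LocalBasis 𝒜.Mem k d) (LocalBasis 𝒜.Mem k d) ℂ
  | none, none => sleepNIC 𝒜.Mem k d
  | none, some _ => 0
  | some s, none => if 𝒜.halted s then 1 else 0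
  | some s, some o => if 𝒜.halted s then 0 else 𝒜.op d s inbox o

open scoped Classical in
/-- The classical messages that a node of degree `d` sends. -/
def nodeSend (d : ℕ) (inbox : Fin d → Option (Bits k)) :
    Option 𝒜.State → Option 𝒜.Outcome → Fin d → Option (Bits k)
  | some s, some o => if 𝒜.halted s then fun _ => none else 𝒜.send d s inbox o
  | _, _ => fun _ => none

open scoped Classical in
/-- The classical state of a node of degree `d` after its local operation. -/
def nodeNext (d : ℕ) (inbox : Fin d → Option (Bits k)) :
    Option 𝒜.State → Option 𝒜.Outcome → Option 𝒜.State
  | some s, some o => some (if 𝒜.halted s then s else 𝒜.next d s inbox o)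
  | s, _ => s

/-- The joint quantum state after the local operations of one round: the tensor product of the
operators of the nodes is applied. -/
def localAmp (c : 𝒜.Config N) (o : 𝒜.Outcomes) : 𝒜.GlobalBasis N → ℂ :=
  fun x => ∑ y, (∏ v, 𝒜.nodeOp (N.deg v) (c.inbox v) (c.state v) (o v) (x v) (y v)) * c.amp y

/-- Quantum routing on basis states: along every link, the emission register at each end is swapped
with the receive register at the other end. -/
def route (x : 𝒜.GlobalBasis N) : 𝒜.GlobalBasis N :=
  fun v => ⟨(x v).mem, fun i => (x (N.peer v i)).recv (N.backPort v i),
    fun i => (x (N.peer v i)).emit (N.backPort v i)⟩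

open scoped Classical in
/-- The number of quantum messages of a round whose joint state just before the routing is `ψ`:
the maximum, over all basis configurations that occur in `ψ`, of the number of nonempty registers
that are swapped across links. -/
def quantumMsgs (ψ : 𝒜.GlobalBasis N → ℂ) : ℕ :=
  (Finset.univ.filter fun x => ψ x ≠ 0).sup fun x => ∑ v, (x v).load

/-- The number of classical messages sent in a round. -/
def classicalMsgs (out : (v : Fin n) → Fin (N.deg v) → Option (Bits k)) : ℕ :=
  ∑ v, (Finset.univ.filter fun i => (out v i).isSome).card

open scoped Classical in
/-- One synchronous round, for the given outcomes of the local operations: the local operations,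
then the delivery of the classical messages and the quantum routing. A sleeping node that receives
a classical message is awake from the beginning of the next round. -/
def step (advice : Fin n → List Bool) (c : 𝒜.Config N) (o : 𝒜.Outcomes) : 𝒜.Config N :=
  let out : (v : Fin n) → Fin (N.deg v) → Option (Bits k) :=
    fun v => 𝒜.nodeSend (N.deg v) (c.inbox v) (c.state v) (o v)
  let inbox' : (v : Fin n) → Fin (N.deg v) → Option (Bits k) :=
    fun v i => out (N.peer v i) (N.backPort v i)
  let ψ := 𝒜.localAmp N c o
  { state := fun v =>
      if c.state v = none ∧ ∃ i, inbox' v i ≠ none then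
        some (𝒜.start v (N.deg v) (advice v))
      else 𝒜.nodeNext (N.deg v) (c.inbox v) (c.state v) (o v)
    inbox := inbox'
    amp := fun x => ψ (𝒜.route N x)
    msgs := c.msgs + classicalMsgs N out + 𝒜.quantumMsgs N ψ }

/-- The configuration reached after the rounds whose outcomes are listed, in order, in `h`. -/
def run (A : Finset (Fin n)) (advice : Fin n → List Bool) (h : List 𝒜.Outcomes) : 𝒜.Config N :=
  h.foldl (𝒜.step N advice) (𝒜.initial N A advice)

open scoped Classical in
/-- The probability that the sequence of outcomes of the first `t` rounds satisfies `E`. -/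
def prob (A : Finset (Fin n)) (advice : Fin n → List Bool) (t : ℕ)
    (E : List 𝒜.Outcomes → Prop) : ℝ :=
  ∑ h : Fin t → 𝒜.Outcomes,
    if E (List.ofFn h) then ∑ x, ‖(𝒜.run N A advice (List.ofFn h)).amp x‖ ^ 2 else 0

end Execution

/-- All nodes are awake. -/
def Config.AllAwake {𝒜 : Algorithm n k} {N : Network n} (c : 𝒜.Config N) : Prop :=
  ∀ v, c.state v ≠ none

/-- All nodes are awake and have terminated. -/
def Config.AllHalted {𝒜 : Algorithm n k} {N : Network n} (c : 𝒜.Config N) : Prop :=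
  ∀ v, ∃ s, c.state v = some s ∧ 𝒜.halted s

end Algorithm

end

/-! The nodes act one at a time, each in its own slot of a common cyclic clock. In the first slot at
whose beginning it is awake, a node has its turn and wakes all its sleeping neighbours. One cycle of
`n` slots therefore enlarges the awake set by one unit of distance, and a slot of O(n log n) rounds
suffices; this gives both time bounds.

Sleeping neighbours are found by Grover search with a single quantum message in superposition over
ports. A sleeping neighbour sends it back with the phase -1 into the receive register of the
searcher; an awake one leaves it alone, and the swap of registers returns it to the emission
register. A second trip brings every component back to the emission register, so four rounds
implement a phase oracle for "asleep". A measurement after only two rounds reads off which neighbour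
was reached and whether it sleeps, so a reported sleeper is never an error. The number of sleepers
is unknown; searches with `2q + 1 = 3 ^ a` for `a = 0, 1, …` are tried, each `R = O(log n)` times,
and a success restarts at `a = 0`.

If all searches succeed, the set of awake nodes at the beginning of each slot depends only on the
network and on `A`, although the order of discoveries inside a turn is random. The oracle can thus
compute it. Ports are cut into at most `2 ^ β` blocks of length about `n / 2 ^ β`. A node is told
its first block with a sleeping neighbour and, since the node that will wake it is determined
(`target_unique`), also the next such block of its waker, which it reports when woken. So every
block searched contains a sleeper, except the single block of a node that has none, and each
fruitless final pass over a block is paid by a success in it or by the end of the turn.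

The failure probability is bounded by a supermartingale (`continuationWeight_ge`): the number of
sleeping nodes plus a penalty that is multiplied by 4/3 with each failure at the critical level,
where `3 ^ a * θ ≤ π / 2 < 3 ^ (a + 1) * θ`. There a search succeeds with probability at least 1/4
(`Grover.sum_unmarked_le`), and the unit by which a success lowers the first term pays for the fresh
penalty 1. The plan is abandoned only after `R` critical failures, at potential `(4 / 3) ^ R`,
against `1 + n` initially.

As long as the plan holds, time and messages are bounded deterministically by the invariant
`Progress`. At most one message is sent per round, and a pass over all levels takes O(R √(n / 2 ^
β)) rounds; at most `3 n` such passes are charged. -/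

/-! ### Norm preservation for tensor products of instruments. -/

/-- A tensor product of quantum instruments preserves the total squared norm. -/
theorem sum_norm_sq_tensor {ι O : Type*} [Fintype ι] [DecidableEq ι] [Fintype O]
    {X : ι → Type*} [∀ v, Fintype (X v)] [∀ v, DecidableEq (X v)]
    (M : ∀ v, O → Matrix (X v) (X v) ℂ) (hM : ∀ v, ∑ o, (M v o)ᴴ * M v o = 1)
    (a : (∀ v, X v) → ℂ) :
    ∑ o : ι → O, ∑ x : ∀ v, X v, ‖∑ y, (∏ v, M v (o v) (x v) (y v)) * a y‖ ^ 2 =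
      ∑ y, ‖a y‖ ^ 2 := by
  have key : ∀ y y' : ∀ v, X v,
      ∑ o : ι → O, ∑ x : ∀ v, X v,
        star (∏ v, M v (o v) (x v) (y v)) * (∏ v, M v (o v) (x v) (y' v)) =
      if y = y' then 1 else 0 := by
    intro y y'
    have h1 : ∀ v, ∑ o : O, ∑ x : X v, star (M v o x (y v)) * M v o x (y' v) =
        if y v = y' v then 1 else 0 := by
      intro v
      have := congrFun (congrFun (hM v) (y v)) (y' v)
      rw [Matrix.sum_apply] at this
      simpa [Matrix.mul_apply, Matrix.one_apply] using this
    have h2 : ∀ o : ι → O, ∑ x : ∀ v, X v,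
        star (∏ v, M v (o v) (x v) (y v)) * (∏ v, M v (o v) (x v) (y' v)) =
        ∏ v, ∑ x : X v, star (M v (o v) x (y v)) * M v (o v) x (y' v) := by
      intro o
      rw [Fintype.prod_sum]
      refine Finset.sum_congr rfl fun x _ => ?_
      rw [star_prod, Finset.prod_mul_distrib]
    simp_rw [h2]
    rw [← Fintype.prod_sum fun v o => ∑ x : X v, star (M v o x (y v)) * M v o x (y' v)]
    simp_rw [h1]
    by_cases h : y = y'
    · subst h; simp
    · rw [if_neg h]
      obtain ⟨v, hv⟩ := Function.ne_iff.mp h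
      exact Finset.prod_eq_zero (Finset.mem_univ v) (if_neg hv)
  have hnorm : ∀ w : ℂ, ((‖w‖ ^ 2 : ℝ) : ℂ) = star w * w := by
    intro w
    have := Complex.conj_mul' w
    rw [Complex.ofReal_pow]
    exact this.symm
  apply Complex.ofReal_injective
  push_cast
  have hnorm' : ∀ w : ℂ, ((‖w‖ : ℂ)) ^ 2 = star w * w := fun w => by
    rw [← hnorm w]; push_cast; rfl
  simp_rw [hnorm', star_sum, star_mul', Finset.sum_mul_sum]
  calc _ = ∑ y, ∑ y', (∑ o : ι → O, ∑ x : ∀ v, X v,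
        star (∏ v, M v (o v) (x v) (y v)) * (∏ v, M v (o v) (x v) (y' v))) *
          (star (a y) * a y') := by
        simp_rw [Finset.sum_mul]
        simp_rw [Finset.sum_comm (s := (Finset.univ : Finset (∀ v, X v)))
          (t := (Finset.univ : Finset (ι → O)))]
        refine Finset.sum_congr rfl fun o _ => ?_
        rw [Finset.sum_comm]
        refine Finset.sum_congr rfl fun y _ => ?_
        rw [Finset.sum_comm]
        refine Finset.sum_congr rfl fun y' _ => ?_
        refine Finset.sum_congr rfl fun x _ => ?_
        ring
    _ = _ := by simp_rw [key]; simp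

/-! ### Links and ports. -/

namespace Network

variable {n : ℕ} (N : Network n)

/-- The other end of a link. -/
def flip (p : Σ v, Fin (N.deg v)) : Σ v, Fin (N.deg v) := ⟨N.peer p.1 p.2, N.backPort p.1 p.2⟩

theorem sigma_port_ext {p q : Σ v, Fin (N.deg v)} (h₁ : p.1 = q.1)
    (h₂ : N.peer p.1 p.2 = N.peer q.1 q.2) : p = q := by
  obtain ⟨v, i⟩ := p
  obtain ⟨w, j⟩ := q
  obtain rfl : v = w := h₁
  have : i = j := (N.port v).injective (Subtype.ext h₂)
  rw [this]

theorem peer_flip (p : Σ v, Fin (N.deg v)) : N.peer (N.flip p).1 (N.flip p).2 = p.1 := by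
  change ((N.port (N.peer p.1 p.2)) ((N.port (N.peer p.1 p.2)).symm _)).1 = p.1
  rw [Equiv.apply_symm_apply]

theorem flip_flip (p : Σ v, Fin (N.deg v)) : N.flip (N.flip p) = p :=
  N.sigma_port_ext (N.peer_flip p) (by rw [N.peer_flip]; rfl)

theorem flip_eq_iff {p q : Σ v, Fin (N.deg v)} : N.flip p = q ↔ p = N.flip q :=
  ⟨fun h => by rw [← h, N.flip_flip], fun h => by rw [h, N.flip_flip]⟩

theorem peer_injective (v : Fin n) : Function.Injective (N.peer v) :=
  fun _ _ h => (N.port v).injective (Subtype.ext h)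

theorem adj_peer (v : Fin n) (i : Fin (N.deg v)) : N.graph.Adj v (N.peer v i) := (N.port v i).2

theorem exists_port {v w : Fin n} (h : N.graph.Adj v w) : ∃ i, N.peer v i = w :=
  ⟨(N.port v).symm ⟨w, h⟩, by simp [peer]⟩

theorem peer_ne (v : Fin n) (i : Fin (N.deg v)) : N.peer v i ≠ v := (N.adj_peer v i).ne'

theorem deg_le (v : Fin n) : N.deg v ≤ n := by
  have := Fintype.card_le_of_injective _ (N.peer_injective v)
  simpa using this

end Network

/-! ### Branch probabilities and the supermartingale bound. -/

theorem sleepNIC_complete (Mem : Type) [Fintype Mem] [DecidableEq Mem] (k d : ℕ) :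
    (sleepNIC Mem k d)ᴴ * sleepNIC Mem k d = 1 := by
  ext y y'
  rw [Matrix.mul_apply, Matrix.one_apply]
  have hneg : ∀ j : ℕ, star ((-1 : ℂ) ^ j) * (-1) ^ j = 1 := by
    intro j
    rw [star_pow, star_neg, star_one, ← mul_pow]; norm_num
  have hinj : (⟨y.mem, y.recv, y.emit⟩ : LocalBasis Mem k d) = ⟨y'.mem, y'.recv, y'.emit⟩ ↔
      y = y' := by
    simp only [LocalBasis.ext_iff]; tauto
  simp only [Matrix.conjTranspose_apply, sleepNIC]
  rw [Finset.sum_eq_single (⟨y.mem, y.recv, y.emit⟩ : LocalBasis Mem k d)]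
  · rw [if_pos rfl]
    by_cases h : y = y'
    · subst h
      rw [if_pos rfl, if_pos rfl, hneg]
    · rw [if_neg (fun h' => h (hinj.mp h')), if_neg h, mul_zero]
  · intro x _ hx
    rw [if_neg hx, star_zero, zero_mul]
  · simp

namespace Algorithm

variable {n k : ℕ} (𝒜 : Algorithm n k) (N : Network n)

theorem nodeOp_complete (d : ℕ) (inbox : Fin d → Option (Bits k)) (s : Option 𝒜.State) :
    ∑ o, (𝒜.nodeOp d inbox s o)ᴴ * 𝒜.nodeOp d inbox s o = 1 := by
  rw [Fintype.sum_option]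
  cases s with
  | none => simp [nodeOp, sleepNIC_complete]
  | some s =>
    by_cases h : 𝒜.halted s
    · simp [nodeOp, h]
    · simp [nodeOp, h, 𝒜.op_complete]

theorem route_route (x : 𝒜.GlobalBasis N) : 𝒜.route N (𝒜.route N x) = x := by
  funext v
  ext1
  · rfl
  · funext i
    exact congrArg (fun p : Σ v, Fin (N.deg v) => (x p.1).emit p.2) (N.flip_flip ⟨v, i⟩)
  · funext i
    exact congrArg (fun p : Σ v, Fin (N.deg v) => (x p.1).recv p.2) (N.flip_flip ⟨v, i⟩)

/-- The squared norm of the joint quantum state, which is the probability of the branch. -/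
noncomputable def Config.weight {𝒜 : Algorithm n k} {N : Network n} (c : 𝒜.Config N) : ℝ := ∑ x, ‖c.amp x‖ ^ 2

theorem Config.weight_nonneg {𝒜 : Algorithm n k} {N : Network n} (c : 𝒜.Config N) :
    0 ≤ c.weight := Finset.sum_nonneg fun _ _ => by positivity

theorem Config.weight_eq_zero {𝒜 : Algorithm n k} {N : Network n} {c : 𝒜.Config N}
    (h : c.amp = 0) : c.weight = 0 := by simp [weight, h]

theorem weight_step (advice : Fin n → List Bool) (c : 𝒜.Config N) (o : 𝒜.Outcomes) :
    (𝒜.step N advice c o).weight = ∑ x, ‖𝒜.localAmp N c o x‖ ^ 2 :=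
  Function.Bijective.sum_comp
    (Function.Involutive.bijective (f := 𝒜.route N) (𝒜.route_route N))
    fun x => ‖𝒜.localAmp N c o x‖ ^ 2

/-- Every local operation is complete, that of a sleeping network card included, and routing only
permutes basis states. So probability is conserved from each branch on, which makes a constant
potential admissible in deterministic rounds. -/
theorem sum_weight_step (advice : Fin n → List Bool) (c : 𝒜.Config N) :
    ∑ o, (𝒜.step N advice c o).weight = c.weight := by
  simp_rw [weight_step]
  exact sum_norm_sq_tensor
    (fun v o => 𝒜.nodeOp (N.deg v) (c.inbox v) (c.state v) o) (fun v => 𝒜.nodeOp_complete _ _ _) c.amp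

open scoped Classical in
/-- The total weight of the continuations of `c` by `t` rounds that satisfy `E`. -/
noncomputable def continuationWeight (advice : Fin n → List Bool) (c : 𝒜.Config N) (t : ℕ)
    (E : List 𝒜.Outcomes → Prop) : ℝ :=
  ∑ h : Fin t → 𝒜.Outcomes,
    if E (List.ofFn h) then ((List.ofFn h).foldl (𝒜.step N advice) c).weight else 0

variable {N} in
theorem continuationWeight_nonneg (advice : Fin n → List Bool) (c : 𝒜.Config N) (t : ℕ)
    (E : List 𝒜.Outcomes → Prop) : 0 ≤ 𝒜.continuationWeight N advice c t E := by
  refine Finset.sum_nonneg fun h _ => ?_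
  split_ifs
  · exact Config.weight_nonneg _
  · exact le_rfl

theorem continuationWeight_succ (advice : Fin n → List Bool) (c : 𝒜.Config N) (t : ℕ)
    (E : List 𝒜.Outcomes → Prop) :
    𝒜.continuationWeight N advice c (t + 1) E =
      ∑ o, 𝒜.continuationWeight N advice (𝒜.step N advice c o) t fun h => E (o :: h) := by
  classical
  unfold continuationWeight
  rw [← (Fin.consEquiv fun _ : Fin (t + 1) => 𝒜.Outcomes).sum_comp, Fintype.sum_prod_type]
  refine Finset.sum_congr rfl fun o _ => Finset.sum_congr rfl fun h _ => ?_
  simp only [Fin.consEquiv, Equiv.coe_fn_mk, List.ofFn_cons, List.foldl_cons]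

theorem continuationWeight_mono (advice : Fin n → List Bool) (c : 𝒜.Config N) (t : ℕ)
    {E E' : List 𝒜.Outcomes → Prop} (h : ∀ l, l.length = t → E l → E' l) :
    𝒜.continuationWeight N advice c t E ≤ 𝒜.continuationWeight N advice c t E' := by
  refine Finset.sum_le_sum fun l _ => ?_
  by_cases hE : E (List.ofFn l)
  · rw [if_pos hE, if_pos (h _ (List.length_ofFn) hE)]
  · rw [if_neg hE]
    split_ifs
    · exact Config.weight_nonneg _
    · exact le_rfl

theorem weight_initial (A : Finset (Fin n)) (advice : Fin n → List Bool) :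
    (𝒜.initial N A advice).weight = 1 := by
  classical
  unfold Config.weight initial
  simp only
  rw [Finset.sum_eq_single (fun _ => ⟨𝒜.mem₀, fun _ => none, fun _ => none⟩)]
  · simp
  · intro x _ hx
    simp [hx]
  · simp

variable {N} in
/-- A supermartingale bound. If `Inv t c φ` expresses that the configuration `c` at time `t` is as
planned with potential at most `φ`, and the potential does not increase in expectation, where
unplanned configurations count with potential `K`, then an execution is as planned up to time `t`
with probability at least `1 - φ / K`. -/
theorem continuationWeight_ge (advice : Fin n → List Bool)
    (Inv : ℕ → 𝒜.Config N → ℝ → Prop) {K : ℝ} (hK : 0 < K)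
    (hpos : ∀ t c φ, Inv t c φ → 0 ≤ φ)
    (hstep : ∀ t c φ, Inv t c φ → ∃ f : 𝒜.Outcomes → ℝ,
      (∀ o, (𝒜.step N advice c o).amp = 0 ∨ K ≤ f o ∨ Inv (t + 1) (𝒜.step N advice c o) (f o)) ∧
      ∑ o, (𝒜.step N advice c o).weight * f o ≤ c.weight * φ)
    (r : ℕ) : ∀ (t : ℕ) (c : 𝒜.Config N) (φ : ℝ), Inv t c φ →
    c.weight * (1 - φ / K) ≤ 𝒜.continuationWeight N advice c r fun l =>
      ∀ j ≤ r, ∃ φ, Inv (t + j) ((l.take j).foldl (𝒜.step N advice) c) φ := by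
  classical
  induction r with
  | zero =>
    intro t c φ h
    have hE : ∀ l : List 𝒜.Outcomes, ∀ j ≤ 0,
        ∃ φ, Inv (t + j) ((l.take j).foldl (𝒜.step N advice) c) φ := by
      intro l j hj
      obtain rfl : j = 0 := by omega
      exact ⟨φ, by simpa using h⟩
    unfold continuationWeight
    rw [Fintype.sum_unique, if_pos (hE _)]
    have h1 : c.weight * (1 - φ / K) ≤ c.weight * 1 := by
      apply mul_le_mul_of_nonneg_left _ c.weight_nonneg
      have := div_nonneg (hpos t c φ h) hK.le
      linarith
    simpa using h1
  | succ r ih =>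
    intro t c φ h
    obtain ⟨f, hf, hsum⟩ := hstep t c φ h
    rw [continuationWeight_succ]
    have hterm : ∀ o, (𝒜.step N advice c o).weight * (1 - f o / K) ≤
        𝒜.continuationWeight N advice (𝒜.step N advice c o) r fun l =>
          ∀ j ≤ r + 1, ∃ φ, Inv (t + j) (((o :: l).take j).foldl (𝒜.step N advice) c) φ := by
      intro o
      -- An unplanned branch has `f o ≥ K`, so its term on the left is nonpositive and nothing need
      -- be known about its future.
      rcases hf o with h0 | hKf | hI
      · rw [Config.weight_eq_zero h0, zero_mul]
        exact continuationWeight_nonneg _ _ _ _ _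
      · refine le_trans ?_ (continuationWeight_nonneg _ _ _ _ _)
        apply mul_nonpos_of_nonneg_of_nonpos (Config.weight_nonneg _)
        rw [sub_nonpos, le_div_iff₀ hK, one_mul]
        exact hKf
      · refine (ih _ _ _ hI).trans (continuationWeight_mono _ _ _ _ _ ?_)
        intro l _ hl j hj
        cases j with
        | zero => exact ⟨φ, by simpa using h⟩
        | succ j =>
          obtain ⟨ψ, hψ⟩ := hl j (by omega)
          refine ⟨ψ, ?_⟩
          rw [List.take_succ_cons, List.foldl_cons, show t + (j + 1) = t + 1 + j by ring]
          exact hψ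
    refine le_trans ?_ (Finset.sum_le_sum fun o _ => hterm o)
    have : ∑ o, (𝒜.step N advice c o).weight * (1 - f o / K) =
        c.weight - (∑ o, (𝒜.step N advice c o).weight * f o) / K := by
      rw [← 𝒜.sum_weight_step N advice c, Finset.sum_div, ← Finset.sum_sub_distrib]
      refine Finset.sum_congr rfl fun o _ => by ring
    rw [this]
    have h2 := div_le_div_of_nonneg_right hsum hK.le
    have h3 : c.weight * (1 - φ / K) = c.weight - c.weight * φ / K := by ring
    linarith

theorem prob_eq_continuationWeight (A : Finset (Fin n)) (advice : Fin n → List Bool) (t : ℕ)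
    (E : List 𝒜.Outcomes → Prop) :
    𝒜.prob N A advice t E = 𝒜.continuationWeight N advice (𝒜.initial N A advice) t E := rfl

end Algorithm

/-! ### States with at most one message in the network. -/

noncomputable section

open scoped Classical in
/-- The vector `∑ i, a i • |Y i⟩`. -/
def superposition {X ι : Type*} [Fintype ι] (Y : ι → X) (a : ι → ℂ) : X → ℂ :=
  fun x => ∑ i, if x = Y i then a i else 0

/-- This passes between a superposition of registers at one node and the superposition of the
network states that extend them. -/
theorem superposition_collapse {X ι κ : Type*} [Fintype ι] [Fintype κ] (Y : ι → X) (e : κ → ι)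
    (a : κ → ℂ) : superposition Y (superposition e a) = superposition (fun i => Y (e i)) a := by
  classical
  funext x
  unfold superposition
  have h : ∀ j, (if x = Y j then ∑ i, (if j = e i then a i else 0) else 0) =
      ∑ i, if j = e i then (if x = Y (e i) then a i else 0) else 0 := by
    intro j
    split_ifs with hj
    · refine Finset.sum_congr rfl fun i _ => ?_
      split_ifs with h1 h2
      · rfl
      · exact absurd (h1 ▸ hj) h2
      · rfl
    · symm
      refine Finset.sum_eq_zero fun i _ => ?_
      split_ifs with h1 h2
      · exact absurd (h1.symm ▸ h2) hj
      · rfl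
      · rfl
  simp_rw [h]
  rw [Finset.sum_comm]
  refine Finset.sum_congr rfl fun i _ => ?_
  simp

namespace Algorithm

variable {n k : ℕ} (𝒜 : Algorithm n k) (N : Network n)

/-- The basis state of a node without messages. -/
def vacuum (d : ℕ) : LocalBasis 𝒜.Mem k d := ⟨𝒜.mem₀, fun _ => none, fun _ => none⟩

/-- The basis state of a node with one message at the port `i`: in the receive register if `b`, and
in the emission register otherwise. -/
def photon (d : ℕ) (i : Fin d) (b : Bool) : LocalBasis 𝒜.Mem k d :=
  ⟨𝒜.mem₀, fun j => if j = i ∧ b = false then some fun _ => false else none,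
    fun j => if j = i ∧ b = true then some fun _ => false else none⟩

/-- The basis state of the network without messages. -/
def globalVacuum : 𝒜.GlobalBasis N := fun v => 𝒜.vacuum (N.deg v)

/-- The basis state of the network with one message, at the link end `p`. -/
def message (p : Σ v, Fin (N.deg v)) (b : Bool) : 𝒜.GlobalBasis N :=
  Function.update (𝒜.globalVacuum N) p.1 (𝒜.photon _ p.2 b)

theorem emit_message (p : Σ v, Fin (N.deg v)) (b : Bool) (q : Σ v, Fin (N.deg v)) :
    (𝒜.message N p b q.1).emit q.2 =
      if q = p ∧ b = false then some fun _ => false else none := by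
  obtain ⟨v, i⟩ := p
  obtain ⟨w, j⟩ := q
  by_cases h : w = v
  · subst h
    simp [message, photon]
  · simp [message, h, globalVacuum, vacuum]

theorem recv_message (p : Σ v, Fin (N.deg v)) (b : Bool) (q : Σ v, Fin (N.deg v)) :
    (𝒜.message N p b q.1).recv q.2 =
      if q = p ∧ b = true then some fun _ => false else none := by
  obtain ⟨v, i⟩ := p
  obtain ⟨w, j⟩ := q
  by_cases h : w = v
  · subst h
    simp [message, photon]
  · simp [message, h, globalVacuum, vacuum]

theorem mem_message (p : Σ v, Fin (N.deg v)) (b : Bool) (w : Fin n) :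
    (𝒜.message N p b w).mem = 𝒜.mem₀ := by
  obtain ⟨v, i⟩ := p
  by_cases h : w = v
  · subst h
    simp [message, photon]
  · simp [message, h, globalVacuum, vacuum]

theorem route_message (p : Σ v, Fin (N.deg v)) (b : Bool) :
    𝒜.route N (𝒜.message N p b) = 𝒜.message N (N.flip p) (!b) := by
  funext v
  ext1
  · rw [mem_message]; exact 𝒜.mem_message N p b v
  · funext i
    have h1 := 𝒜.recv_message N p b (N.flip ⟨v, i⟩)
    have h2 := 𝒜.emit_message N (N.flip p) (!b) ⟨v, i⟩
    refine (h1.trans ?_).trans h2.symm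
    cases b <;> simp [N.flip_eq_iff]
  · funext i
    have h1 := 𝒜.emit_message N p b (N.flip ⟨v, i⟩)
    have h2 := 𝒜.recv_message N (N.flip p) (!b) ⟨v, i⟩
    refine (h1.trans ?_).trans h2.symm
    cases b <;> simp [N.flip_eq_iff]

theorem route_globalVacuum : 𝒜.route N (𝒜.globalVacuum N) = 𝒜.globalVacuum N := rfl

theorem load_vacuum (d : ℕ) : (𝒜.vacuum d).load = 0 := by simp [LocalBasis.load, vacuum]

theorem load_photon (d : ℕ) (i : Fin d) (b : Bool) : (𝒜.photon d i b).load = 1 := by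
  cases b <;> simp [LocalBasis.load, photon, apply_ite Option.isSome, Finset.filter_eq']

theorem sum_load_message (p : Σ v, Fin (N.deg v)) (b : Bool) :
    ∑ v, (𝒜.message N p b v).load = 1 := by
  rw [Finset.sum_eq_single p.1]
  · simp [message, load_photon]
  · intro v _ hv
    simp [message, hv, globalVacuum, load_vacuum]
  · simp

theorem sum_load_globalVacuum : ∑ v, (𝒜.globalVacuum N v).load = 0 := by
  simp [globalVacuum, load_vacuum]

/-- Amplitudes of coinciding basis states may cancel, but the support never leaves the listed
states. With `m = 1` this shows that a single message in superposition over many ports costs one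
message. -/
theorem quantumMsgs_superposition_le {ι : Type*} [Fintype ι] (Y : ι → 𝒜.GlobalBasis N) (a : ι → ℂ)
    (m : ℕ) (h : ∀ i, ∑ v, (Y i v).load ≤ m) : 𝒜.quantumMsgs N (superposition Y a) ≤ m := by
  classical
  unfold quantumMsgs
  refine Finset.sup_le fun x hx => ?_
  have hx' : superposition Y a x ≠ 0 := by simpa using hx
  obtain ⟨i, _, hi⟩ := Finset.exists_ne_zero_of_sum_ne_zero hx'
  have : x = Y i := by
    by_contra hne
    exact hi (if_neg hne)
  rw [this]
  exact h i

theorem superposition_route {ι : Type*} [Fintype ι] (Y : ι → 𝒜.GlobalBasis N) (a : ι → ℂ) :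
    (fun x => superposition Y a (𝒜.route N x)) = superposition (fun i => 𝒜.route N (Y i)) a := by
  funext x
  unfold superposition
  refine Finset.sum_congr rfl fun i _ => ?_
  have : 𝒜.route N x = Y i ↔ x = 𝒜.route N (Y i) :=
    ⟨fun h => by rw [← h, route_route], fun h => by rw [h, route_route]⟩
  by_cases h : x = 𝒜.route N (Y i)
  · exact (if_pos (this.2 h)).trans (if_pos h).symm
  · exact (if_neg fun h' => h (this.1 h')).trans (if_neg h).symm

variable {N}

/-- A zero factor kills the tensor product. All outcomes that differ from the intended ones are
excluded in this way. -/
theorem localAmp_eq_zero (c : 𝒜.Config N) (o : 𝒜.Outcomes) (v : Fin n)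
    (h : 𝒜.nodeOp (N.deg v) (c.inbox v) (c.state v) (o v) = 0) : 𝒜.localAmp N c o = 0 := by
  funext x
  refine Finset.sum_eq_zero fun y _ => ?_
  rw [Finset.prod_eq_zero (Finset.mem_univ v), zero_mul]
  rw [h]; rfl

theorem localAmp_superposition (c : 𝒜.Config N) (o : 𝒜.Outcomes) {ι : Type*} [Fintype ι]
    (Y : ι → 𝒜.GlobalBasis N) (a : ι → ℂ) (hc : c.amp = superposition Y a) :
    𝒜.localAmp N c o = fun x => ∑ i,
      (∏ v, 𝒜.nodeOp (N.deg v) (c.inbox v) (c.state v) (o v) (x v) (Y i v)) * a i := by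
  classical
  funext x
  simp only [localAmp, hc, superposition, Finset.mul_sum]
  rw [Finset.sum_comm]
  refine Finset.sum_congr rfl fun i _ => ?_
  simp

/-- The local operations on basis states that every node maps to a multiple of a basis state. -/
theorem localAmp_monomial (c : 𝒜.Config N) (o : 𝒜.Outcomes) {ι : Type*} [Fintype ι]
    (Y Z : ι → 𝒜.GlobalBasis N) (a : ι → ℂ) (σ : ι → Fin n → ℂ) (hc : c.amp = superposition Y a)
    (h : ∀ i v x, 𝒜.nodeOp (N.deg v) (c.inbox v) (c.state v) (o v) x (Y i v) =
      if x = Z i v then σ i v else 0) :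
    𝒜.localAmp N c o = superposition Z fun i => (∏ v, σ i v) * a i := by
  classical
  rw [𝒜.localAmp_superposition c o Y a hc]
  funext x
  refine Finset.sum_congr rfl fun i _ => ?_
  simp_rw [h]
  by_cases hx : x = Z i
  · subst hx; simp
  · rw [if_neg hx]
    obtain ⟨v, hv⟩ := Function.ne_iff.mp hx
    rw [Finset.prod_eq_zero (Finset.mem_univ v) (if_neg hv), zero_mul]

/-- The operation of a node that only lets its quantum network card run. -/
def passiveOp (T : Finset (Fin n)) (v : Fin n) (d : ℕ) :
    Matrix (LocalBasis 𝒜.Mem k d) (LocalBasis 𝒜.Mem k d) ℂ :=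
  if v ∈ T then 1 else sleepNIC 𝒜.Mem k d

theorem passiveOp_vacuum (T : Finset (Fin n)) (v : Fin n) (d : ℕ) (x : LocalBasis 𝒜.Mem k d) :
    𝒜.passiveOp T v d x (𝒜.vacuum d) = if x = 𝒜.vacuum d then 1 else 0 := by
  by_cases hv : v ∈ T
  · rw [passiveOp, if_pos hv, Matrix.one_apply]
  · rw [passiveOp, if_neg hv]
    simp [sleepNIC, vacuum]
    congr

/-- A sleeping card exchanges the two registers, but the phase counts receive registers only. A
message already in the emission register is moved without a sign, which keeps the return trip from
undoing the phase. -/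
theorem passiveOp_photon (T : Finset (Fin n)) (v : Fin n) (d : ℕ) (i : Fin d) (b : Bool)
    (x : LocalBasis 𝒜.Mem k d) :
    𝒜.passiveOp T v d x (𝒜.photon d i b) =
      if x = 𝒜.photon d i (if v ∈ T then b else !b) then
        if v ∉ T ∧ b = true then -1 else 1 else 0 := by
  by_cases hv : v ∈ T
  · rw [passiveOp, if_pos hv, Matrix.one_apply]
    simp [hv]
  · rw [passiveOp, if_neg hv]
    simp only [hv, if_false, not_false_eq_true, true_and]
    have : (⟨(𝒜.photon d i b).mem, (𝒜.photon d i b).recv, (𝒜.photon d i b).emit⟩ :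
        LocalBasis 𝒜.Mem k d) = 𝒜.photon d i (!b) := by
      cases b <;> simp [photon]
    unfold sleepNIC
    rw [this]
    congr 1
    cases b <;> simp [photon, apply_ite Option.isSome, Finset.filter_eq']

/-- A round in which all nodes are passive, applied to a superposition of single messages. -/
theorem localAmp_passive (c : 𝒜.Config N) (o : 𝒜.Outcomes) (T : Finset (Fin n)) {ι : Type*}
    [Fintype ι] (p : ι → Σ v, Fin (N.deg v)) (b : ι → Bool) (a : ι → ℂ)
    (hop : ∀ v, 𝒜.nodeOp (N.deg v) (c.inbox v) (c.state v) (o v) = 𝒜.passiveOp T v (N.deg v))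
    (hc : c.amp = superposition (fun i => 𝒜.message N (p i) (b i)) a) :
    𝒜.localAmp N c o = superposition
      (fun i => 𝒜.message N (p i) (if (p i).1 ∈ T then b i else !b i))
      fun i => (if (p i).1 ∉ T ∧ b i = true then -1 else 1) * a i := by
  classical
  rw [𝒜.localAmp_monomial c o _
    (fun i => 𝒜.message N (p i) (if (p i).1 ∈ T then b i else !b i)) a
    (fun i v => if v = (p i).1 then if (p i).1 ∉ T ∧ b i = true then -1 else 1 else 1) hc]
  · congr 1
    funext i
    rw [Finset.prod_ite_eq']
    simp
  · intro i v x
    rw [hop]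
    by_cases hv : v = (p i).1
    · subst hv
      simp only [message, Function.update_self, passiveOp_photon, if_true]
    · simp only [message, Function.update_of_ne hv, globalVacuum, passiveOp_vacuum, if_neg hv]

/-- A round in which all messages are at the node `u` and all other nodes are passive. -/
theorem localAmp_active (c : 𝒜.Config N) (o : 𝒜.Outcomes) (T : Finset (Fin n)) (u : Fin n)
    (M : Matrix (LocalBasis 𝒜.Mem k (N.deg u)) (LocalBasis 𝒜.Mem k (N.deg u)) ℂ)
    (f : LocalBasis 𝒜.Mem k (N.deg u) → ℂ)
    (hop : ∀ v, v ≠ u →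
      𝒜.nodeOp (N.deg v) (c.inbox v) (c.state v) (o v) = 𝒜.passiveOp T v (N.deg v))
    (hu : 𝒜.nodeOp (N.deg u) (c.inbox u) (c.state u) (o u) = M)
    (hc : c.amp = superposition (Function.update (𝒜.globalVacuum N) u) f) :
    𝒜.localAmp N c o = superposition (Function.update (𝒜.globalVacuum N) u) (M *ᵥ f) := by
  classical
  rw [𝒜.localAmp_superposition c o _ f hc]
  funext x
  have hprod : ∀ l, (∏ v, 𝒜.nodeOp (N.deg v) (c.inbox v) (c.state v) (o v) (x v)
      (Function.update (𝒜.globalVacuum N) u l v)) =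
      if x = Function.update (𝒜.globalVacuum N) u (x u) then M (x u) l else 0 := by
    intro l
    by_cases hx : x = Function.update (𝒜.globalVacuum N) u (x u)
    · rw [if_pos hx, Finset.prod_eq_single u]
      · rw [hu, Function.update_self]
      · intro v _ hv
        have hxv : x v = 𝒜.vacuum (N.deg v) := by
          rw [hx, Function.update_of_ne hv]; rfl
        rw [hop v hv, Function.update_of_ne hv, hxv]
        exact (𝒜.passiveOp_vacuum _ _ _ _).trans (if_pos rfl)
      · simp
    · rw [if_neg hx]
      obtain ⟨v, hv⟩ := Function.ne_iff.mp hx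
      have hvu : v ≠ u := by
        rintro rfl
        simp at hv
      rw [Function.update_of_ne hvu] at hv
      refine Finset.prod_eq_zero (Finset.mem_univ v) ?_
      rw [hop v hvu, Function.update_of_ne hvu]
      exact (𝒜.passiveOp_vacuum _ _ _ _).trans (if_neg hv)
  simp_rw [hprod]
  unfold superposition
  by_cases hx : x = Function.update (𝒜.globalVacuum N) u (x u)
  · simp only [if_pos hx]
    symm
    rw [Finset.sum_eq_single (x u)]
    · rw [if_pos hx]; rfl
    · intro l _ hl
      refine if_neg fun h => hl ?_
      rw [h, Function.update_self]
    · simp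
  · simp only [if_neg hx, zero_mul, Finset.sum_const_zero]
    symm
    refine Finset.sum_eq_zero fun l _ => if_neg fun h => hx ?_
    rw [h, Function.update_self]

end Algorithm
end

/-! ### Local operators: reflections and destructive readout. -/

noncomputable section

section Superposition

variable {X ι : Type*} [Fintype ι]

theorem superposition_apply {Y : ι → X} (hY : Function.Injective Y) (a : ι → ℂ) (i : ι) :
    superposition Y a (Y i) = a i := by
  classical
  unfold superposition
  rw [Finset.sum_eq_single i]
  · simp
  · intro j _ hj
    exact if_neg fun h => hj (hY h).symm
  · simp

theorem superposition_eq_zero {Y : ι → X} (a : ι → ℂ) {x : X} (hx : ∀ i, x ≠ Y i) :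
    superposition Y a x = 0 :=
  Finset.sum_eq_zero fun i _ => if_neg (hx i)

theorem superposition_ext {Y : ι → X} (hY : Function.Injective Y) {a : ι → ℂ} {f : X → ℂ}
    (h₁ : ∀ i, f (Y i) = a i) (h₂ : ∀ x, (∀ i, x ≠ Y i) → f x = 0) : f = superposition Y a := by
  funext x
  by_cases hx : ∃ i, x = Y i
  · obtain ⟨i, rfl⟩ := hx
    rw [h₁, superposition_apply hY]
  · push Not at hx
    rw [h₂ x hx, superposition_eq_zero a hx]

theorem superposition_congr {Y Y' : ι → X} {a a' : ι → ℂ} (ha : ∀ i, a i = a' i)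
    (hY : ∀ i, a' i ≠ 0 → Y i = Y' i) : superposition Y a = superposition Y' a' := by
  classical
  funext x
  refine Finset.sum_congr rfl fun i _ => ?_
  rw [ha]
  by_cases h : a' i = 0
  · simp [h]
  · rw [hY i h]

theorem superposition_zero {Y : ι → X} : superposition Y (0 : ι → ℂ) = 0 := by
  funext x
  simp [superposition]

theorem sum_mul_superposition [Fintype X] (w : X → ℂ) (Y : ι → X) (a : ι → ℂ) :
    ∑ x, w x * superposition Y a x = ∑ i, w (Y i) * a i := by
  classical
  unfold superposition
  simp_rw [Finset.mul_sum]
  rw [Finset.sum_comm]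
  refine Finset.sum_congr rfl fun i _ => ?_
  simp

theorem sum_norm_sq_superposition_unit [Fintype X] (y : X) (z : ℂ) :
    ∑ x, ‖superposition (fun _ : Unit => y) (fun _ => z) x‖ ^ 2 = ‖z‖ ^ 2 := by
  classical
  simp [superposition, apply_ite norm, ite_pow]

theorem mulVec_superposition [Fintype X] (M : Matrix X X ℂ) (Y : ι → X) (a : ι → ℂ) :
    M *ᵥ superposition Y a = fun x => ∑ i, M x (Y i) * a i := by
  funext x
  exact sum_mul_superposition (M x) Y a

end Superposition

section Householder

variable {X : Type*} [Fintype X] [DecidableEq X]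

/-- The reflection in the hyperplane orthogonal to `w`. -/
def householder (w : X → ℂ) : Matrix X X ℂ :=
  1 - (2 / ∑ x, star (w x) * w x) • Matrix.vecMulVec w (star w)

theorem householder_mulVec (w f : X → ℂ) (y : X) :
    (householder w *ᵥ f) y =
      f y - 2 / (∑ x, star (w x) * w x) * (∑ x, star (w x) * f x) * w y := by
  unfold householder
  rw [Matrix.sub_mulVec, Matrix.one_mulVec, Matrix.smul_mulVec, Matrix.vecMulVec_mulVec]
  simp only [Pi.sub_apply, Pi.smul_apply, smul_eq_mul, dotProduct, Pi.star_apply,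
    MulOpposite.smul_eq_mul_unop, MulOpposite.unop_op]
  ring

/-- The case `w = 0` is included: the coefficient is then `2 / 0 = 0` and the operator is the
identity. -/
theorem householder_complete (w : X → ℂ) : (householder w)ᴴ * householder w = 1 := by
  set N : ℂ := ∑ x, star (w x) * w x with hN
  have hstarN : star N = N := by
    rw [hN, star_sum]
    refine Finset.sum_congr rfl fun x _ => ?_
    rw [star_mul', star_star, mul_comm]
  have hP : (Matrix.vecMulVec w (star w))ᴴ = Matrix.vecMulVec w (star w) := by
    ext x y
    simp [Matrix.vecMulVec_apply, mul_comm]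
  have hPP : Matrix.vecMulVec w (star w) * Matrix.vecMulVec w (star w) =
      N • Matrix.vecMulVec w (star w) := by
    ext x y
    simp only [Matrix.mul_apply, Matrix.vecMulVec_apply, Pi.star_apply, Matrix.smul_apply,
      smul_eq_mul, hN, Finset.sum_mul]
    refine Finset.sum_congr rfl fun z _ => by ring
  have hh : (householder w)ᴴ = householder w := by
    unfold householder
    rw [← hN, Matrix.conjTranspose_sub, Matrix.conjTranspose_one, Matrix.conjTranspose_smul, hP,
      star_div₀, hstarN]
    simp
  rw [hh]
  unfold householder
  rw [← hN]
  rw [sub_mul, one_mul, mul_sub, mul_one, smul_mul_smul_comm, hPP, smul_smul]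
  have hc : 2 / N * (2 / N) * N = 2 / N + 2 / N := by
    by_cases h : N = 0
    · simp [h]
    · field_simp; ring
  rw [hc, add_smul]
  abel

end Householder

section Readout

variable {X O : Type*} [Fintype X] [DecidableEq X] [Fintype O]

open scoped Classical in
/-- The instrument that maps a basis state `y` to the basis state `g y` with the outcome `r y`. -/
def readout (g : X → X) (r : X → O) (o : O) : Matrix X X ℂ :=
  fun x y => if x = g y ∧ r y = o then 1 else 0

/-- A basis state can be recovered from its image and its outcome together, so the operators form an
isometry. -/
theorem readout_complete (g : X → X) (r : X → O)
    (h : ∀ y y', g y = g y' → r y = r y' → y = y') :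
    ∑ o, (readout g r o)ᴴ * readout g r o = 1 := by
  classical
  ext y y'
  rw [Matrix.sum_apply, Matrix.one_apply]
  simp only [Matrix.mul_apply, Matrix.conjTranspose_apply, readout]
  rw [Finset.sum_eq_single (r y)]
  · rw [Finset.sum_eq_single (g y)]
    · by_cases hy : y = y'
      · subst hy; simp
      · rw [if_neg hy, if_neg (c := g y = g y' ∧ _), mul_zero]
        exact fun h' => hy (h y y' h'.1 h'.2.symm)
    · intro x _ hx
      simp [hx]
    · simp
  · intro o _ ho
    refine Finset.sum_eq_zero fun x _ => ?_
    rw [if_neg (fun h' => ho h'.2.symm), star_zero, zero_mul]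
  · simp

end Readout

namespace WakeUp

section Registers

variable (k d : ℕ)

/-- The basis state without messages, for a trivial private memory. -/
def vacuum : LocalBasis Unit k d := ⟨(), fun _ => none, fun _ => none⟩

/-- The basis state with one message at the port `i`. -/
def photon (i : Fin d) (b : Bool) : LocalBasis Unit k d :=
  ⟨(), fun j => if j = i ∧ b = false then some fun _ => false else none,
    fun j => if j = i ∧ b = true then some fun _ => false else none⟩

variable {k d}

theorem photon_injective {i j : Fin d} {b b' : Bool} (h : photon k d i b = photon k d j b') :
    i = j ∧ b = b' := by
  have h1 := congrFun (congrArg LocalBasis.emit h) i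
  have h2 := congrFun (congrArg LocalBasis.recv h) i
  clear h
  cases b <;> cases b' <;> simp_all [photon]

theorem photon_ne_vacuum (i : Fin d) (b : Bool) : photon k d i b ≠ vacuum k d := by
  intro h
  have h1 := congrFun (congrArg LocalBasis.emit h) i
  have h2 := congrFun (congrArg LocalBasis.recv h) i
  clear h
  cases b <;> simp_all [photon, vacuum]

open scoped Classical in
/-- The link end at which a basis state has its message. -/
def reading (n : ℕ) (y : LocalBasis Unit k d) : Option (Fin n × Bool) :=
  if h : ∃ p : Fin d × Bool, p.1.1 < n ∧ y = photon k d p.1 p.2 then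
    some (⟨h.choose.1.1, h.choose_spec.1⟩, h.choose.2) else none

theorem reading_photon {n : ℕ} (i : Fin d) (b : Bool) (hi : i.1 < n) :
    reading n (photon k d i b) = some (⟨i.1, hi⟩, b) := by
  have h : ∃ p : Fin d × Bool, p.1.1 < n ∧ photon k d i b = photon k d p.1 p.2 := ⟨(i, b), hi, rfl⟩
  rw [reading, dif_pos h]
  obtain ⟨h1, h2⟩ := photon_injective h.choose_spec.2
  simp only [← h1, ← h2]

theorem eq_photon_of_reading {n : ℕ} {y : LocalBasis Unit k d} {i : Fin n} {b : Bool}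
    (h : reading n y = some (i, b)) : ∃ hi : i.1 < d, y = photon k d ⟨i.1, hi⟩ b := by
  unfold reading at h
  split_ifs at h with h'
  have h2 := h'.choose_spec.2
  simp only [Option.some.injEq, Prod.mk.injEq] at h
  obtain ⟨h3, h4⟩ := h
  subst h3
  refine ⟨h'.choose.1.2, ?_⟩
  rw [← h4]
  exact h2

open scoped Classical in
/-- The Kraus operators of a measurement of the position of the message, which absorbs it. -/
def absorb (n k d : ℕ) : Option (Fin n × Bool) →
    Matrix (LocalBasis Unit k d) (LocalBasis Unit k d) ℂ :=
  readout (fun y => if reading n y = none then y else vacuum k d) (reading n)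

theorem absorb_complete (n k d : ℕ) : ∑ o, (absorb n k d o)ᴴ * absorb n k d o = 1 := by
  classical
  refine readout_complete _ _ fun y y' hg hr => ?_
  by_cases h : reading n y = none
  · rw [if_pos h, if_pos (hr ▸ h)] at hg
    exact hg
  · obtain ⟨⟨i, b⟩, hib⟩ := Option.ne_none_iff_exists'.mp h
    obtain ⟨hi, hy⟩ := eq_photon_of_reading hib
    obtain ⟨hi', hy'⟩ := eq_photon_of_reading (hr ▸ hib)
    rw [hy, hy']

/-- Every outcome leaves the same empty registers, so only a scalar remains. Distinct ports have
distinct outcomes, hence at most one term of the sum survives. -/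
theorem absorb_mulVec_photon {n : ℕ} (hd : d ≤ n) (b : Fin d → Bool) (a : Fin d → ℂ)
    (o : Option (Fin n × Bool)) :
    absorb n k d o *ᵥ superposition (fun i => photon k d i (b i)) a =
      superposition (fun _ : Unit => vacuum k d)
        fun _ => ∑ i : Fin d, if o = some (Fin.castLE hd i, b i) then a i else 0 := by
  classical
  rw [mulVec_superposition]
  funext x
  have h : ∀ i, absorb n k d o x (photon k d i (b i)) =
      if x = vacuum k d ∧ o = some (Fin.castLE hd i, b i) then 1 else 0 := by
    intro i
    have hr : reading n (photon k d i (b i)) = some (Fin.castLE hd i, b i) :=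
      reading_photon i (b i) (i.2.trans_le hd)
    simp only [absorb, readout, hr]
    simp [eq_comm]
  simp_rw [h]
  by_cases hx : x = vacuum k d <;> simp [superposition, hx]

open scoped Classical in
/-- The unnormalised uniform superposition of a message in the emission registers of the ports in
the set `s`. -/
def uniform (s : Finset (Fin d)) : LocalBasis Unit k d → ℂ :=
  superposition (fun i => photon k d i false) fun i => if i ∈ s then 1 else 0

open scoped Classical in
/-- The normal vector of the reflection that exchanges the vacuum and the normalised uniform
superposition. -/
def prepareVec (s : Finset (Fin d)) : LocalBasis Unit k d → ℂ :=
  fun x => (if x = vacuum k d then (√(s.card : ℝ) : ℂ) else 0) - uniform s x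

theorem emit_injective : Function.Injective fun i : Fin d => photon k d i false :=
  fun _ _ h => (photon_injective h).1

theorem uniform_vacuum (s : Finset (Fin d)) : uniform (k := k) s (vacuum k d) = 0 :=
  superposition_eq_zero _ fun i h => photon_ne_vacuum i false h.symm

theorem uniform_photon (s : Finset (Fin d)) (i : Fin d) [Decidable (i ∈ s)] :
    uniform (k := k) s (photon k d i false) = if i ∈ s then 1 else 0 := by
  refine (superposition_apply (emit_injective (k := k)) _ i).trans ?_
  congr

theorem sum_star_uniform_mul (s : Finset (Fin d)) (a : Fin d → ℂ) :
    ∑ x, star (uniform (k := k) s x) * superposition (fun i => photon k d i false) a x =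
      ∑ i ∈ s, a i := by
  classical
  rw [sum_mul_superposition]
  simp [uniform_photon, apply_ite]

theorem sum_star_uniform_mul_self (s : Finset (Fin d)) :
    ∑ x, star (uniform (k := k) s x) * uniform s x = s.card := by
  classical
  conv_lhs => enter [2, x, 2]; unfold uniform
  rw [sum_star_uniform_mul]
  simp

/-- This reflection is the negative of the usual Grover diffusion; the resulting global sign is the
factor `(-1) ^ q` of `Grover.amplitude`. -/
theorem diffuse (s : Finset (Fin d)) (a : Fin d → ℂ) (ha : ∀ i ∉ s, a i = 0) :
    householder (uniform (k := k) s) *ᵥ superposition (fun i => photon k d i false) a =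
      superposition (fun i => photon k d i false)
        fun i => if i ∈ s then a i - 2 / s.card * ∑ j ∈ s, a j else 0 := by
  classical
  refine superposition_ext emit_injective (fun i => ?_) fun x hx => ?_
  · rw [householder_mulVec, sum_star_uniform_mul_self, sum_star_uniform_mul, uniform_photon,
      superposition_apply emit_injective]
    by_cases hi : i ∈ s
    · simp [hi]
    · simp [hi, ha i hi]
  · rw [householder_mulVec, superposition_eq_zero a hx, uniform, superposition_eq_zero _ hx]
    simp

/-- The vacuum and the uniform superposition are orthogonal. After scaling the vacuum by `√s` they
have equal length, and the reflection along their difference exchanges the two directions. -/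
theorem prepare (s : Finset (Fin d)) (hs : s.Nonempty) (z : ℂ) :
    householder (prepareVec (k := k) s) *ᵥ
        superposition (fun _ : Unit => vacuum k d) (fun _ => z) =
      superposition (fun i => photon k d i false)
        fun i => if i ∈ s then z / (√(s.card : ℝ) : ℂ) else 0 := by
  classical
  have hs0 : (√(s.card : ℝ) : ℂ) ≠ 0 := by
    have : (0 : ℝ) < s.card := by exact_mod_cast hs.card_pos
    exact_mod_cast (Real.sqrt_pos.mpr this).ne'
  have hsq : (√(s.card : ℝ) : ℂ) * (√(s.card : ℝ) : ℂ) = s.card := by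
    rw [← Complex.ofReal_mul, Real.mul_self_sqrt (Nat.cast_nonneg _)]; simp
  have hvac : prepareVec (k := k) s (vacuum k d) = √(s.card : ℝ) := by
    simp [prepareVec, uniform_vacuum]
  have hphot : ∀ i, prepareVec (k := k) s (photon k d i false) = -if i ∈ s then 1 else 0 := by
    intro i
    simp [prepareVec, uniform_photon, photon_ne_vacuum]
  have hN : ∑ x, star (prepareVec (k := k) s x) * prepareVec s x = 2 * s.card := by
    have h1 : ∀ x, star (prepareVec (k := k) s x) * prepareVec s x =
        (if x = vacuum k d then (s.card : ℂ) else 0) + star (uniform (k := k) s x) * uniform s x := by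
      intro x
      by_cases hx : x = vacuum k d
      · subst hx
        rw [hvac, uniform_vacuum]
        simp [hsq]
      · simp [prepareVec, hx]
    simp_rw [h1, Finset.sum_add_distrib, sum_star_uniform_mul_self]
    simp
    ring
  have hI : ∑ x, star (prepareVec (k := k) s x) *
      superposition (fun _ : Unit => vacuum k d) (fun _ => z) x = √(s.card : ℝ) * z := by
    rw [sum_mul_superposition]
    simp [hvac]
  refine superposition_ext emit_injective (fun i => ?_) fun x hx => ?_
  · rw [householder_mulVec, hN, hI, hphot, superposition_eq_zero _ fun _ => photon_ne_vacuum i _]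
    split_ifs
    · rw [← hsq]; field_simp; simp
    · simp
  · rw [householder_mulVec, hN, hI]
    by_cases hv : x = vacuum k d
    · subst hv
      rw [hvac]
      simp only [superposition, Finset.univ_unique, Finset.sum_const, Finset.card_singleton,
        one_smul, if_true]
      rw [← hsq]; field_simp; ring
    · rw [superposition_eq_zero _ fun _ => hv]
      simp [prepareVec, hv, uniform, superposition_eq_zero _ hx]

end Registers

end WakeUp
end

/-! ### The Grover rotation. -/

noncomputable section

namespace Grover

/-- The Grover angle for `m` marked among `s` items. -/
def angle (m s : ℕ) : ℝ := Real.arcsin √(m / s)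

/-- The amplitude of a marked or unmarked item after `q` Grover iterations, where an iteration is
the phase oracle followed by the reflection at the uniform superposition with the sign `-1`. -/
def amplitude (m s q : ℕ) (marked : Prop) [Decidable marked] : ℝ :=
  (-1) ^ q * if marked then Real.sin ((2 * q + 1) * angle m s) / (√s * Real.sin (angle m s))
    else Real.cos ((2 * q + 1) * angle m s) / (√s * Real.cos (angle m s))

variable {m s : ℕ}

theorem ratio_le_one (h : m ≤ s) : (m : ℝ) / s ≤ 1 :=
  div_le_one_of_le₀ (by exact_mod_cast h) (Nat.cast_nonneg _)

theorem sin_angle (h : m ≤ s) : Real.sin (angle m s) = √(m / s) := by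
  refine Real.sin_arcsin (by linarith [Real.sqrt_nonneg ((m : ℝ) / s)]) ?_
  exact Real.sqrt_le_one.mpr (ratio_le_one h)

theorem sin_angle_sq (h : m ≤ s) : Real.sin (angle m s) ^ 2 = m / s := by
  rw [sin_angle h, Real.sq_sqrt (by positivity)]

theorem cos_angle_sq (h : m ≤ s) : Real.cos (angle m s) ^ 2 = 1 - m / s := by
  rw [Real.cos_sq', sin_angle_sq h]

theorem cast_mul_sin_angle_sq (h : m ≤ s) (hs : 0 < s) :
    (s : ℝ) * Real.sin (angle m s) ^ 2 = m := by
  rw [sin_angle_sq h]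
  have : (s : ℝ) ≠ 0 := by positivity
  field_simp

theorem cast_mul_cos_angle_sq (h : m ≤ s) (hs : 0 < s) :
    (s : ℝ) * Real.cos (angle m s) ^ 2 = s - m := by
  rw [cos_angle_sq h]
  have : (s : ℝ) ≠ 0 := by positivity
  field_simp

theorem sin_angle_ne_zero (h : m ≤ s) (hs : 0 < s) (hm : 0 < m) :
    Real.sin (angle m s) ≠ 0 := by
  intro h0
  have := cast_mul_sin_angle_sq h hs
  rw [h0] at this
  have hm' : (0 : ℝ) < m := by exact_mod_cast hm
  norm_num at this
  exact hm'.ne this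

theorem cos_angle_ne_zero (h : m < s) : Real.cos (angle m s) ≠ 0 := by
  intro h0
  have := cast_mul_cos_angle_sq h.le (by omega)
  rw [h0] at this
  have hm' : (m : ℝ) < s := by exact_mod_cast h
  norm_num at this
  linarith

theorem sqrt_ratio_le_angle (h : m ≤ s) : √((m : ℝ) / s) ≤ angle m s := by
  rw [← sin_angle h]
  exact Real.sin_le (Real.arcsin_nonneg.mpr (Real.sqrt_nonneg _))

theorem angle_le : angle m s ≤ Real.pi / 2 := Real.arcsin_le_pi_div_two _

/-- From `√(m / s) = sin θ ≤ θ` and `π ≤ 4`. A bound on the rotation angle becomes a bound on the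
length of a search, as needed for the time estimate and for the choice of the top level. -/
theorem mul_sqrt_le_of_mul_angle_le (h : m ≤ s) (hs : 0 < s) {x : ℝ} (hx0 : 0 ≤ x)
    (hx : x * angle m s ≤ Real.pi / 2) : x * √m ≤ 2 * √s := by
  have h1 : x * √((m : ℝ) / s) ≤ 2 :=
    ((mul_le_mul_of_nonneg_left (sqrt_ratio_le_angle h) hx0).trans hx).trans
      (by linarith [Real.pi_le_four])
  rw [Real.sqrt_div (Nat.cast_nonneg _)] at h1
  have hs' : 0 < √(s : ℝ) := Real.sqrt_pos.mpr (by exact_mod_cast hs)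
  rw [← mul_div_assoc, div_le_iff₀ hs'] at h1
  exact h1

section Sums

variable {ι : Type*} (B : Finset ι) (P : ι → Prop) [DecidablePred P]

theorem card_marked_le : (B.filter P).card ≤ B.card := Finset.card_filter_le _ _

theorem amplitude_zero {i : ι} (hi : i ∈ B) :
    amplitude (B.filter P).card B.card 0 (P i) = 1 / √(B.card : ℝ) := by
  have hs : 0 < B.card := Finset.card_pos.mpr ⟨i, hi⟩
  unfold amplitude
  by_cases hP : P i
  · have := sin_angle_ne_zero (card_marked_le B P) hs
      (Finset.card_pos.mpr ⟨i, Finset.mem_filter.mpr ⟨hi, hP⟩⟩)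
    simp [hP, div_mul_cancel_right₀ this]
  · have := cos_angle_ne_zero (m := (B.filter P).card) (s := B.card)
      (Finset.card_lt_card (Finset.filter_ssubset.mpr ⟨i, hi, hP⟩))
    simp [hP, div_mul_cancel_right₀ this]

theorem sum_ite_filter (x y : ℝ) :
    ∑ j ∈ B, (if P j then x else y) =
      (B.filter P).card * x + ((B.card : ℝ) - (B.filter P).card) * y := by
  have h : (B.card : ℝ) = (B.filter P).card + (B.filter fun j => ¬P j).card := by
    exact_mod_cast (Finset.card_filter_add_card_filter_not (s := B) P).symm
  rw [Finset.sum_ite, Finset.sum_const, Finset.sum_const, nsmul_eq_mul, nsmul_eq_mul, h]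
  ring

/-- In the plane spanned by the marked and the unmarked items, an iteration is a rotation by `2θ` up
to sign. The signed sum of amplitudes is `(-1) ^ q * √s * cos ((2q + 2)θ)`, and the addition
theorems around this middle angle do the rest. -/
theorem amplitude_succ (q : ℕ) {i : ι} (hi : i ∈ B) :
    amplitude (B.filter P).card B.card (q + 1) (P i) =
      (if P i then -1 else 1) * amplitude (B.filter P).card B.card q (P i) -
        2 / B.card * ∑ j ∈ B, (if P j then -1 else 1) *
          amplitude (B.filter P).card B.card q (P j) := by
  have hs : 0 < B.card := Finset.card_pos.mpr ⟨i, hi⟩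
  have hle := card_marked_le B P
  set m := (B.filter P).card with hm
  set s := B.card with hs_def
  set θ := angle m s with hθ
  have hsR : (0 : ℝ) < s := by exact_mod_cast hs
  have hr0 : √(s : ℝ) ≠ 0 := (Real.sqrt_pos.mpr hsR).ne'
  have hrr : √(s : ℝ) * √(s : ℝ) = s := Real.mul_self_sqrt hsR.le
  have hterm : ∀ j, (if P j then (-1 : ℝ) else 1) * amplitude m s q (P j) =
      if P j then -((-1) ^ q * (Real.sin ((2 * q + 1) * θ) / (√s * Real.sin θ)))
        else (-1) ^ q * (Real.cos ((2 * q + 1) * θ) / (√s * Real.cos θ)) := by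
    intro j
    unfold amplitude
    split_ifs <;> ring
  have hsum : ∑ j ∈ B, (if P j then (-1 : ℝ) else 1) * amplitude m s q (P j) =
      (-1) ^ q * √s * Real.cos ((2 * q + 1) * θ + θ) := by
    simp_rw [hterm]
    rw [sum_ite_filter, ← hm, ← hs_def, ← cast_mul_cos_angle_sq hle hs,
      ← cast_mul_sin_angle_sq hle hs, ← hθ, Real.cos_add]
    generalize √(s : ℝ) = r at hrr hr0
    rw [← hrr]
    -- If `sin θ = 0`, nothing is marked and the junk value of the marked amplitude is multiplied by
    -- zero. The same holds below for `cos θ = 0` and the unmarked items.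
    have e1 : r * r * Real.sin θ ^ 2 *
        -((-1) ^ q * (Real.sin ((2 * q + 1) * θ) / (r * Real.sin θ))) =
        -((-1) ^ q * r * (Real.sin ((2 * q + 1) * θ) * Real.sin θ)) := by
      by_cases h0 : Real.sin θ = 0
      · simp [h0]
      · field_simp
    have e2 : r * r * Real.cos θ ^ 2 *
        ((-1) ^ q * (Real.cos ((2 * q + 1) * θ) / (r * Real.cos θ))) =
        (-1) ^ q * r * (Real.cos ((2 * q + 1) * θ) * Real.cos θ) := by
      by_cases h0 : Real.cos θ = 0
      · simp [h0]
      · field_simp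
    rw [e1, e2]
    ring
  rw [hsum, hterm]
  have hx : (2 * ((q + 1 : ℕ) : ℝ) + 1) * θ = ((2 * q + 1) * θ + θ) + θ := by push_cast; ring
  set y := (2 * (q : ℝ) + 1) * θ with hy
  have hy' : y = (y + θ) - θ := by ring
  have hdiv : 2 / (s : ℝ) * ((-1) ^ q * √s * Real.cos (y + θ)) =
      (-1) ^ q * (2 * Real.cos (y + θ) / √s) := by
    clear hsum hterm
    generalize √(s : ℝ) = r at hrr hr0
    rw [← hrr]
    field_simp
  rw [hdiv]
  unfold amplitude
  rw [← hθ, hx, pow_succ]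
  by_cases hP : P i
  · have hθ0 := sin_angle_ne_zero hle hs
      (Finset.card_pos.mpr ⟨i, Finset.mem_filter.mpr ⟨hi, hP⟩⟩)
    rw [← hθ] at hθ0
    rw [if_pos hP, if_pos hP]
    have h1 : Real.sin y = Real.sin (y + θ) * Real.cos θ - Real.cos (y + θ) * Real.sin θ := by
      conv_lhs => rw [hy']
      rw [Real.sin_sub]
    rw [h1, Real.sin_add (y + θ)]
    field_simp
    ring
  · have hθ0 := cos_angle_ne_zero (m := (B.filter P).card) (s := B.card)
      (Finset.card_lt_card (Finset.filter_ssubset.mpr ⟨i, hi, hP⟩))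
    rw [← hm, ← hs_def, ← hθ] at hθ0
    rw [if_neg hP, if_neg hP]
    have h1 : Real.cos y = Real.cos (y + θ) * Real.cos θ + Real.sin (y + θ) * Real.sin θ := by
      conv_lhs => rw [hy']
      rw [Real.cos_sub]
    rw [h1, Real.cos_add (y + θ)]
    field_simp
    ring

/-- If the rotation angle is at least `π / 6` and at most `π / 2`, then the unmarked items have at
most three times the weight of the marked ones. -/
theorem sum_unmarked_le (q : ℕ) (hm : 0 < (B.filter P).card)
    (h₁ : Real.pi / 6 ≤ (2 * q + 1) * angle (B.filter P).card B.card)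
    (h₂ : (2 * q + 1) * angle (B.filter P).card B.card ≤ Real.pi / 2) :
    ∑ i ∈ B, (if P i then 0 else amplitude (B.filter P).card B.card q (P i) ^ 2) ≤
      3 * ∑ i ∈ B, (if P i then amplitude (B.filter P).card B.card q (P i) ^ 2 else 0) := by
  have hle := card_marked_le B P
  have hs : 0 < B.card := hm.trans_le hle
  set m := (B.filter P).card with hm_def
  set s := B.card with hs_def
  set θ := angle m s with hθ
  set y := (2 * (q : ℝ) + 1) * θ with hy
  have hsR : (0 : ℝ) < s := by exact_mod_cast hs
  have hsq : √(s : ℝ) ^ 2 = s := Real.sq_sqrt hsR.le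
  have hu : ∀ i, (if P i then (0 : ℝ) else amplitude m s q (P i) ^ 2) =
      if P i then 0 else Real.cos y ^ 2 / (s * Real.cos θ ^ 2) := by
    intro i
    split_ifs with hP
    · rfl
    · simp only [amplitude, hP, if_false, ← hθ, ← hy]
      rw [mul_pow, ← pow_mul, mul_comm q 2, pow_mul, div_pow, mul_pow, hsq]
      norm_num
  have hk : ∀ i, (if P i then amplitude m s q (P i) ^ 2 else 0) =
      if P i then Real.sin y ^ 2 / (s * Real.sin θ ^ 2) else 0 := by
    intro i
    split_ifs with hP
    · simp only [amplitude, hP, if_true, ← hθ, ← hy]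
      rw [mul_pow, ← pow_mul, mul_comm q 2, pow_mul, div_pow, mul_pow, hsq]
      norm_num
    · rfl
  simp_rw [hu, hk]
  rw [sum_ite_filter, sum_ite_filter, ← hm_def, ← hs_def, cast_mul_cos_angle_sq hle hs,
    cast_mul_sin_angle_sq hle hs]
  have hmR : (m : ℝ) ≠ 0 := by exact_mod_cast hm.ne'
  rw [mul_zero, mul_zero, zero_add, add_zero, mul_div_cancel₀ _ hmR]
  -- The marked items carry the weight `sin² y ≥ 1/4`, the unmarked ones at most `cos² y ≤ 3/4`.
  have hsin : 1 / 2 ≤ Real.sin y := by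
    rw [← Real.sin_pi_div_six]
    exact Real.sin_le_sin_of_le_of_le_pi_div_two (by linarith [Real.pi_pos]) h₂ h₁
  have hcos : Real.cos y ^ 2 ≤ 3 / 4 := by
    rw [Real.cos_sq']; nlinarith
  have h3 : ((s : ℝ) - m) * (Real.cos y ^ 2 / (s - m)) ≤ Real.cos y ^ 2 := by
    by_cases h0 : (s : ℝ) - m = 0
    · rw [h0, zero_mul]; positivity
    · rw [mul_div_cancel₀ _ h0]
  nlinarith

end Sums

end Grover
end

/-! ### The wake-up algorithm. -/

noncomputable section

namespace WakeUp

/-- The number encoded by a message. -/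
def decode {k : ℕ} (m : Bits k) : ℕ := Nat.ofBits m

/-- The message that encodes a number. -/
def encode (k x : ℕ) : Bits k := fun i => x.testBit i

theorem decode_encode {k x : ℕ} (h : x < 2 ^ k) : decode (encode k x) = x := by
  unfold decode encode
  rw [Nat.ofBits_testBit, Nat.mod_eq_of_lt h]

/-- The modes of an awake node. A running node searches the block `block` of its ports for a
sleeping neighbour by a Grover search with `3 ^ level` half-iterations. -/
inductive Mode where
  | wait (clock : ℕ)
  | run (clock block pointer level rep pos : ℕ)
  | done

/-- The classical state of a node: its identifier, the two numbers of its advice, and its mode. -/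
structure NodeState (n : ℕ) where
  id : Fin n
  first : ℕ
  next : ℕ
  mode : Mode

/-- The length of a block of ports. -/
def blockLength (n β : ℕ) : ℕ := n / 2 ^ β + 1

/-- The highest level of a Grover search. -/
def topLevel (n β : ℕ) : ℕ := Nat.log 9 (4 * blockLength n β)

/-- The number of rounds of a time slot. -/
def slotLength (n β R : ℕ) : ℕ := 2 ^ β * (30 * R * blockLength n β) + 4

/-- The number of rounds in which every node has one time slot. -/
def cycle (n β R : ℕ) : ℕ := n * slotLength n β R

/-- The ports of the block `B`. -/
def block (ℓ d B : ℕ) : Finset (Fin d) := Finset.univ.filter fun i => i.1 / ℓ = B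

theorem mem_block {ℓ d B : ℕ} {i : Fin d} : i ∈ block ℓ d B ↔ i.1 / ℓ = B := by simp [block]

theorem card_block_le {ℓ d B : ℕ} (hℓ : 0 < ℓ) : (block ℓ d B).card ≤ ℓ := by
  refine (Finset.card_le_card_of_injOn (t := Finset.range ℓ) (fun i => i.1 % ℓ) ?_ ?_).trans
    (Finset.card_range ℓ).le
  · intro i _
    simpa using Nat.mod_lt _ hℓ
  · intro i hi j hj hij
    have hi' := mem_block.mp hi
    have hj' := mem_block.mp hj
    apply Fin.ext
    rw [← Nat.div_add_mod i.1 ℓ, ← Nat.div_add_mod j.1 ℓ, hi', hj']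
    simp only at hij
    rw [hij]

open scoped Classical in
/-- The number received in the inbox, or `x` if the inbox is empty. -/
def heard {k d : ℕ} (inbox : Fin d → Option (Bits k)) (x : ℕ) : ℕ :=
  if h : ∃ m, ∃ i, inbox i = some m then decode h.choose else x

theorem heard_none {k d : ℕ} {inbox : Fin d → Option (Bits k)} (h : ∀ i, inbox i = none) (x : ℕ) :
    heard inbox x = x := by
  unfold heard
  rw [dif_neg]
  simp [h]

theorem heard_single {k d : ℕ} {inbox : Fin d → Option (Bits k)} {i : Fin d} {m : Bits k}
    (hi : inbox i = some m) (h : ∀ j, j ≠ i → inbox j = none) (x : ℕ) :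
    heard inbox x = decode m := by
  have he : ∃ m, ∃ i, inbox i = some m := ⟨m, i, hi⟩
  unfold heard
  rw [dif_pos he]
  congr 1
  obtain ⟨j, hj⟩ := he.choose_spec
  by_cases hji : j = i
  · rw [hji, hi] at hj
    exact (Option.some.inj hj).symm
  · rw [h j hji] at hj
    simp at hj

section Transitions

variable (n k β R : ℕ)

/-- The next value of the clock, which counts the rounds of a cycle. -/
def tick (τ : ℕ) : ℕ := (τ + 1) % cycle n β R

/-- The mode after a Grover search that has found nothing. -/
def failMode (τ B ptr a rep : ℕ) : Mode :=
  if rep + 1 < R then .run τ B ptr a (rep + 1) 0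
  else if a < topLevel n β then .run τ B ptr (a + 1) 0 0
  else if ptr = B then .done
  else .run τ ptr ptr 0 0 0

variable {n k}

/-- The next mode of a node. -/
def nextMode {d : ℕ} (s : NodeState n) (inbox : Fin d → Option (Bits k))
    (o : Option (Fin n × Bool)) : Mode :=
  match s.mode with
  | .wait τ =>
    if heard inbox τ = s.id.1 * slotLength n β R + 1 then
      -- The pointer starts at the block itself, which also serves as the end mark: a turn that
      -- finds nothing stops after this block.
      .run (tick n β R (heard inbox τ)) s.first s.first 0 0 0
    else .wait (tick n β R (heard inbox τ))
  | .run τ B ptr a rep pos =>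
    if pos < 2 * 3 ^ a + 1 then .run (tick n β R τ) B (heard inbox ptr) a rep (pos + 1)
    else
      match o with
      | some (_, true) => .run (tick n β R τ) B (heard inbox ptr) 0 0 0
      | _ => failMode n β R (tick n β R τ) B (heard inbox ptr) a rep
  | .done => .done

open scoped Classical in
/-- The classical messages sent by a node. -/
def outgoing {d : ℕ} (s : NodeState n) (inbox : Fin d → Option (Bits k))
    (o : Option (Fin n × Bool)) (i : Fin d) : Option (Bits k) :=
  match s.mode with
  | .wait _ => (inbox i).map fun _ => encode k s.next
  | .run τ _ _ a _ pos =>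
    if 2 * 3 ^ a + 1 ≤ pos ∧ ∃ j : Fin n, j.1 = i.1 ∧ o = some (j, true) then
      some (encode k (tick n β R τ))
    else none
  | .done => none

/-- The instrument with only one possible outcome that applies a unitary operator. -/
def unitaryOp {X : Type*} (U : Matrix X X ℂ) (o : Option (Fin n × Bool)) : Matrix X X ℂ :=
  if o = none then U else 0

theorem unitaryOp_complete {X : Type*} [Fintype X] [DecidableEq X] (U : Matrix X X ℂ)
    (hU : Uᴴ * U = 1) :
    ∑ o : Option (Fin n × Bool), (unitaryOp U o)ᴴ * unitaryOp U o = 1 := by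
  rw [Fintype.sum_option]
  simp [unitaryOp, hU]

variable (k)

/-- The unitary operator applied in the round `pos` of a Grover search. -/
def searchUnitary (d : ℕ) (s : Finset (Fin d)) (pos : ℕ) :
    Matrix (LocalBasis Unit k d) (LocalBasis Unit k d) ℂ :=
  if pos = 1 then householder (prepareVec s)
  else if pos % 4 = 1 then householder (uniform s)
  else 1

theorem searchUnitary_complete (d : ℕ) (s : Finset (Fin d)) (pos : ℕ) :
    (searchUnitary k d s pos)ᴴ * searchUnitary k d s pos = 1 := by
  unfold searchUnitary
  split_ifs
  · exact householder_complete _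
  · exact householder_complete _
  · simp

/-- The Kraus operators of a node. -/
def operation (d : ℕ) (s : NodeState n) :
    Option (Fin n × Bool) → Matrix (LocalBasis Unit k d) (LocalBasis Unit k d) ℂ :=
  match s.mode with
  | .run _ B _ a _ pos =>
    if 2 * 3 ^ a + 1 ≤ pos then absorb n k d
    else unitaryOp (searchUnitary k d (block (blockLength n β) d B) pos)
  | _ => unitaryOp 1

theorem operation_complete (d : ℕ) (s : NodeState n) :
    ∑ o, (operation k β d s o)ᴴ * operation k β d s o = 1 := by
  obtain ⟨v, f, g, md⟩ := s
  cases md with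
  | run τ B ptr a rep pos =>
    by_cases h : 2 * 3 ^ a + 1 ≤ pos
    · simpa only [operation, if_pos h] using absorb_complete n k d
    · simpa only [operation, if_neg h] using
        unitaryOp_complete _ (searchUnitary_complete k d (block (blockLength n β) d B) pos)
  | _ => exact unitaryOp_complete _ (by simp)

/-- The number encoded by `β` bits of an advice string from the position `j` on. -/
def readAdvice (j : ℕ) (s : List Bool) : ℕ := Nat.ofBits fun i : Fin β => s.getD (j + i.1) false

/-- The wake-up algorithm. Time is divided into slots, which the nodes own in turn. A node that is
awake at the beginning of its slot searches its ports for sleeping neighbours, block by block, by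
Grover searches with a message that a sleeping neighbour sends back with the phase `-1`, and wakes
the neighbours it finds with the current time; they answer with a pointer to the next block. -/
abbrev algorithm (n k β R : ℕ) : Algorithm n k where
  State := NodeState n
  Mem := Unit
  Outcome := Option (Fin n × Bool)
  mem₀ := ()
  start v _ s := ⟨v, readAdvice β 0 s, readAdvice β β s, .wait 0⟩
  op d s _ o := operation k β d s o
  op_complete d s _ := operation_complete k β d s
  next _ s inbox o := { s with mode := nextMode β R s inbox o }
  send _ s inbox o := outgoing β R s inbox o
  halted s := s.mode = .done

end Transitions

/-- Since degrees are at most `n`, there are at most `2 ^ β` blocks and a block number fits into `β`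
bits. -/
theorem lt_blockLength_mul (n β : ℕ) : n < 2 ^ β * blockLength n β := by
  unfold blockLength
  have := Nat.lt_mul_div_succ n (Nat.two_pow_pos β)
  simpa using this

theorem block_lt {n : ℕ} {N : Network n} (β : ℕ) {v : Fin n} (i : Fin (N.deg v)) : i.1 / blockLength n β < 2 ^ β := by
  rw [Nat.div_lt_iff_lt_mul (by simp [blockLength])]
  exact (i.2.trans_le (N.deg_le v)).trans (lt_blockLength_mul n β)

/-! ### The ideal schedule and the advice. -/

section Oracle

variable {n : ℕ} [NeZero n] (N : Network n) (A : Finset (Fin n)) (ℓ : ℕ)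

/-- The node that owns the time slot `k`. -/
def owner (n : ℕ) [NeZero n] (k : ℕ) : Fin n := Fin.ofNat n k

theorem owner_add_mul (κ : ℕ) (w : Fin n) : owner n (κ * n + w.1) = w := by
  apply Fin.ext
  simp [owner, Nat.mod_eq_of_lt w.2]

open scoped Classical in
/-- The nodes that are awake at the beginning of the time slot `k`, if all searches succeed. -/
def awakeAt : ℕ → Finset (Fin n)
  | 0 => A
  | k + 1 => if owner n k ∈ awakeAt k then
      awakeAt k ∪ Finset.univ.filter (N.graph.Adj (owner n k)) else awakeAt k

open scoped Classical in
/-- The nodes that have had their turn before the time slot `k`. -/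
def doneAt (k : ℕ) : Finset (Fin n) :=
  Finset.univ.filter fun w => ∃ j < k, owner n j = w ∧ w ∈ awakeAt N A j

/-- The owner of the time slot `k` has its turn in this slot. -/
def Turn (k : ℕ) : Prop := owner n k ∈ awakeAt N A k ∧ owner n k ∉ doneAt N A k

variable {N A}

theorem mem_doneAt {k : ℕ} {w : Fin n} :
    w ∈ doneAt N A k ↔ ∃ j < k, owner n j = w ∧ w ∈ awakeAt N A j := by simp [doneAt]

theorem mem_awakeAt_succ {k : ℕ} {w : Fin n} : w ∈ awakeAt N A (k + 1) ↔
    w ∈ awakeAt N A k ∨ owner n k ∈ awakeAt N A k ∧ N.graph.Adj (owner n k) w := by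
  rw [awakeAt]
  split_ifs with h <;> simp [h]

theorem awakeAt_mono : Monotone (awakeAt N A) :=
  monotone_nat_of_le_succ fun _ _ hw => mem_awakeAt_succ.mpr (Or.inl hw)

theorem doneAt_subset (k : ℕ) : doneAt N A k ⊆ awakeAt N A k := by
  intro w hw
  obtain ⟨j, hj, _, h⟩ := mem_doneAt.mp hw
  exact awakeAt_mono hj.le h

theorem mem_doneAt_succ {k : ℕ} {w : Fin n} : w ∈ doneAt N A (k + 1) ↔
    w ∈ doneAt N A k ∨ owner n k = w ∧ w ∈ awakeAt N A k := by
  simp only [mem_doneAt]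
  constructor
  · rintro ⟨j, hj, h⟩
    rcases (Nat.lt_succ_iff_lt_or_eq.mp hj) with h' | rfl
    · exact Or.inl ⟨j, h', h⟩
    · exact Or.inr h
  · rintro (⟨j, hj, h⟩ | h)
    · exact ⟨j, by omega, h⟩
    · exact ⟨k, by omega, h⟩

theorem adj_mem_awakeAt {k : ℕ} {v w : Fin n} (hv : v ∈ doneAt N A k) (h : N.graph.Adj v w) :
    w ∈ awakeAt N A k := by
  obtain ⟨j, hj, rfl, hj'⟩ := mem_doneAt.mp hv
  exact awakeAt_mono (Nat.succ_le_of_lt hj) (mem_awakeAt_succ.mpr (Or.inr ⟨hj', h⟩))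

theorem doneAt_succ_of_not_turn {k : ℕ} (h : ¬Turn N A k) : doneAt N A (k + 1) = doneAt N A k := by
  ext w
  rw [mem_doneAt_succ]
  refine ⟨?_, Or.inl⟩
  rintro (h' | ⟨rfl, h'⟩)
  · exact h'
  · by_contra h''
    exact h ⟨h', h''⟩

/-- `awakeAt` lets an awake owner act in each of its slots, but the algorithm gives it only one
turn. The two agree because all neighbours of a node that has had its turn are already awake. -/
theorem awakeAt_succ_of_not_turn {k : ℕ} (h : ¬Turn N A k) :
    awakeAt N A (k + 1) = awakeAt N A k := by
  ext w
  rw [mem_awakeAt_succ]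
  refine ⟨?_, Or.inl⟩
  rintro (h' | ⟨h', hw⟩)
  · exact h'
  · refine adj_mem_awakeAt ?_ hw
    by_contra h''
    exact h ⟨h', h''⟩

theorem doneAt_succ_of_turn {k : ℕ} (h : Turn N A k) :
    doneAt N A (k + 1) = insert (owner n k) (doneAt N A k) := by
  ext w
  rw [mem_doneAt_succ, Finset.mem_insert]
  constructor
  · rintro (h' | ⟨rfl, _⟩)
    · exact Or.inr h'
    · exact Or.inl rfl
  · rintro (rfl | h')
    · exact Or.inr ⟨rfl, h.1⟩
    · exact Or.inl h'

theorem Turn.unique {k k' : ℕ} (h : Turn N A k) (h' : Turn N A k')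
    (ho : owner n k = owner n k') : k = k' := by
  rcases lt_trichotomy k k' with hlt | rfl | hlt
  · exact absurd (mem_doneAt.mpr ⟨k, hlt, ho, ho ▸ h.1⟩) h'.2
  · rfl
  · exact absurd (mem_doneAt.mpr ⟨k', hlt, ho.symm, ho ▸ h'.1⟩) h.2

variable (N A)

/-- The port `i` of the owner of the slot `k` leads to a node that is asleep when the slot
begins. -/
def Target (k : ℕ) (i : Fin (N.deg (owner n k))) : Prop := N.peer (owner n k) i ∉ awakeAt N A k

/-- The first block with a target. -/
def firstBlock (k : ℕ) : ℕ := sInf {B | ∃ i, Target N A k i ∧ i.1 / ℓ = B}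

open scoped Classical in
/-- The next block after `B` with a target, and `B` if there is none. -/
def nextBlock (k B : ℕ) : ℕ :=
  if ∃ i, Target N A k i ∧ B < i.1 / ℓ then
    sInf {B' | B < B' ∧ ∃ i, Target N A k i ∧ i.1 / ℓ = B'}
  else B

open scoped Classical in
/-- The block in which the node `v` starts. -/
def startBlock (v : Fin n) : ℕ :=
  if h : ∃ k, Turn N A k ∧ owner n k = v then firstBlock N A ℓ h.choose else 0

open scoped Classical in
/-- The block in which the node that wakes `w` continues after the block of `w`. -/
def siblingBlock (w : Fin n) : ℕ :=
  if h : ∃ (k : ℕ) (i : Fin (N.deg (owner n k))),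
      Turn N A k ∧ Target N A k i ∧ N.peer (owner n k) i = w then
    nextBlock N A ℓ h.choose (h.choose_spec.choose.1 / ℓ)
  else 0

variable {N A ℓ}

theorem startBlock_eq {k : ℕ} (h : Turn N A k) :
    startBlock N A ℓ (owner n k) = firstBlock N A ℓ k := by
  have he : ∃ j, Turn N A j ∧ owner n j = owner n k := ⟨k, h, rfl⟩
  rw [startBlock, dif_pos he]
  rw [he.choose_spec.1.unique h he.choose_spec.2]

/-- After a turn all neighbours of the owner are awake, so none can be a target of a later turn.
Every sleeping node thus has one predictable waker, and a pointer for the waker can be stored in its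
advice. -/
theorem target_unique {k k' : ℕ} {i : Fin (N.deg (owner n k))} {i' : Fin (N.deg (owner n k'))}
    (h : Turn N A k) (h' : Turn N A k') (hi : Target N A k i) (hi' : Target N A k' i')
    (hp : N.peer _ i = N.peer _ i') : k = k' := by
  rcases lt_trichotomy k k' with hlt | rfl | hlt
  · refine absurd (awakeAt_mono (Nat.succ_le_of_lt hlt) (mem_awakeAt_succ.mpr (Or.inr ⟨h.1, ?_⟩))) hi'
    rw [← hp]
    exact N.adj_peer _ _
  · rfl
  · refine absurd (awakeAt_mono (Nat.succ_le_of_lt hlt) (mem_awakeAt_succ.mpr (Or.inr ⟨h'.1, ?_⟩))) hi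
    rw [hp]
    exact N.adj_peer _ _

/-- All targets in one block carry the same pointer, so it does not matter which of them is found.
-/
theorem siblingBlock_eq {k : ℕ} {i : Fin (N.deg (owner n k))} (h : Turn N A k)
    (hi : Target N A k i) :
    siblingBlock N A ℓ (N.peer (owner n k) i) = nextBlock N A ℓ k (i.1 / ℓ) := by
  have he : ∃ (k' : ℕ) (i' : Fin (N.deg (owner n k'))), Turn N A k' ∧ Target N A k' i' ∧
      N.peer (owner n k') i' = N.peer (owner n k) i := ⟨k, i, h, hi, rfl⟩
  rw [siblingBlock, dif_pos he]
  obtain ⟨h1, h2, h3⟩ := he.choose_spec.choose_spec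
  generalize he.choose_spec.choose = i' at *
  generalize he.choose = k' at *
  obtain rfl := target_unique h1 h h2 hi h3
  rw [N.peer_injective _ h3]

theorem firstBlock_le {k : ℕ} {i : Fin (N.deg (owner n k))} (hi : Target N A k i) :
    firstBlock N A ℓ k ≤ i.1 / ℓ := Nat.sInf_le ⟨i, hi, rfl⟩

theorem exists_target_firstBlock {k : ℕ} (h : ∃ i, Target N A k i) :
    ∃ i, Target N A k i ∧ i.1 / ℓ = firstBlock N A ℓ k := by
  obtain ⟨i, hi⟩ := h
  exact Nat.sInf_mem (s := {B | ∃ i, Target N A k i ∧ i.1 / ℓ = B}) ⟨_, i, hi, rfl⟩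

theorem firstBlock_of_not_exists {k : ℕ} (h : ¬∃ i, Target N A k i) : firstBlock N A ℓ k = 0 := by
  unfold firstBlock
  convert Nat.sInf_empty
  ext B
  simp only [Set.mem_ofPred_eq, Set.mem_empty_iff_false, iff_false]
  rintro ⟨i, hi, _⟩
  exact h ⟨i, hi⟩

theorem nextBlock_spec {k B : ℕ} (h : nextBlock N A ℓ k B ≠ B) :
    B < nextBlock N A ℓ k B ∧ (∃ i, Target N A k i ∧ i.1 / ℓ = nextBlock N A ℓ k B) ∧
      ∀ i, Target N A k i → B < i.1 / ℓ → nextBlock N A ℓ k B ≤ i.1 / ℓ := by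
  unfold nextBlock at h ⊢
  split_ifs at h ⊢ with he
  · obtain ⟨i, hi, hB⟩ := he
    have := Nat.sInf_mem (s := {B' | B < B' ∧ ∃ i, Target N A k i ∧ i.1 / ℓ = B'})
      ⟨_, hB, i, hi, rfl⟩
    exact ⟨this.1, this.2, fun j hj hj' => Nat.sInf_le ⟨hj', j, hj, rfl⟩⟩
  · exact absurd rfl h

/-- The default value `B` acts as the end mark: a pointer to the current block means that no later
block has a target. -/
theorem nextBlock_eq_self {k B : ℕ} (h : nextBlock N A ℓ k B = B) (i : Fin (N.deg (owner n k)))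
    (hi : Target N A k i) : i.1 / ℓ ≤ B := by
  by_contra hB
  have he : ∃ i, Target N A k i ∧ B < i.1 / ℓ := ⟨i, hi, by omega⟩
  rw [nextBlock, if_pos he] at h
  have := Nat.sInf_mem (s := {B' | B < B' ∧ ∃ i, Target N A k i ∧ i.1 / ℓ = B'})
    ⟨_, he.choose_spec.2, he.choose, he.choose_spec.1, rfl⟩
  rw [h] at this
  exact absurd this.1 (lt_irrefl _)

/-- In each cycle every node owns a slot. The neighbour of `w` on a shortest path to `a` is awake
one cycle earlier by induction, and its slot in the cycle wakes `w`. -/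
theorem mem_awakeAt_of_dist (κ : ℕ) : ∀ (w a : Fin n), a ∈ A → N.graph.dist w a ≤ κ →
    w ∈ awakeAt N A (κ * n) := by
  induction κ with
  | zero =>
    intro w a ha h
    have : w = a := (N.connected.dist_eq_zero_iff).mp (Nat.le_zero.mp h)
    subst this
    simpa [awakeAt] using ha
  | succ κ ih =>
    intro w a ha h
    have hmono : κ * n ≤ (κ + 1) * n := Nat.mul_le_mul_right _ (Nat.le_succ κ)
    obtain ⟨p, hp⟩ := (N.connected w a).exists_walk_length_eq_dist
    cases p with
    | nil => exact awakeAt_mono hmono (ih w w ha (by simp))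
    | cons hadj p =>
      rename_i w'
      have hw' : w' ∈ awakeAt N A (κ * n) := by
        refine ih w' a ha ((SimpleGraph.dist_le p).trans ?_)
        simp only [SimpleGraph.Walk.length_cons] at hp
        omega
      have h2 : κ * n + w'.1 + 1 ≤ (κ + 1) * n := by
        have := w'.2
        rw [Nat.succ_mul]; omega
      refine awakeAt_mono h2 (mem_awakeAt_succ.mpr (Or.inr ?_))
      rw [owner_add_mul]
      exact ⟨awakeAt_mono (Nat.le_add_right _ _) hw', hadj.symm⟩

theorem mem_awakeAt_awakeDist (hA : A.Nonempty) (w : Fin n) :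
    w ∈ awakeAt N A (N.awakeDist A * n) := by
  by_cases hw : w ∈ A
  · exact awakeAt_mono (Nat.zero_le _) hw
  · obtain ⟨a₀, ha₀⟩ := hA
    obtain ⟨a, ha, h⟩ := Nat.sInf_mem (s := {d : ℕ | ∃ a ∈ A, d = N.graph.dist w a})
      ⟨_, a₀, ha₀, rfl⟩
    refine mem_awakeAt_of_dist _ w a ha ?_
    rw [← h]
    exact Finset.le_sup (f := fun v => sInf {d : ℕ | ∃ a ∈ A, d = N.graph.dist v a})
      (Finset.mem_compl.mpr hw)

theorem mem_doneAt_awakeDist (hA : A.Nonempty) (w : Fin n) :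
    w ∈ doneAt N A ((N.awakeDist A + 1) * n) := by
  refine mem_doneAt.mpr ⟨N.awakeDist A * n + w.1, ?_, owner_add_mul _ _, ?_⟩
  · have := w.2
    rw [Nat.succ_mul]; omega
  · exact awakeAt_mono (Nat.le_add_right _ _) (mem_awakeAt_awakeDist hA w)

variable (N A ℓ) in
/-- The advice of the oracle with `β` bits per pointer. -/
def advice (β : ℕ) (v : Fin n) : List Bool :=
  List.ofFn fun i : Fin (2 * β) =>
    if i.1 < β then (startBlock N A ℓ v).testBit i.1 else (siblingBlock N A ℓ v).testBit (i.1 - β)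

theorem length_advice (β : ℕ) (v : Fin n) : (advice N A ℓ β v).length = 2 * β := by simp [advice]

theorem readAdvice_zero (β : ℕ) (v : Fin n) (h : startBlock N A ℓ v < 2 ^ β) :
    readAdvice β 0 (advice N A ℓ β v) = startBlock N A ℓ v := by
  unfold readAdvice
  refine Eq.trans ?_ ((Nat.ofBits_testBit _ β).trans (Nat.mod_eq_of_lt h))
  congr 1
  funext i
  have : i.1 < 2 * β := by omega
  simp [advice, this]

theorem readAdvice_self (β : ℕ) (v : Fin n) (h : siblingBlock N A ℓ v < 2 ^ β) :
    readAdvice β β (advice N A ℓ β v) = siblingBlock N A ℓ v := by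
  unfold readAdvice
  refine Eq.trans ?_ ((Nat.ofBits_testBit _ β).trans (Nat.mod_eq_of_lt h))
  congr 1
  funext i
  have : β + i.1 < 2 * β := by omega
  simp [advice, this]

theorem firstBlock_lt (β k : ℕ) : firstBlock N A (blockLength n β) k < 2 ^ β := by
  by_cases h : ∃ i, Target N A k i
  · obtain ⟨i, _, hi⟩ := exists_target_firstBlock (ℓ := blockLength n β) h
    rw [← hi]
    exact block_lt β i
  · rw [firstBlock_of_not_exists h]
    exact Nat.two_pow_pos β

theorem nextBlock_lt (β k B : ℕ) (hB : B < 2 ^ β) :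
    nextBlock N A (blockLength n β) k B < 2 ^ β := by
  by_cases h : nextBlock N A (blockLength n β) k B = B
  · rwa [h]
  · obtain ⟨_, ⟨i, _, hi⟩, _⟩ := nextBlock_spec h
    rw [← hi]
    exact block_lt β i

theorem startBlock_lt (β : ℕ) (v : Fin n) : startBlock N A (blockLength n β) v < 2 ^ β := by
  unfold startBlock
  split_ifs
  · exact firstBlock_lt β _
  · exact Nat.two_pow_pos β

theorem siblingBlock_lt (β : ℕ) (v : Fin n) : siblingBlock N A (blockLength n β) v < 2 ^ β := by
  unfold siblingBlock
  split_ifs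
  · exact nextBlock_lt β _ _ (block_lt β _)
  · exact Nat.two_pow_pos β

end Oracle

end WakeUp
end

/-! ### Time and message accounting within a turn. -/

noncomputable section

namespace WakeUp

/-- The number of rounds of a Grover search at level `a`. -/
def runLength (a : ℕ) : ℕ := 2 * 3 ^ a + 2

/-- The number of rounds of `R` Grover searches at each level below `a`. -/
def fullCost (R a : ℕ) : ℕ := ∑ j ∈ Finset.range a, R * runLength j

/-- The number of rounds since the last success. -/
def cost (R a rep pos : ℕ) : ℕ := fullCost R a + rep * runLength a + pos

theorem fullCost_succ (R a : ℕ) : fullCost R (a + 1) = fullCost R a + R * runLength a :=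
  Finset.sum_range_succ _ _

theorem fullCost_succ_le (R a : ℕ) : fullCost R (a + 1) ≤ R * (5 * 3 ^ a) := by
  -- The geometric sum of `2 * 3 ^ j + 2` over `j ≤ b`, which equals `3 ^ (b + 1) - 1 + 2 * (b +
  -- 1)`.
  have h : ∀ b, fullCost R (b + 1) + R ≤ R * (3 ^ (b + 1) + 2 * (b + 1)) := by
    intro b
    induction b with
    | zero => simp [fullCost, runLength]; nlinarith
    | succ b ih =>
      rw [fullCost_succ]
      unfold runLength
      calc _ = fullCost R (b + 1) + R + R * (2 * 3 ^ (b + 1) + 2) := by ring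
        _ ≤ R * (3 ^ (b + 1) + 2 * (b + 1)) + R * (2 * 3 ^ (b + 1) + 2) := by omega
        _ = _ := by ring
  have h2 : a + 1 ≤ 3 ^ a := Nat.lt_pow_self (by norm_num)
  refine (Nat.le_add_right _ R).trans ((h a).trans (Nat.mul_le_mul_left R ?_))
  rw [pow_succ]
  omega

theorem fullCost_mono (R : ℕ) : Monotone (fullCost R) :=
  monotone_nat_of_le_succ fun a => by rw [fullCost_succ]; exact Nat.le_add_right _ _

theorem cost_lt {R a rep pos : ℕ} (hr : rep < R) (hp : pos ≤ 2 * 3 ^ a + 1) :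
    cost R a rep pos < fullCost R (a + 1) := by
  rw [fullCost_succ]
  unfold cost
  have h : (rep + 1) * runLength a ≤ R * runLength a := Nat.mul_le_mul_right _ hr
  have h2 : pos + 1 ≤ runLength a := by unfold runLength; omega
  rw [Nat.succ_mul] at h
  omega

theorem three_pow_topLevel_le (n β : ℕ) :
    (3 : ℝ) ^ topLevel n β ≤ 2 * √(blockLength n β : ℝ) := by
  have h : 9 ^ topLevel n β ≤ 4 * blockLength n β :=
    Nat.pow_log_le_self 9 (by simp [blockLength])
  have h' : ((3 : ℝ) ^ topLevel n β) ^ 2 ≤ 4 * blockLength n β := by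
    rw [← pow_mul, mul_comm, pow_mul]
    norm_num
    exact_mod_cast h
  have h4 : (2 * √(blockLength n β : ℝ)) = √(4 * blockLength n β) := by
    rw [Real.sqrt_mul (by norm_num), show (4 : ℝ) = 2 ^ 2 by norm_num, Real.sqrt_sq (by norm_num)]
  rw [h4]
  exact Real.le_sqrt_of_sq_le h'

theorem fullCost_topLevel_le (n β R : ℕ) :
    (fullCost R (topLevel n β + 1) : ℝ) ≤ 10 * R * √(blockLength n β : ℝ) := by
  have h : (fullCost R (topLevel n β + 1) : ℝ) ≤ R * (5 * 3 ^ topLevel n β) := by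
    exact_mod_cast fullCost_succ_le R (topLevel n β)
  have h2 := mul_le_mul_of_nonneg_left (three_pow_topLevel_le n β)
    (show (0 : ℝ) ≤ R * 5 by positivity)
  linarith

/-- The weight that counts the failures at the critical level. -/
def penalty (m s a rep : ℕ) : ℝ :=
  if 0 < m ∧ Real.pi / 2 < 3 ^ (a + 1) * Grover.angle m s then (4 / 3) ^ rep else 1

theorem penalty_zero (m s a : ℕ) : penalty m s a 0 = 1 := by simp [penalty]

theorem one_le_penalty (m s a rep : ℕ) : 1 ≤ penalty m s a rep := by
  unfold penalty
  split_ifs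
  · exact one_le_pow₀ (by norm_num)
  · exact le_rfl

section Progress

variable {n : ℕ} [NeZero n] (N : Network n) (A : Finset (Fin n)) (β R k : ℕ)

/-- The ports of the block `B` of the owner of the slot `k`. -/
def ports (B : ℕ) : Finset (Fin (N.deg (owner n k))) :=
  block (blockLength n β) (N.deg (owner n k)) B

/-- The ports of the block `B` of the owner of the slot `k` that lead to sleeping nodes. -/
def asleep (T : Finset (Fin n)) (B : ℕ) : Finset (Fin (N.deg (owner n k))) :=
  (ports N β k B).filter fun i => N.peer (owner n k) i ∉ T

/-- The search of the owner of the slot `k` is as planned, `e` rounds after the beginning of the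
slot, when the nodes in `T` are awake. -/
structure Progress (e B a rep pos : ℕ) (T : Finset (Fin n)) (found : Bool) (msgs : ℕ) : Prop where
  turn : Turn N A k
  two_le : 2 ≤ e
  awake_subset : awakeAt N A k ⊆ T
  of_mem : ∀ w ∈ T, w ∈ awakeAt N A k ∨ ∃ i, N.peer (owner n k) i = w
  below : ∀ i : Fin (N.deg (owner n k)), i.1 / blockLength n β < B → N.peer (owner n k) i ∈ T
  above : ∀ i : Fin (N.deg (owner n k)), B < i.1 / blockLength n β → Target N A k i →
    N.peer (owner n k) i ∉ T
  ports_nonempty : (ports N β k B).Nonempty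
  of_not_found : found = false → (asleep N β k T B).Nonempty ∨ ∀ i, N.peer (owner n k) i ∈ T
  level_le : a ≤ topLevel n β
  rep_lt : rep < R
  pos_le : pos ≤ 2 * 3 ^ a + 1
  angle_le : 0 < (asleep N β k T B).card →
    3 ^ a * Grover.angle (asleep N β k T B).card (ports N β k B).card ≤ Real.pi / 2
  -- Each earlier block, searched or skipped, has a budget of `30 R ℓ` rounds. Within a block of `s`
  -- ports the successes so far cost at most `20 R (s - √s √m)`, which increases as the number `m`
  -- of sleepers falls; `cost` is the current unsuccessful stretch, and 2 is the offset of the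
  -- start.
  time_le : (e : ℝ) ≤ B * (30 * R * blockLength n β) +
    20 * R * ((ports N β k B).card - √((ports N β k B).card : ℝ) * √((asleep N β k T B).card : ℝ)) +
    cost R a rep pos + 2
  -- With `K` the cost of a full pass, every woken node brings a credit `2 K`: one `K` pays for the
  -- search that found it, the other replaces the credit `K` held for the last, fruitless pass while
  -- `found` is true. A completed turn brings one more `K`.
  msgs_le : msgs + fullCost R (topLevel n β + 1) * (2 * A.card + found.toNat) ≤
    fullCost R (topLevel n β + 1) * (2 * T.card + (doneAt N A k).card) + cost R a rep pos

variable {N A β R k} {e B a rep pos : ℕ} {T : Finset (Fin n)} {found : Bool} {msgs : ℕ}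

theorem asleep_card_le : (asleep N β k T B).card ≤ (ports N β k B).card :=
  Finset.card_filter_le _ _

theorem ports_card_le : (ports N β k B).card ≤ blockLength n β :=
  card_block_le (by simp [blockLength])

namespace Progress

theorem block_lt (h : Progress N A β R k e B a rep pos T found msgs) : B < 2 ^ β := by
  obtain ⟨i, hi⟩ := h.ports_nonempty
  rw [← mem_block.mp hi]
  exact WakeUp.block_lt β i

theorem cost_lt_full (h : Progress N A β R k e B a rep pos T found msgs) :
    cost R a rep pos < fullCost R (topLevel n β + 1) :=
  (cost_lt h.rep_lt h.pos_le).trans_le (fullCost_mono R (Nat.succ_le_succ h.level_le))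

/-- The current block uses at most `20 R ℓ` rounds for its successes and `10 R √ℓ ≤ 10 R ℓ` for an
unfinished pass. With at most `2 ^ β` blocks the turn fits into the slot, and the additive 4 covers
the initial offset. -/
theorem time_lt (h : Progress N A β R k e B a rep pos T found msgs) :
    e + 1 < slotLength n β R := by
  have h1 := h.time_le
  have h2 : (cost R a rep pos : ℝ) + 1 ≤ 10 * R * √(blockLength n β : ℝ) := by
    refine le_trans ?_ (fullCost_topLevel_le n β R)
    exact_mod_cast h.cost_lt_full
  have hℓ : (1 : ℝ) ≤ blockLength n β := by
    exact_mod_cast (show 1 ≤ blockLength n β by simp [blockLength])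
  have h3 : √(blockLength n β : ℝ) ≤ blockLength n β := by
    rw [Real.sqrt_le_left (by linarith)]
    nlinarith
  have h4 : ((ports N β k B).card : ℝ) ≤ blockLength n β := by exact_mod_cast ports_card_le
  have h5 : (0 : ℝ) ≤ √((ports N β k B).card : ℝ) * √((asleep N β k T B).card : ℝ) := by positivity
  have h6 : ((B : ℝ) + 1) ≤ 2 ^ β := by exact_mod_cast h.block_lt
  have hR : (0 : ℝ) ≤ R := Nat.cast_nonneg R
  have h7 := mul_le_mul_of_nonneg_left h3 (show (0 : ℝ) ≤ 10 * R by positivity)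
  have h8 := mul_le_mul_of_nonneg_left (show ((ports N β k B).card : ℝ) -
    √((ports N β k B).card : ℝ) * √((asleep N β k T B).card : ℝ) ≤ blockLength n β by linarith)
    (show (0 : ℝ) ≤ 20 * R by positivity)
  have h9 := mul_le_mul_of_nonneg_right h6 (show (0 : ℝ) ≤ 30 * R * blockLength n β by positivity)
  have : (e : ℝ) + 1 < slotLength n β R := by
    unfold slotLength
    push_cast
    linarith
  exact_mod_cast this

theorem next (h : Progress N A β R k e B a rep pos T found msgs) (hp : pos < 2 * 3 ^ a + 1)
    {msgs' : ℕ} (hm : msgs' ≤ msgs + 1) :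
    Progress N A β R k (e + 1) B a rep (pos + 1) T found msgs' :=
  { h with
    two_le := h.two_le.trans (Nat.le_succ e)
    pos_le := hp
    time_le := by
      have h1 := h.time_le
      unfold cost at h1 ⊢
      push_cast at h1 ⊢
      linarith
    msgs_le := by
      have h1 := h.msgs_le
      unfold cost at h1 ⊢
      omega }

theorem repeat_search (h : Progress N A β R k e B a rep (2 * 3 ^ a + 1) T found msgs)
    (hr : rep + 1 < R) {msgs' : ℕ} (hm : msgs' ≤ msgs + 1) :
    Progress N A β R k (e + 1) B a (rep + 1) 0 T found msgs' :=
  have hc : cost R a (rep + 1) 0 = cost R a rep (2 * 3 ^ a + 1) + 1 := by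
    unfold cost runLength; ring
  { h with
    two_le := h.two_le.trans (Nat.le_succ e)
    rep_lt := hr
    pos_le := Nat.zero_le _
    time_le := by
      have h1 := h.time_le
      rw [hc]
      push_cast at h1 ⊢
      linarith
    msgs_le := by
      have h1 := h.msgs_le
      rw [hc]
      omega }

theorem next_level (h : Progress N A β R k e B a rep (2 * 3 ^ a + 1) T found msgs)
    (hr : ¬rep + 1 < R) (ha : a < topLevel n β)
    (hcrit : ¬(0 < (asleep N β k T B).card ∧ Real.pi / 2 <
      3 ^ (a + 1) * Grover.angle (asleep N β k T B).card (ports N β k B).card))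
    {msgs' : ℕ} (hm : msgs' ≤ msgs + 1) :
    Progress N A β R k (e + 1) B (a + 1) 0 0 T found msgs' :=
  have hR : R = rep + 1 := le_antisymm (not_lt.mp hr) h.rep_lt
  have hc : cost R (a + 1) 0 0 = cost R a rep (2 * 3 ^ a + 1) + 1 := by
    unfold cost
    rw [fullCost_succ]
    nth_rewrite 2 [hR]
    unfold runLength
    ring
  { h with
    two_le := h.two_le.trans (Nat.le_succ e)
    rep_lt := by omega
    level_le := ha
    pos_le := Nat.zero_le _
    angle_le := fun hm => not_lt.mp fun hlt => hcrit ⟨hm, hlt⟩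
    time_le := by
      have h1 := h.time_le
      rw [hc]
      push_cast at h1 ⊢
      linarith
    msgs_le := by
      have h1 := h.msgs_le
      rw [hc]
      omega }

/-- A sleeper would give `3 ^ (a + 1) ≤ 2 √ℓ` at the top level, hence `9 ^ (a + 1) ≤ 4 ℓ`, contrary
to the choice of `topLevel` as a logarithm to the base 9. -/
theorem asleep_eq_empty (h : Progress N A β R k e B a rep pos T found msgs)
    (ha : ¬a < topLevel n β)
    (hcrit : ¬(0 < (asleep N β k T B).card ∧ Real.pi / 2 <
      3 ^ (a + 1) * Grover.angle (asleep N β k T B).card (ports N β k B).card)) :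
    asleep N β k T B = ∅ := by
  by_contra hne
  have hm : 0 < (asleep N β k T B).card := Finset.card_pos.mpr (Finset.nonempty_iff_ne_empty.mpr hne)
  have hle : 3 ^ (a + 1) * Grover.angle (asleep N β k T B).card (ports N β k B).card ≤
      Real.pi / 2 := not_lt.mp fun hlt => hcrit ⟨hm, hlt⟩
  obtain rfl : a = topLevel n β := le_antisymm h.level_le (not_lt.mp ha)
  have h1 := Grover.mul_sqrt_le_of_mul_angle_le asleep_card_le (hm.trans_le asleep_card_le)
    (by positivity) hle
  have h2 : (1 : ℝ) ≤ √((asleep N β k T B).card : ℝ) := by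
    rw [Real.one_le_sqrt]; exact_mod_cast hm
  have h3 : √((ports N β k B).card : ℝ) ≤ √(blockLength n β : ℝ) :=
    Real.sqrt_le_sqrt (by exact_mod_cast ports_card_le)
  have h4 : (3 : ℝ) ^ (topLevel n β + 1) ≤ 2 * √(blockLength n β : ℝ) := by
    have h5 : (0 : ℝ) < 3 ^ (topLevel n β + 1) := by positivity
    nlinarith
  have h5 : ((3 : ℝ) ^ (topLevel n β + 1)) ^ 2 ≤ 4 * blockLength n β := by
    have := pow_le_pow_left₀ (by positivity) h4 2
    rw [mul_pow, Real.sq_sqrt (Nat.cast_nonneg _)] at this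
    linarith
  have h6 : 4 * blockLength n β < 9 ^ (topLevel n β + 1) :=
    Nat.lt_pow_succ_log_self (by norm_num) _
  have h7 : ((4 * blockLength n β : ℕ) : ℝ) < 9 ^ (topLevel n β + 1) := by exact_mod_cast h6
  rw [← pow_mul, mul_comm, pow_mul] at h5
  push_cast at h7
  norm_num at h5
  linarith

/-- The pointer after the search of the block `B`. -/
def pointer (N : Network n) (A : Finset (Fin n)) (β k B : ℕ) (found : Bool) : ℕ :=
  if found then nextBlock N A (blockLength n β) k B else B

theorem mem_of_asleep_eq_empty (he : asleep N β k T B = ∅) (i : Fin (N.deg (owner n k)))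
    (hi : i.1 / blockLength n β = B) : N.peer (owner n k) i ∈ T := by
  by_contra hT
  have : i ∈ asleep N β k T B := Finset.mem_filter.mpr ⟨mem_block.mpr hi, hT⟩
  rw [he] at this
  simp at this

/-- If nothing was found, the block had no sleeper from the start, which by `of_not_found` happens
only to an owner without targets. Otherwise the pointer is genuine and its end mark excludes later
targets. -/
theorem mem_of_pointer_eq (h : Progress N A β R k e B a rep pos T found msgs)
    (he : asleep N β k T B = ∅) (hp : pointer N A β k B found = B)
    (i : Fin (N.deg (owner n k))) : N.peer (owner n k) i ∈ T := by
  cases found with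
  | false =>
    rcases h.of_not_found rfl with h' | h'
    · rw [he] at h'; simp at h'
    · exact h' i
  | true =>
    rcases lt_trichotomy (i.1 / blockLength n β) B with hlt | heq | hgt
    · exact h.below i hlt
    · exact mem_of_asleep_eq_empty he i heq
    · by_contra hT
      have := nextBlock_eq_self (by simpa [pointer] using hp) i fun h' => hT (h.awake_subset h')
      omega

/-- A finished turn returns the random execution to the ideal schedule: the order of discoveries is
forgotten, and the next slot begins with the set that the oracle predicted. -/
theorem eq_awakeAt_succ (h : Progress N A β R k e B a rep pos T found msgs)
    (hall : ∀ i, N.peer (owner n k) i ∈ T) : T = awakeAt N A (k + 1) := by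
  ext w
  rw [mem_awakeAt_succ]
  constructor
  · intro hw
    rcases h.of_mem w hw with h' | ⟨i, rfl⟩
    · exact Or.inl h'
    · exact Or.inr ⟨h.turn.1, N.adj_peer _ i⟩
  · rintro (h' | ⟨_, h'⟩)
    · exact h.awake_subset h'
    · obtain ⟨i, rfl⟩ := N.exists_port h'
      exact hall i

theorem finish_msgs (h : Progress N A β R k e B a rep pos T found msgs) {msgs' : ℕ}
    (hm : msgs' ≤ msgs + 1) :
    msgs' + fullCost R (topLevel n β + 1) * (2 * A.card) ≤
      fullCost R (topLevel n β + 1) * (2 * T.card + (doneAt N A (k + 1)).card) := by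
  have h1 := h.msgs_le
  have h2 := h.cost_lt_full
  rw [doneAt_succ_of_turn h.turn, Finset.card_insert_of_notMem h.turn.2]
  generalize fullCost R (topLevel n β + 1) = K at *
  have h3 : K * (2 * A.card) ≤ K * (2 * A.card + found.toNat) :=
    Nat.mul_le_mul_left _ (Nat.le_add_right _ _)
  rw [show K * (2 * T.card + ((doneAt N A k).card + 1)) =
    K * (2 * T.card + (doneAt N A k).card) + K by ring]
  omega

/-- The pointer differs from `B` only after a success, so a credit is held for the fruitless pass.
Its time and that of the successes exhaust at most the budget `30 R ℓ` of the old block, and `B <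
B'` releases at least one such budget. -/
theorem next_block (h : Progress N A β R k e B a rep (2 * 3 ^ a + 1) T found msgs)
    (he : asleep N β k T B = ∅) (hp : pointer N A β k B found ≠ B) {msgs' : ℕ}
    (hm : msgs' ≤ msgs + 1) :
    Progress N A β R k (e + 1) (pointer N A β k B found) 0 0 0 T false msgs' := by
  have hf : found = true := by
    cases found
    · exact absurd rfl hp
    · rfl
  subst hf
  have hptr : pointer N A β k B true = nextBlock N A (blockLength n β) k B := rfl
  rw [hptr] at hp ⊢
  obtain ⟨hlt, ⟨i, hi, hiB⟩, hmin⟩ := nextBlock_spec hp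
  set B' := nextBlock N A (blockLength n β) k B with hB'
  have habove : ∀ i : Fin (N.deg (owner n k)), B < i.1 / blockLength n β → Target N A k i →
    N.peer (owner n k) i ∉ T := h.above
  have hbelow : ∀ i : Fin (N.deg (owner n k)), i.1 / blockLength n β < B' →
      N.peer (owner n k) i ∈ T := by
    intro j hj
    rcases lt_trichotomy (j.1 / blockLength n β) B with hlt | heq | hgt
    · exact h.below j hlt
    · exact mem_of_asleep_eq_empty he j heq
    · by_contra hT
      have := hmin j (fun h' => hT (h.awake_subset h')) hgt
      omega
  have hcost : (cost R a rep (2 * 3 ^ a + 1) : ℝ) + 1 ≤ 10 * R * blockLength n β := by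
    have hℓ : (1 : ℝ) ≤ blockLength n β := by
      exact_mod_cast (show 1 ≤ blockLength n β by simp [blockLength])
    have h3 : √(blockLength n β : ℝ) ≤ blockLength n β := by
      rw [Real.sqrt_le_left (by linarith)]
      nlinarith
    have h2 : (cost R a rep (2 * 3 ^ a + 1) : ℝ) + 1 ≤ 10 * R * √(blockLength n β : ℝ) := by
      refine le_trans ?_ (fullCost_topLevel_le n β R)
      exact_mod_cast h.cost_lt_full
    have := mul_le_mul_of_nonneg_left h3 (show (0 : ℝ) ≤ 10 * R by positivity)
    linarith
  refine
    { turn := h.turn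
      two_le := h.two_le.trans (Nat.le_succ e)
      awake_subset := h.awake_subset
      of_mem := h.of_mem
      below := hbelow
      above := fun j hj => h.above j (hlt.trans hj)
      ports_nonempty := ⟨i, mem_block.mpr hiB⟩
      of_not_found := fun _ => Or.inl ⟨i, Finset.mem_filter.mpr
        ⟨mem_block.mpr hiB, h.above i (hiB ▸ hlt) hi⟩⟩
      level_le := Nat.zero_le _
      rep_lt := (Nat.zero_le _).trans_lt h.rep_lt
      pos_le := Nat.zero_le _
      angle_le := fun _ => by simpa using Grover.angle_le
      time_le := ?_
      msgs_le := ?_ }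
  · have h1 := h.time_le
    rw [he, Finset.card_empty, Nat.cast_zero, Real.sqrt_zero, mul_zero, sub_zero] at h1
    have h4 : ((ports N β k B).card : ℝ) ≤ blockLength n β := by exact_mod_cast ports_card_le
    have h5 := mul_le_mul_of_nonneg_left h4 (show (0 : ℝ) ≤ 20 * R by positivity)
    have h6 : ((B : ℝ) + 1) ≤ B' := by exact_mod_cast hlt
    have h7 := mul_le_mul_of_nonneg_right h6 (show (0 : ℝ) ≤ 30 * R * blockLength n β by positivity)
    have h8 : √((ports N β k B').card : ℝ) * √((asleep N β k T B').card : ℝ) ≤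
        (ports N β k B').card := by
      have : √((asleep N β k T B').card : ℝ) ≤ √((ports N β k B').card : ℝ) :=
        Real.sqrt_le_sqrt (by exact_mod_cast asleep_card_le)
      have h9 := Real.mul_self_sqrt (Nat.cast_nonneg (α := ℝ) (ports N β k B').card)
      nlinarith [Real.sqrt_nonneg ((ports N β k B').card : ℝ)]
    have h9 := mul_nonneg (show (0 : ℝ) ≤ 20 * R by positivity) (sub_nonneg.mpr h8)
    have h10 : cost R 0 0 0 = 0 := by simp [cost, fullCost]
    rw [h10]
    push_cast
    linarith
  · have h1 := h.msgs_le
    have h2 := h.cost_lt_full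
    generalize fullCost R (topLevel n β + 1) = K at *
    simp only [Bool.toNat_true, Bool.toNat_false, mul_add, mul_one, mul_zero] at h1 ⊢
    omega

theorem success (h : Progress N A β R k e B a rep (2 * 3 ^ a + 1) T found msgs)
    {i : Fin (N.deg (owner n k))} (hi : i ∈ asleep N β k T B) {msgs' : ℕ} (hm : msgs' ≤ msgs + 1) :
    Progress N A β R k (e + 1) B 0 0 0 (insert (N.peer (owner n k) i) T) true msgs' := by
  have hiT : N.peer (owner n k) i ∉ T := (Finset.mem_filter.mp hi).2
  have hiB : i.1 / blockLength n β = B := mem_block.mp (Finset.mem_filter.mp hi).1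
  have hcard : (asleep N β k (insert (N.peer (owner n k) i) T) B).card + 1 =
      (asleep N β k T B).card := by
    have : asleep N β k (insert (N.peer (owner n k) i) T) B = (asleep N β k T B).erase i := by
      ext j
      simp only [asleep, Finset.mem_filter, Finset.mem_insert, Finset.mem_erase, not_or,
        (N.peer_injective _).eq_iff]
      tauto
    rw [this, Finset.card_erase_add_one hi]
  refine
    { turn := h.turn
      two_le := h.two_le.trans (Nat.le_succ e)
      awake_subset := h.awake_subset.trans (Finset.subset_insert _ _)
      of_mem := ?_
      below := fun j hj => Finset.mem_insert_of_mem (h.below j hj)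
      above := ?_
      ports_nonempty := h.ports_nonempty
      of_not_found := fun h' => by simp at h'
      level_le := Nat.zero_le _
      rep_lt := (Nat.zero_le _).trans_lt h.rep_lt
      pos_le := Nat.zero_le _
      angle_le := fun _ => by simpa using Grover.angle_le
      time_le := ?_
      msgs_le := ?_ }
  · intro w hw
    rcases Finset.mem_insert.mp hw with rfl | hw
    · exact Or.inr ⟨i, rfl⟩
    · exact h.of_mem w hw
  · intro j hj ht hmem
    rcases Finset.mem_insert.mp hmem with h' | h'
    · have := N.peer_injective _ h'
      subst this
      omega
    · exact h.above j hj ht h'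
  · have h1 := h.time_le
    set m := (asleep N β k T B).card with hm_def
    set m' := (asleep N β k (insert (N.peer (owner n k) i) T) B).card with hm'_def
    set s := (ports N β k B).card with hs_def
    have hm0 : 0 < m := by omega
    have hms : m ≤ s := asleep_card_le
    have hang := Grover.mul_sqrt_le_of_mul_angle_le hms (hm0.trans_le hms)
      (show (0 : ℝ) ≤ 3 ^ a by positivity) (h.angle_le hm0)
    have hcost : (cost R a rep (2 * 3 ^ a + 1) : ℝ) + 1 ≤ R * (5 * 3 ^ a) := by
      have : cost R a rep (2 * 3 ^ a + 1) + 1 ≤ R * (5 * 3 ^ a) :=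
        (cost_lt h.rep_lt h.pos_le).trans_le (fullCost_succ_le R a)
      exact_mod_cast this
    have hsm : √(m : ℝ) ^ 2 = m := Real.sq_sqrt (Nat.cast_nonneg _)
    have hsm' : √(m' : ℝ) ^ 2 = m' := Real.sq_sqrt (Nat.cast_nonneg _)
    have hmm : (m : ℝ) = m' + 1 := by exact_mod_cast hcard.symm
    have hpos : 0 < √(m : ℝ) := Real.sqrt_pos.mpr (by exact_mod_cast hm0)
    have hpos' : 0 ≤ √(m' : ℝ) := Real.sqrt_nonneg _
    have hss : 0 ≤ √(s : ℝ) := Real.sqrt_nonneg _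
    have hR : (0 : ℝ) ≤ R := Nat.cast_nonneg R
    have hle : √(m' : ℝ) ≤ √(m : ℝ) := Real.sqrt_le_sqrt (by linarith)
    -- This is `√m - √(m - 1) ≥ 1 / (2 √m)`. Together with `3 ^ a √m ≤ 2 √s` it lets the time
    -- potential pay for the at most `5 R 3 ^ a` rounds since the last success.
    have hdiff : 1 ≤ 2 * √(m : ℝ) * (√(m : ℝ) - √(m' : ℝ)) := by nlinarith
    have hkey : (3 : ℝ) ^ a ≤ 4 * √(s : ℝ) * (√(m : ℝ) - √(m' : ℝ)) := by
      have h3 : (3 : ℝ) ^ a * √(m : ℝ) ≤ 4 * √(s : ℝ) * (√(m : ℝ) - √(m' : ℝ)) * √(m : ℝ) := by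
        have := mul_le_mul_of_nonneg_left hdiff (show (0 : ℝ) ≤ 2 * √(s : ℝ) by positivity)
        nlinarith
      exact le_of_mul_le_mul_right h3 hpos
    have h10 : cost R 0 0 0 = 0 := by simp [cost, fullCost]
    rw [h10]
    have h11 := mul_le_mul_of_nonneg_left hkey (show (0 : ℝ) ≤ R * 5 by positivity)
    push_cast
    have h12 : (R : ℝ) * 5 * (4 * √(s : ℝ) * (√(m : ℝ) - √(m' : ℝ))) =
      20 * R * (√(s : ℝ) * √(m : ℝ)) - 20 * R * (√(s : ℝ) * √(m' : ℝ)) := by ring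
    linarith
  · have h1 := h.msgs_le
    have h2 := h.cost_lt_full
    rw [Finset.card_insert_of_notMem hiT]
    generalize fullCost R (topLevel n β + 1) = K at *
    simp only [Bool.toNat_true, mul_add, mul_one] at h1 ⊢
    omega

end Progress

theorem Progress.start {msgs msgs' : ℕ} (hn : 2 ≤ n) (hR : 0 < R) (h : Turn N A k)
    (h₁ : msgs + fullCost R (topLevel n β + 1) * (2 * A.card) ≤
      fullCost R (topLevel n β + 1) * (2 * (awakeAt N A k).card + (doneAt N A k).card))
    (hm : msgs' ≤ msgs) :
    Progress N A β R k 2 (firstBlock N A (blockLength n β) k) 0 0 0 (awakeAt N A k) false msgs' := by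
  set B := firstBlock N A (blockLength n β) k with hB
  have hports : (ports N β k B).Nonempty := by
    by_cases he : ∃ i, Target N A k i
    · obtain ⟨i, _, hi⟩ := exists_target_firstBlock (ℓ := blockLength n β) he
      exact ⟨i, mem_block.mpr hi⟩
    -- An owner without targets still searches block 0. It has a port because the network is
    -- connected with `n ≥ 2`, so this block is nonempty.
    · have h0 : B = 0 := firstBlock_of_not_exists he
      have : Nontrivial (Fin n) := Fin.nontrivial_iff_two_le.mpr hn
      obtain ⟨w, hw⟩ := N.connected.preconnected.exists_adj_of_nontrivial (owner n k)
      obtain ⟨i, _⟩ := N.exists_port hw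
      exact ⟨⟨0, by have := i.2; omega⟩, mem_block.mpr (by simp [h0])⟩
  refine
    { turn := h
      two_le := le_rfl
      awake_subset := subset_rfl
      of_mem := fun w hw => Or.inl hw
      below := ?_
      above := fun i _ hi => hi
      ports_nonempty := hports
      of_not_found := ?_
      level_le := Nat.zero_le _
      rep_lt := hR
      pos_le := Nat.zero_le _
      angle_le := fun _ => by simpa using Grover.angle_le
      time_le := ?_
      msgs_le := ?_ }
  · intro i hi
    by_contra hT
    exact absurd (firstBlock_le (ℓ := blockLength n β) hT) (not_le.mpr hi)
  · intro _
    by_cases he : ∃ i, Target N A k i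
    · obtain ⟨i, hi, hiB⟩ := exists_target_firstBlock (ℓ := blockLength n β) he
      exact Or.inl ⟨i, Finset.mem_filter.mpr ⟨mem_block.mpr hiB, hi⟩⟩
    · right
      intro i
      by_contra hT
      exact he ⟨i, hT⟩
  · have h8 : √((ports N β k B).card : ℝ) * √((asleep N β k (awakeAt N A k) B).card : ℝ) ≤
        (ports N β k B).card := by
      have : √((asleep N β k (awakeAt N A k) B).card : ℝ) ≤ √((ports N β k B).card : ℝ) :=
        Real.sqrt_le_sqrt (by exact_mod_cast asleep_card_le)
      have h9 := Real.mul_self_sqrt (Nat.cast_nonneg (α := ℝ) (ports N β k B).card)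
      nlinarith [Real.sqrt_nonneg ((ports N β k B).card : ℝ)]
    have h9 := mul_nonneg (show (0 : ℝ) ≤ 20 * R by positivity) (sub_nonneg.mpr h8)
    have h10 : cost R 0 0 0 = 0 := by simp [cost, fullCost]
    rw [h10]
    have h11 : (0 : ℝ) ≤ B * (30 * R * blockLength n β) := by positivity
    push_cast
    linarith
  · simp only [Bool.toNat_false, add_zero]
    omega

end Progress

end WakeUp
end

/-! ### One round of an execution: outcomes, classical messages, clocks. -/

noncomputable section

namespace WakeUp

variable {n : ℕ} [NeZero n] (N : Network n) (A : Finset (Fin n)) (K β R : ℕ)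

/-- The state of the node `v` in the mode `md`, with the advice of the oracle. -/
def nodeState (v : Fin n) (md : Mode) : NodeState n :=
  ⟨v, startBlock N A (blockLength n β) v, siblingBlock N A (blockLength n β) v, md⟩

variable {N A K β R} in
theorem start_advice (v : Fin n) (d : ℕ) :
    (algorithm n K β R).start v d (advice N A (blockLength n β) β v) =
      nodeState N A β v (.wait 0) := by
  simp only [algorithm, nodeState, readAdvice_zero β v (startBlock_lt β v),
    readAdvice_self β v (siblingBlock_lt β v)]

/-- The nodes in `T` are awake, in the given modes. -/
def HasModes (c : (algorithm n K β R).Config N) (T : Finset (Fin n)) (md : Fin n → Mode) : Prop :=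
  ∀ v, c.state v = if v ∈ T then some (nodeState N A β v (md v)) else none

/-- The mode does not act on the quantum registers. -/
def Mode.IsPassive : Mode → Prop
  | .run .. => False
  | _ => True

open scoped Classical in
/-- The outcomes of a round in which only the node `u` can measure, with the outcome `x`. -/
def plan (T : Finset (Fin n)) (md : Fin n → Mode) (u : Fin n) (x : Option (Fin n × Bool)) :
    Fin n → Option (Option (Fin n × Bool)) :=
  fun v => if v ∈ T ∧ md v ≠ .done then some (if v = u then x else none) else none

open scoped Classical in
/-- The classical messages sent in such a round. -/
def sent (c : (algorithm n K β R).Config N) (T : Finset (Fin n)) (md : Fin n → Mode) (u : Fin n)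
    (x : Option (Fin n × Bool)) (v : Fin n) (i : Fin (N.deg v)) : Option (Bits K) :=
  if v ∈ T then
    outgoing β R (nodeState N A β v (md v)) (c.inbox v) (if v = u then x else none) i
  else none

variable {N A K β R}
variable {c : (algorithm n K β R).Config N} {T : Finset (Fin n)} {md : Fin n → Mode} {u : Fin n}
  {x : Option (Fin n × Bool)}

theorem nodeOp_of_isPassive (hst : HasModes N A K β R c T md) {v : Fin n}
    (hv : (md v).IsPassive) (o : Option (Option (Fin n × Bool))) :
    (algorithm n K β R).nodeOp (N.deg v) (c.inbox v) (c.state v) o =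
      if o = plan T md v none v then (algorithm n K β R).passiveOp T v (N.deg v) else 0 := by
  classical
  rw [hst v]
  unfold plan Algorithm.passiveOp
  by_cases hT : v ∈ T
  · cases hmd : md v with
    | run => rw [hmd] at hv; exact hv.elim
    | done =>
      cases o <;> simp [hT, Algorithm.nodeOp, nodeState]
    | wait τ =>
      cases o with
      | none => simp [hT, Algorithm.nodeOp, nodeState]
      | some o => simp [hT, Algorithm.nodeOp, nodeState, operation, unitaryOp]
  · cases o <;> simp [hT, Algorithm.nodeOp]

theorem nodeOp_of_run (hst : HasModes N A K β R c T md) (hu : u ∈ T)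
    {τ B ptr a rep pos : ℕ} (hmd : md u = .run τ B ptr a rep pos)
    (o : Option (Option (Fin n × Bool))) :
    (algorithm n K β R).nodeOp (N.deg u) (c.inbox u) (c.state u) o =
      match o with
      | none => 0
      | some x => operation K β (N.deg u) (nodeState N A β u (.run τ B ptr a rep pos)) x := by
  rw [hst u, if_pos hu, hmd]
  cases o <;> simp [Algorithm.nodeOp, nodeState]

theorem plan_of_ne {n : ℕ} {T : Finset (Fin n)} {md : Fin n → Mode} {u : Fin n}
    {x : Option (Fin n × Bool)} {v : Fin n} (h : v ≠ u) : plan T md u x v = plan T md v none v := by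
  simp [plan, h]

/-- A passive node has only one outcome with a nonzero operator, so a round without a measurement
does not branch. -/
theorem localAmp_of_ne_plan (hst : HasModes N A K β R c T md) (hp : ∀ v, (md v).IsPassive)
    (u : Fin n) {o : (algorithm n K β R).Outcomes} (ho : o ≠ plan T md u none) :
    (algorithm n K β R).localAmp N c o = 0 := by
  obtain ⟨v, hv⟩ := Function.ne_iff.mp ho
  refine Algorithm.localAmp_eq_zero _ c o v ?_
  rw [nodeOp_of_isPassive hst (hp v), if_neg]
  intro h
  apply hv
  rw [h]
  simp [plan]

theorem localAmp_of_forall_ne_plan (hst : HasModes N A K β R c T md) (hu : u ∈ T)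
    {τ B ptr a rep pos : ℕ} (hmd : md u = .run τ B ptr a rep pos)
    (hp : ∀ v, v ≠ u → (md v).IsPassive) {o : (algorithm n K β R).Outcomes}
    (ho : ∀ x, o ≠ plan T md u x) : (algorithm n K β R).localAmp N c o = 0 := by
  by_cases hu0 : o u = none
  · refine Algorithm.localAmp_eq_zero _ c o u ?_
    rw [nodeOp_of_run hst hu hmd, hu0]
  · obtain ⟨x, hx⟩ := Option.ne_none_iff_exists'.mp hu0
    obtain ⟨v, hv⟩ := Function.ne_iff.mp (ho x)
    have hvu : v ≠ u := by
      rintro rfl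
      apply hv
      rw [hx]
      simp [plan, hu, hmd]
    refine Algorithm.localAmp_eq_zero _ c o v ?_
    rw [nodeOp_of_isPassive hst (hp v hvu), if_neg]
    intro h
    exact hv (h.trans (plan_of_ne hvu).symm)

theorem localAmp_of_unitary (hst : HasModes N A K β R c T md) (hu : u ∈ T)
    {τ B ptr a rep pos : ℕ} (hmd : md u = .run τ B ptr a rep pos) (hpos : pos < 2 * 3 ^ a + 1)
    (hp : ∀ v, v ≠ u → (md v).IsPassive) {o : (algorithm n K β R).Outcomes}
    (ho : o ≠ plan T md u none) : (algorithm n K β R).localAmp N c o = 0 := by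
  by_cases h : ∃ x, o = plan T md u x
  · obtain ⟨x, rfl⟩ := h
    have hx : x ≠ none := by rintro rfl; exact ho rfl
    refine Algorithm.localAmp_eq_zero _ c _ u ?_
    have : plan T md u x u = some x := by simp [plan, hu, hmd]
    rw [nodeOp_of_run hst hu hmd, this]
    have hop : operation K β (N.deg u) (nodeState N A β u (.run τ B ptr a rep pos)) =
        unitaryOp (searchUnitary K (N.deg u) (block (blockLength n β) (N.deg u) B) pos) :=
      if_neg (not_le.mpr hpos)
    simp only [hop]
    exact if_neg hx
  · push Not at h
    exact localAmp_of_forall_ne_plan hst hu hmd hp h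

theorem nodeSend_plan (hst : HasModes N A K β R c T md) (v : Fin n) :
    (algorithm n K β R).nodeSend (N.deg v) (c.inbox v) (c.state v) (plan T md u x v) =
      sent N A K β R c T md u x v := by
  classical
  funext i
  rw [hst v]
  unfold plan sent
  by_cases hT : v ∈ T
  · cases hmd : md v <;> simp [hT, Algorithm.nodeSend, nodeState, outgoing]
  · simp [hT, Algorithm.nodeSend]

theorem nodeNext_plan (hst : HasModes N A K β R c T md) (v : Fin n) :
    (algorithm n K β R).nodeNext (N.deg v) (c.inbox v) (c.state v) (plan T md u x v) =
      if v ∈ T then some (nodeState N A β v (nextMode β R (nodeState N A β v (md v)) (c.inbox v)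
        (if v = u then x else none))) else none := by
  classical
  rw [hst v]
  unfold plan
  by_cases hT : v ∈ T
  · cases hmd : md v <;> simp [hT, Algorithm.nodeNext, nodeState, nextMode]
    congr
  · simp [hT, Algorithm.nodeNext]

/-- The configuration after a round with the outcomes of a plan. -/
abbrev stepPlan (N : Network n) (A : Finset (Fin n)) (K β R : ℕ)
    (c : (algorithm n K β R).Config N) (T : Finset (Fin n)) (md : Fin n → Mode) (u : Fin n)
    (x : Option (Fin n × Bool)) : (algorithm n K β R).Config N :=
  (algorithm n K β R).step N (advice N A (blockLength n β) β) c (plan T md u x)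

theorem stepPlan_inbox (hst : HasModes N A K β R c T md) (q : Σ v, Fin (N.deg v)) :
    (stepPlan N A K β R c T md u x).inbox q.1 q.2 =
      sent N A K β R c T md u x (N.flip q).1 (N.flip q).2 := by
  rw [← nodeSend_plan hst]
  rfl

theorem stepPlan_state (hst : HasModes N A K β R c T md) (v : Fin n) :
    (stepPlan N A K β R c T md u x).state v =
      if v ∈ T then some (nodeState N A β v (nextMode β R (nodeState N A β v (md v)) (c.inbox v)
        (if v = u then x else none)))
      else if ∃ i, (stepPlan N A K β R c T md u x).inbox v i ≠ none then
        some (nodeState N A β v (.wait 0)) else none := by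
  classical
  have h : (stepPlan N A K β R c T md u x).state v =
      if c.state v = none ∧ ∃ i, (stepPlan N A K β R c T md u x).inbox v i ≠ none then
        some ((algorithm n K β R).start v (N.deg v) (advice N A (blockLength n β) β v))
      else (algorithm n K β R).nodeNext (N.deg v) (c.inbox v) (c.state v) (plan T md u x v) := by
    unfold stepPlan Algorithm.step
    congr
  rw [h, start_advice, nodeNext_plan hst]
  by_cases hT : v ∈ T
  · simp [hst v, hT]
  · simp [hst v, hT]

theorem stepPlan_msgs (hst : HasModes N A K β R c T md) :
    (stepPlan N A K β R c T md u x).msgs =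
      c.msgs + Algorithm.classicalMsgs N (sent N A K β R c T md u x) +
        (algorithm n K β R).quantumMsgs N
          ((algorithm n K β R).localAmp N c (plan T md u x)) := by
  have : (fun v => (algorithm n K β R).nodeSend (N.deg v) (c.inbox v) (c.state v)
      (plan T md u x v)) = sent N A K β R c T md u x := funext fun v => nodeSend_plan hst v
  rw [← this]
  rfl

theorem stepPlan_of_silent (hst : HasModes N A K β R c T md)
    (hs : ∀ v i, sent N A K β R c T md u x v i = none) :
    (∀ v i, (stepPlan N A K β R c T md u x).inbox v i = none) ∧
    HasModes N A K β R (stepPlan N A K β R c T md u x) T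
      (fun v => nextMode β R (nodeState N A β v (md v)) (c.inbox v) (if v = u then x else none)) ∧
    (stepPlan N A K β R c T md u x).msgs = c.msgs + (algorithm n K β R).quantumMsgs N
          ((algorithm n K β R).localAmp N c (plan T md u x)) := by
  have hin : ∀ v i, (stepPlan N A K β R c T md u x).inbox v i = none := fun v i => by
    rw [stepPlan_inbox hst ⟨v, i⟩]; exact hs _ _
  refine ⟨hin, fun v => ?_, ?_⟩
  · rw [stepPlan_state hst]
    have : ¬∃ i, (stepPlan N A K β R c T md u x).inbox v i ≠ none := fun ⟨i, hi⟩ => hi (hin v i)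
    simp only [this, if_false]
  · rw [stepPlan_msgs hst]
    simp [Algorithm.classicalMsgs, hs]

theorem classicalMsgs_single {p : Σ v, Fin (N.deg v)} {m : Bits K}
    {out : (v : Fin n) → Fin (N.deg v) → Option (Bits K)}
    (hs : ∀ q : Σ v, Fin (N.deg v), out q.1 q.2 = if q = p then some m else none) :
    Algorithm.classicalMsgs N out = 1 := by
  classical
  obtain ⟨w, j⟩ := p
  unfold Algorithm.classicalMsgs
  rw [Finset.sum_eq_single w]
  · rw [Finset.card_eq_one]
    refine ⟨j, ?_⟩
    ext i
    have := hs ⟨w, i⟩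
    simp only at this
    simp only [this, Finset.mem_filter, Finset.mem_univ, true_and, Finset.mem_singleton]
    by_cases h : i = j
    · subst h; simp
    · have h' : (⟨w, i⟩ : Σ v, Fin (N.deg v)) ≠ ⟨w, j⟩ := by
        intro h'; exact h (eq_of_heq (Sigma.mk.inj h').2)
      simp [h, h']
  · intro v _ hv
    rw [Finset.card_eq_zero]
    ext i
    have := hs ⟨v, i⟩
    have h' : (⟨v, i⟩ : Σ v, Fin (N.deg v)) ≠ ⟨w, j⟩ := by
      intro h'; exact hv (Sigma.mk.inj h').1
    simp only [h', if_false] at this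
    simp [this]
  · simp

theorem stepPlan_of_single (hst : HasModes N A K β R c T md) {p : Σ v, Fin (N.deg v)} {m : Bits K}
    (hs : ∀ q : Σ v, Fin (N.deg v),
      sent N A K β R c T md u x q.1 q.2 = if q = p then some m else none) :
    (∀ q : Σ v, Fin (N.deg v), (stepPlan N A K β R c T md u x).inbox q.1 q.2 =
      if q = N.flip p then some m else none) ∧
    (∀ v, (stepPlan N A K β R c T md u x).state v =
      if v ∈ T then some (nodeState N A β v (nextMode β R (nodeState N A β v (md v)) (c.inbox v)
        (if v = u then x else none)))
      else if v = (N.flip p).1 then some (nodeState N A β v (.wait 0)) else none) ∧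
    (stepPlan N A K β R c T md u x).msgs = c.msgs + 1 + (algorithm n K β R).quantumMsgs N
          ((algorithm n K β R).localAmp N c (plan T md u x)) := by
  have hin : ∀ q : Σ v, Fin (N.deg v), (stepPlan N A K β R c T md u x).inbox q.1 q.2 =
      if q = N.flip p then some m else none := fun q => by
    rw [stepPlan_inbox hst, hs]
    by_cases h : q = N.flip p
    · rw [if_pos h, if_pos (N.flip_eq_iff.mpr h)]
    · rw [if_neg h, if_neg (fun h' => h (N.flip_eq_iff.mp h'))]
  refine ⟨hin, fun v => ?_, ?_⟩
  · rw [stepPlan_state hst]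
    have : (∃ i, (stepPlan N A K β R c T md u x).inbox v i ≠ none) ↔ v = (N.flip p).1 := by
      constructor
      · rintro ⟨i, hi⟩
        rw [hin ⟨v, i⟩] at hi
        split_ifs at hi with h
        · rw [← h]
        · exact absurd rfl hi
      · rintro rfl
        refine ⟨(N.flip p).2, ?_⟩
        rw [hin (N.flip p), if_pos rfl]
        simp
    simp only [this]
  · rw [stepPlan_msgs hst, classicalMsgs_single hs]

section Clock

theorem slotLength_pos {n β R : ℕ} : 0 < slotLength n β R := by simp [slotLength]

theorem four_le_slotLength {n β R : ℕ} : 4 ≤ slotLength n β R := by simp [slotLength]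

theorem cycle_pos : 0 < cycle n β R := Nat.mul_pos (NeZero.pos n) slotLength_pos

theorem tick_mod {n β R : ℕ} (t : ℕ) : tick n β R (t % cycle n β R) = (t + 1) % cycle n β R := by
  simp [tick]

theorem clock_eq {k e : ℕ} (he : e < slotLength n β R) :
    (k * slotLength n β R + e) % cycle n β R = (owner n k).1 * slotLength n β R + e := by
  have hlt : (owner n k).1 * slotLength n β R + e < cycle n β R := by
    have h1 : ((owner n k).1 + 1) * slotLength n β R ≤ n * slotLength n β R :=
      Nat.mul_le_mul_right _ (owner n k).2
    rw [Nat.succ_mul] at h1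
    unfold cycle
    omega
  have hk : (owner n k).1 = k % n := by simp [owner]
  rw [← Nat.mod_eq_of_lt hlt, hk]
  have : k * slotLength n β R + e =
      (k % n * slotLength n β R + e) + cycle n β R * (k / n) := by
    conv_lhs => rw [← Nat.mod_add_div k n]
    unfold cycle
    ring
  rw [this, Nat.add_mul_mod_self_left]

/-- Slots are separated modulo the cycle, so at any time at most one node can start a turn, and only
at offset 1 of its own slot. -/
theorem clock_eq_iff {k e : ℕ} (he : e < slotLength n β R) (v : Fin n) :
    (k * slotLength n β R + e) % cycle n β R = v.1 * slotLength n β R + 1 ↔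
      e = 1 ∧ v = owner n k := by
  have h4 := four_le_slotLength (n := n) (β := β) (R := R)
  rw [clock_eq he]
  constructor
  · intro h
    have h1 := congrArg (· % slotLength n β R) h
    have h2 := congrArg (· / slotLength n β R) h
    simp only [Nat.mul_add_mod', Nat.mod_eq_of_lt he,
      Nat.mod_eq_of_lt (show 1 < slotLength n β R by omega)] at h1
    rw [h1] at h
    refine ⟨h1, Fin.ext ?_⟩
    have h3 : (owner n k).1 * slotLength n β R = v.1 * slotLength n β R := by omega
    exact (Nat.eq_of_mul_eq_mul_right slotLength_pos h3).symm
  · rintro ⟨rfl, rfl⟩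
    rfl

end Clock

/-- The modes of the awake nodes outside of a turn: those in `F` have had their turn. -/
def baseModes (n β R t : ℕ) (F : Finset (Fin n)) (v : Fin n) : Mode :=
  if v ∈ F then .done else .wait (t % cycle n β R)

theorem isPassive_baseModes {n β R : ℕ} (t : ℕ) (F : Finset (Fin n)) (v : Fin n) :
    (baseModes n β R t F v).IsPassive := by
  unfold baseModes
  split_ifs <;> trivial

theorem nextMode_baseModes {t k e : ℕ} (ht : t = k * slotLength n β R + e)
    (he : e < slotLength n β R) {F : Finset (Fin n)} {v : Fin n}
    (h : ¬(e = 1 ∧ v = owner n k ∧ v ∉ F)) {d : ℕ} {inbox : Fin d → Option (Bits K)}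
    (hin : ∀ i, inbox i = none) (x : Option (Fin n × Bool)) :
    nextMode β R (nodeState N A β v (baseModes n β R t F v)) inbox x =
      baseModes n β R (t + 1) F v := by
  unfold baseModes
  by_cases hF : v ∈ F
  · simp [hF, nextMode, nodeState]
  · have h' := (clock_eq_iff (β := β) (R := R) (k := k) he v).not.mpr
      fun h' => h ⟨h'.1, h'.2, hF⟩
    rw [← ht] at h'
    simp [hF, nextMode, nodeState, heard_none hin, h', tick]

theorem outgoing_baseModes {t : ℕ} {F : Finset (Fin n)} {v : Fin n} {d : ℕ}
    {inbox : Fin d → Option (Bits K)} {i : Fin d} (hin : inbox i = none)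
    (x : Option (Fin n × Bool)) :
    outgoing β R (nodeState N A β v (baseModes n β R t F v)) inbox x i = none := by
  unfold baseModes
  by_cases hF : v ∈ F <;> simp [hF, outgoing, nodeState, hin]

end WakeUp
end

/-! ### One round of an execution: the Grover search. -/

noncomputable section

namespace Algorithm

variable {n k : ℕ} (𝒜 : Algorithm n k) (N : Network n)

/-- The multiple `z` of the basis state without messages. -/
def vacuumState (z : ℂ) : 𝒜.GlobalBasis N → ℂ :=
  superposition (fun _ : Unit => 𝒜.globalVacuum N) fun _ => z

/-- The place, after `r` rounds with `1 ≤ r ≤ 4`, of a message that the node `u` has sent through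
the port `i`, when the nodes in `T` are awake. -/
def location (T : Finset (Fin n)) (u : Fin n) (r : ℕ) (i : Fin (N.deg u)) :
    (Σ v, Fin (N.deg v)) × Bool :=
  if r = 1 then (N.flip ⟨u, i⟩, true)
  else if r = 2 then (⟨u, i⟩, decide (N.peer u i ∉ T))
  else if r = 3 then (N.flip ⟨u, i⟩, decide (N.peer u i ∈ T))
  else (⟨u, i⟩, false)

/-- The phase of this message. -/
def phase (T : Finset (Fin n)) (u : Fin n) (r : ℕ) (i : Fin (N.deg u)) : ℂ :=
  if r ≠ 1 ∧ N.peer u i ∉ T then -1 else 1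

/-- A superposition of messages that the node `u` sent with the amplitudes `a`, after `r` rounds. -/
def flight (T : Finset (Fin n)) (u : Fin n) (r : ℕ) (a : Fin (N.deg u) → ℂ) :
    𝒜.GlobalBasis N → ℂ :=
  superposition (fun i => 𝒜.message N (location N T u r i).1 (location N T u r i).2)
    fun i => phase N T u r i * a i

variable {N} {c : 𝒜.Config N} {o : 𝒜.Outcomes} {T : Finset (Fin n)} {u : Fin n}

theorem step_amp_of_localAmp (advice : Fin n → List Bool) {ι : Type*} [Fintype ι]
    {Y : ι → 𝒜.GlobalBasis N} {a : ι → ℂ} (h : 𝒜.localAmp N c o = superposition Y a) :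
    (𝒜.step N advice c o).amp = superposition (fun i => 𝒜.route N (Y i)) a := by
  rw [← superposition_route, ← h]
  rfl

theorem step_of_passive_vacuum (advice : Fin n → List Bool) {z : ℂ}
    (hop : ∀ v, 𝒜.nodeOp (N.deg v) (c.inbox v) (c.state v) (o v) = 𝒜.passiveOp T v (N.deg v))
    (hc : c.amp = 𝒜.vacuumState N z) :
    (𝒜.step N advice c o).amp = 𝒜.vacuumState N z ∧
      𝒜.quantumMsgs N (𝒜.localAmp N c o) = 0 := by
  have h := 𝒜.localAmp_monomial c o _ (fun _ => 𝒜.globalVacuum N) _ (fun _ _ => 1) hc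
    (fun i v x => by rw [hop]; exact 𝒜.passiveOp_vacuum T v _ x)
  refine ⟨?_, ?_⟩
  · rw [𝒜.step_amp_of_localAmp advice h, vacuumState]
    simp [route_globalVacuum]
  · rw [h]
    exact Nat.le_zero.mp (𝒜.quantumMsgs_superposition_le N _ _ 0
      fun _ => (𝒜.sum_load_globalVacuum N).le)

/-- After the sending round the message lies in a receive register at the far end. A sleeping node
moves it to the emission register with the phase -1, and it comes back to the receive register of
`u`; an awake node leaves it, and the swap carries it back to the emission register of `u`. The
second trip repeats this, now without a sign, and makes the two cases coincide. -/
theorem step_of_passive_flight (advice : Fin n → List Bool) (hu : u ∈ T) {r : ℕ} (hr1 : 1 ≤ r)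
    (hr3 : r ≤ 3) {a : Fin (N.deg u) → ℂ}
    (hop : ∀ v, 𝒜.nodeOp (N.deg v) (c.inbox v) (c.state v) (o v) = 𝒜.passiveOp T v (N.deg v))
    (hc : c.amp = 𝒜.flight N T u r a) :
    (𝒜.step N advice c o).amp = 𝒜.flight N T u (r + 1) a ∧
      𝒜.quantumMsgs N (𝒜.localAmp N c o) ≤ 1 := by
  have h := 𝒜.localAmp_passive c o T _ _ _ hop hc
  refine ⟨?_, ?_⟩
  · rw [𝒜.step_amp_of_localAmp advice h, flight]
    have hpeer : ∀ i, (N.flip ⟨u, i⟩).1 = N.peer u i := fun i => rfl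
    refine superposition_congr (fun i => ?_) (fun i _ => ?_)
    · rw [← mul_assoc]
      congr 1
      by_cases hi : N.peer u i ∈ T <;> interval_cases r <;>
        simp [phase, location, hpeer, hi, hu]
    · rw [route_message]
      by_cases hi : N.peer u i ∈ T <;> interval_cases r <;>
        simp [location, hpeer, hi, hu, N.flip_flip]
  · rw [h]
    exact 𝒜.quantumMsgs_superposition_le N _ _ 1 fun _ => (𝒜.sum_load_message N _ _).le

/-- These are the moments at which the message is at `u`: after two rounds the register still shows
whether the neighbour sleeps, and the measurement uses this; after four rounds only the phase does,
and the diffusion uses that. -/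
theorem flight_eq_active (T : Finset (Fin n)) {r : ℕ} (hr : r = 2 ∨ r = 4)
    (a : Fin (N.deg u) → ℂ) :
    𝒜.flight N T u r a = superposition (Function.update (𝒜.globalVacuum N) u)
      (superposition (fun i => 𝒜.photon _ i (if r = 2 then decide (N.peer u i ∉ T) else false))
        fun i => phase N T u r i * a i) := by
  rw [superposition_collapse, flight]
  refine superposition_congr (fun _ => rfl) fun i _ => ?_
  rcases hr with rfl | rfl <;> simp [location, message]

theorem vacuumState_eq_active (z : ℂ) (u : Fin n) :
    𝒜.vacuumState N z = superposition (Function.update (𝒜.globalVacuum N) u)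
      (superposition (fun _ : Unit => 𝒜.vacuum _) fun _ => z) := by
  rw [superposition_collapse, vacuumState]
  refine superposition_congr (fun _ => rfl) fun i _ => ?_
  exact (Function.update_eq_self u (𝒜.globalVacuum N)).symm

/-- The round in which the node `u` sends a message. -/
theorem step_of_send (advice : Fin n → List Bool)
    {M : Matrix (LocalBasis 𝒜.Mem k (N.deg u)) (LocalBasis 𝒜.Mem k (N.deg u)) ℂ}
    {f : LocalBasis 𝒜.Mem k (N.deg u) → ℂ} {a : Fin (N.deg u) → ℂ}
    (hop : ∀ v, v ≠ u →
      𝒜.nodeOp (N.deg v) (c.inbox v) (c.state v) (o v) = 𝒜.passiveOp T v (N.deg v))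
    (hu : 𝒜.nodeOp (N.deg u) (c.inbox u) (c.state u) (o u) = M)
    (hc : c.amp = superposition (Function.update (𝒜.globalVacuum N) u) f)
    (hM : M *ᵥ f = superposition (fun i => 𝒜.photon _ i false) a) :
    (𝒜.step N advice c o).amp = 𝒜.flight N T u 1 a ∧
      𝒜.quantumMsgs N (𝒜.localAmp N c o) ≤ 1 := by
  have h := 𝒜.localAmp_active c o T u M f hop hu hc
  rw [hM, superposition_collapse] at h
  refine ⟨?_, ?_⟩
  · rw [𝒜.step_amp_of_localAmp advice h, flight]
    refine superposition_congr (fun i => by simp [phase]) fun i _ => ?_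
    exact 𝒜.route_message N ⟨u, i⟩ false
  · rw [h]
    exact 𝒜.quantumMsgs_superposition_le N _ _ 1 fun i =>
      (𝒜.sum_load_message N ⟨u, i⟩ false).le

/-- The round in which the node `u` absorbs the message. -/
theorem step_of_absorb (advice : Fin n → List Bool)
    {M : Matrix (LocalBasis 𝒜.Mem k (N.deg u)) (LocalBasis 𝒜.Mem k (N.deg u)) ℂ}
    {f : LocalBasis 𝒜.Mem k (N.deg u) → ℂ} {z : ℂ}
    (hop : ∀ v, v ≠ u →
      𝒜.nodeOp (N.deg v) (c.inbox v) (c.state v) (o v) = 𝒜.passiveOp T v (N.deg v))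
    (hu : 𝒜.nodeOp (N.deg u) (c.inbox u) (c.state u) (o u) = M)
    (hc : c.amp = superposition (Function.update (𝒜.globalVacuum N) u) f)
    (hM : M *ᵥ f = superposition (fun _ : Unit => 𝒜.vacuum _) fun _ => z) :
    (𝒜.step N advice c o).amp = 𝒜.vacuumState N z ∧
      𝒜.quantumMsgs N (𝒜.localAmp N c o) = 0 := by
  have h := 𝒜.localAmp_active c o T u M f hop hu hc
  rw [hM, ← vacuumState_eq_active] at h
  refine ⟨?_, ?_⟩
  · rw [𝒜.step_amp_of_localAmp advice h, vacuumState]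
    simp [route_globalVacuum]
  · rw [h]
    exact Nat.le_zero.mp (𝒜.quantumMsgs_superposition_le N _ _ 0
      fun _ => (𝒜.sum_load_globalVacuum N).le)

end Algorithm

namespace WakeUp

variable {n : ℕ} [NeZero n] (N : Network n) (A : Finset (Fin n)) (K β R : ℕ)

/-- The amplitude of the port `i` after `q` Grover iterations in the block `B`. -/
def searchAmplitude (k : ℕ) (T : Finset (Fin n)) (B q : ℕ) (i : Fin (N.deg (owner n k))) : ℝ :=
  if i ∈ ports N β k B then
    Grover.amplitude (asleep N β k T B).card (ports N β k B).card q (N.peer (owner n k) i ∉ T)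
  else 0

/-- The joint quantum state before the round `pos` of a Grover search. -/
def searchState (k : ℕ) (T : Finset (Fin n)) (B pos : ℕ) (z : ℂ) :
    (algorithm n K β R).GlobalBasis N → ℂ :=
  if pos ≤ 1 then (algorithm n K β R).vacuumState N z
  else (algorithm n K β R).flight N T (owner n k) ((pos - 2) % 4 + 1)
    fun i => z * searchAmplitude N β k T B ((pos - 2) / 4) i

variable {N A K β R}
variable {c : (algorithm n K β R).Config N} {T : Finset (Fin n)} {md : Fin n → Mode} {k : ℕ}

theorem prepare_search {B : ℕ} (hB : (ports N β k B).Nonempty) (z : ℂ) :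
    searchUnitary K (N.deg (owner n k)) (ports N β k B) 1 *ᵥ
      superposition (fun _ : Unit => vacuum K _) (fun _ => z) =
    superposition (fun i => photon K _ i false) fun i => z * searchAmplitude N β k T B 0 i := by
  rw [searchUnitary, if_pos rfl, prepare _ hB]
  refine superposition_congr (fun i => ?_) fun _ _ => rfl
  unfold searchAmplitude
  split_ifs with hi
  · rw [asleep, Grover.amplitude_zero _ _ hi]
    push_cast
    ring
  · simp

/-- The phase collected on the two trips is the oracle call of `Grover.amplitude_succ`. -/
theorem diffuse_search {B pos q : ℕ} (hpos : pos ≠ 1) (hpos' : pos % 4 = 1) (z : ℂ) :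
    searchUnitary K (N.deg (owner n k)) (ports N β k B) pos *ᵥ
      superposition (fun i => photon K _ i false)
        (fun i => Algorithm.phase N T (owner n k) 4 i * (z * searchAmplitude N β k T B q i)) =
    superposition (fun i => photon K _ i false)
      fun i => z * searchAmplitude N β k T B (q + 1) i := by
  rw [searchUnitary, if_neg hpos, if_pos hpos', diffuse]
  · refine superposition_congr (fun i => ?_) fun _ _ => rfl
    have hterm : ∀ j ∈ ports N β k B,
        Algorithm.phase N T (owner n k) 4 j * (z * searchAmplitude N β k T B q j) =
        z * (((if N.peer (owner n k) j ∉ T then -1 else 1) *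
          Grover.amplitude (asleep N β k T B).card (ports N β k B).card q
            (N.peer (owner n k) j ∉ T) : ℝ) : ℂ) := by
      intro j hj
      simp only [Algorithm.phase, searchAmplitude, if_pos hj]
      by_cases hT : N.peer (owner n k) j ∈ T <;> simp [hT]
    by_cases hi : i ∈ ports N β k B
    · rw [if_pos hi, hterm i hi, Finset.sum_congr rfl hterm, ← Finset.mul_sum]
      simp only [searchAmplitude, if_pos hi]
      have := Grover.amplitude_succ (ports N β k B) (fun i => N.peer (owner n k) i ∉ T) q hi
      rw [asleep, this]
      push_cast
      ring
    · simp [searchAmplitude, hi]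
  · intro i hi
    simp [searchAmplitude, hi]

theorem operation_run (v : Fin n) {d τ B ptr a rep pos : ℕ} (h : pos < 2 * 3 ^ a + 1) :
    operation K β d (nodeState N A β v (.run τ B ptr a rep pos)) none =
      searchUnitary K d (block (blockLength n β) d B) pos := by
  have hop : operation K β d (nodeState N A β v (.run τ B ptr a rep pos)) =
      unitaryOp (searchUnitary K d (block (blockLength n β) d B) pos) := if_neg (not_le.mpr h)
  rw [hop]
  exact if_pos rfl

/-- A round of a Grover search before the measurement. -/
theorem stepPlan_search (hst : HasModes N A K β R c T md) (hu : owner n k ∈ T)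
    {τ B ptr a rep pos : ℕ} (hmd : md (owner n k) = .run τ B ptr a rep pos)
    (hpos : pos < 2 * 3 ^ a + 1) (hp : ∀ v, v ≠ owner n k → (md v).IsPassive)
    (hB : (ports N β k B).Nonempty) {z : ℂ} (hc : c.amp = searchState N K β R k T B pos z) :
    (stepPlan N A K β R c T md (owner n k) none).amp = searchState N K β R k T B (pos + 1) z ∧
    (algorithm n K β R).quantumMsgs N
      ((algorithm n K β R).localAmp N c (plan T md (owner n k) none)) ≤ 1 ∧
    (pos = 0 → (algorithm n K β R).quantumMsgs N
      ((algorithm n K β R).localAmp N c (plan T md (owner n k) none)) = 0) := by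
  have hop : ∀ v, v ≠ owner n k →
      (algorithm n K β R).nodeOp (N.deg v) (c.inbox v) (c.state v)
        (plan T md (owner n k) none v) = (algorithm n K β R).passiveOp T v (N.deg v) := by
    intro v hv
    rw [nodeOp_of_isPassive hst (hp v hv), if_pos (plan_of_ne hv)]
  have hopu : (algorithm n K β R).nodeOp (N.deg (owner n k)) (c.inbox (owner n k))
      (c.state (owner n k)) (plan T md (owner n k) none (owner n k)) =
      searchUnitary K (N.deg (owner n k)) (ports N β k B) pos := by
    have : plan T md (owner n k) none (owner n k) = some none := by simp [plan, hu, hmd]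
    rw [nodeOp_of_run hst hu hmd, this]
    exact operation_run _ hpos
  have hopt : pos ≠ 1 → pos % 4 ≠ 1 → ∀ v,
      (algorithm n K β R).nodeOp (N.deg v) (c.inbox v) (c.state v)
        (plan T md (owner n k) none v) = (algorithm n K β R).passiveOp T v (N.deg v) := by
    intro h1 h4 v
    by_cases hv : v = owner n k
    · subst hv
      rw [hopu, searchUnitary, if_neg h1, if_neg h4, Algorithm.passiveOp, if_pos hu]
    · exact hop v hv
  rcases Nat.lt_or_ge pos 2 with h2 | h2
  · interval_cases pos
    · obtain ⟨h1, h2⟩ := (algorithm n K β R).step_of_passive_vacuum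
        (advice N A (blockLength n β) β) (hopt (by norm_num) (by norm_num)) hc
      exact ⟨h1, h2.le.trans zero_le_one, fun _ => h2⟩
    · have hc' : c.amp = (algorithm n K β R).vacuumState N z := hc
      rw [Algorithm.vacuumState_eq_active _ _ (owner n k)] at hc'
      obtain ⟨h1, h2⟩ := (algorithm n K β R).step_of_send
        (advice N A (blockLength n β) β) hop hopu hc' (prepare_search (T := T) hB z)
      exact ⟨h1, h2, fun h => by simp at h⟩
  · rw [searchState, if_neg (by omega)] at hc
    rw [searchState, if_neg (by omega)]
    by_cases hr : (pos - 2) % 4 = 3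
    · rw [hr, Algorithm.flight_eq_active _ T (Or.inr rfl)] at hc
      obtain ⟨h1, h2⟩ := (algorithm n K β R).step_of_send
        (advice N A (blockLength n β) β) hop hopu hc
        (diffuse_search (by omega) (by omega) z)
      refine ⟨?_, h2, fun h => by omega⟩
      rw [show (pos + 1 - 2) % 4 = 0 by omega, show (pos + 1 - 2) / 4 = (pos - 2) / 4 + 1 by omega]
      exact h1
    · obtain ⟨h1, h2⟩ := (algorithm n K β R).step_of_passive_flight
        (advice N A (blockLength n β) β) hu (by omega) (by omega)
        (hopt (by omega) (by omega)) hc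
      refine ⟨?_, h2, fun h => by omega⟩
      rw [show (pos + 1 - 2) % 4 = (pos - 2) % 4 + 1 by omega,
        show (pos + 1 - 2) / 4 = (pos - 2) / 4 by omega]
      exact h1

/-- Since `3 ^ a` is odd, it has the form `2q + 1`. The message is first sent at `pos = 1`, makes
`q` oracle calls of four rounds, and is measured at `pos = 4q + 3`, in the middle of the next call.
-/
theorem exists_iterations (a : ℕ) :
    (2 * 3 ^ a + 1 - 2) % 4 + 1 = 2 ∧ 2 * ((2 * 3 ^ a + 1 - 2) / 4) + 1 = 3 ^ a := by
  obtain ⟨j, hj⟩ : Odd (3 ^ a) := Odd.pow (by decide)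
  omega

/-- The measurement at the end of a Grover search. -/
theorem stepPlan_measure (hst : HasModes N A K β R c T md) (hu : owner n k ∈ T)
    {τ B ptr a rep : ℕ} (hmd : md (owner n k) = .run τ B ptr a rep (2 * 3 ^ a + 1))
    (hp : ∀ v, v ≠ owner n k → (md v).IsPassive)
    {z : ℂ} (hc : c.amp = searchState N K β R k T B (2 * 3 ^ a + 1) z)
    (x : Option (Fin n × Bool)) :
    (stepPlan N A K β R c T md (owner n k) x).amp = (algorithm n K β R).vacuumState N
      (∑ i : Fin (N.deg (owner n k)),
        if x = some (Fin.castLE (N.deg_le _) i, decide (N.peer (owner n k) i ∉ T)) then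
          Algorithm.phase N T (owner n k) 2 i *
            (z * searchAmplitude N β k T B ((2 * 3 ^ a + 1 - 2) / 4) i) else 0) ∧
    (algorithm n K β R).quantumMsgs N
      ((algorithm n K β R).localAmp N c (plan T md (owner n k) x)) = 0 := by
  have hop : ∀ v, v ≠ owner n k →
      (algorithm n K β R).nodeOp (N.deg v) (c.inbox v) (c.state v)
        (plan T md (owner n k) x v) = (algorithm n K β R).passiveOp T v (N.deg v) := by
    intro v hv
    rw [nodeOp_of_isPassive hst (hp v hv), if_pos (plan_of_ne hv)]
  have hopu : (algorithm n K β R).nodeOp (N.deg (owner n k)) (c.inbox (owner n k))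
      (c.state (owner n k)) (plan T md (owner n k) x (owner n k)) =
      absorb n K (N.deg (owner n k)) x := by
    have : plan T md (owner n k) x (owner n k) = some x := by simp [plan, hu, hmd]
    rw [nodeOp_of_run hst hu hmd, this]
    have hop : operation K β (N.deg (owner n k))
        (nodeState N A β (owner n k) (.run τ B ptr a rep (2 * 3 ^ a + 1))) = absorb n K _ :=
      if_pos le_rfl
    simp only [hop]
  have h3 : 1 ≤ 3 ^ a := Nat.one_le_pow _ _ (by norm_num)
  rw [searchState, if_neg (by omega), (exists_iterations a).1,
    Algorithm.flight_eq_active _ T (Or.inl rfl)] at hc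
  exact (algorithm n K β R).step_of_absorb (advice N A (blockLength n β) β) hop hopu hc
    (absorb_mulVec_photon (N.deg_le _) _ _ x)

end WakeUp
end

/-! ### Planned configurations and the rounds without a measurement. -/

noncomputable section

namespace WakeUp

variable {n : ℕ} [NeZero n] (N : Network n) (A : Finset (Fin n)) (K β R : ℕ)

/-- The modes during the turn of the owner of the slot `k`. -/
def turnModes (k t B ptr a rep pos : ℕ) : Fin n → Mode :=
  Function.update (baseModes n β R t (doneAt N A k)) (owner n k)
    (.run (t % cycle n β R) B ptr a rep pos)

/-- The configuration `c` at time `t` outside of a turn. -/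
def Quiet (t : ℕ) (c : (algorithm n K β R).Config N) (φ : ℝ) : Prop :=
  ∃ (k e j : ℕ) (z : ℂ), t = k * slotLength n β R + e ∧ e < slotLength n β R ∧
    (e ≤ 1 → j = k) ∧ (1 < e → j = k + 1) ∧
    HasModes N A K β R c (awakeAt N A j) (baseModes n β R t (doneAt N A j)) ∧
    (∀ v i, c.inbox v i = none) ∧ c.amp = (algorithm n K β R).vacuumState N z ∧
    c.msgs + fullCost R (topLevel n β + 1) * (2 * A.card) ≤
      fullCost R (topLevel n β + 1) * (2 * (awakeAt N A j).card + (doneAt N A j).card) ∧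
    1 + ((n : ℝ) - (awakeAt N A j).card) ≤ φ

/-- The configuration `c` at time `t` in a turn, when no message for a sleeping node is under
way. -/
def Running (t : ℕ) (c : (algorithm n K β R).Config N) (φ : ℝ) : Prop :=
  ∃ (k e B ptr a rep pos : ℕ) (T : Finset (Fin n)) (found : Bool) (z : ℂ),
    t = k * slotLength n β R + e ∧ Progress N A β R k e B a rep pos T found c.msgs ∧
    HasModes N A K β R c T (turnModes N A β R k t B ptr a rep pos) ∧
    (∀ v, v ≠ owner n k → ∀ i, c.inbox v i = none) ∧
    heard (c.inbox (owner n k)) ptr = Progress.pointer N A β k B found ∧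
    c.amp = searchState N K β R k T B pos z ∧
    penalty (asleep N β k T B).card (ports N β k B).card a rep + ((n : ℝ) - T.card) ≤ φ

/-- The configuration `c` at time `t` in a turn, when a node has just been woken up. -/
def Waking (t : ℕ) (c : (algorithm n K β R).Config N) (φ : ℝ) : Prop :=
  ∃ (k e B ptr : ℕ) (T : Finset (Fin n)) (z : ℂ) (i : Fin (N.deg (owner n k))),
    t = k * slotLength n β R + e ∧ Progress N A β R k e B 0 0 0 T true c.msgs ∧
    Target N A k i ∧ i.1 / blockLength n β = B ∧ N.peer (owner n k) i ∈ T ∧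
    HasModes N A K β R c T (Function.update (turnModes N A β R k t B ptr 0 0 0)
      (N.peer (owner n k) i) (.wait 0)) ∧
    (∀ q : Σ v, Fin (N.deg v), c.inbox q.1 q.2 =
      if q = N.flip ⟨owner n k, i⟩ then some (encode K (t % cycle n β R)) else none) ∧
    c.amp = (algorithm n K β R).vacuumState N z ∧
    1 + ((n : ℝ) - T.card) ≤ φ

/-- The configuration `c` at time `t` is as planned, with potential at most `φ`. -/
def Planned (t : ℕ) (c : (algorithm n K β R).Config N) (φ : ℝ) : Prop :=
  Quiet N A K β R t c φ ∨ Running N A K β R t c φ ∨ Waking N A K β R t c φ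

/-- The potential does not increase in expectation in the next round, if unplanned configurations
count with the potential `P`. -/
def Preserved (P : ℝ) (t : ℕ) (c : (algorithm n K β R).Config N) (φ : ℝ) : Prop :=
  ∃ f : (algorithm n K β R).Outcomes → ℝ,
    (∀ o, ((algorithm n K β R).step N (advice N A (blockLength n β) β) c o).amp = 0 ∨ P ≤ f o ∨
      Planned N A K β R (t + 1)
        ((algorithm n K β R).step N (advice N A (blockLength n β) β) c o) (f o)) ∧
    ∑ o, ((algorithm n K β R).step N (advice N A (blockLength n β) β) c o).weight * f o ≤
      c.weight * φ

variable {N A K β R}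
variable {c : (algorithm n K β R).Config N} {T : Finset (Fin n)} {t : ℕ} {φ P : ℝ}

theorem HasModes.congr {md md' : Fin n → Mode} (h : HasModes N A K β R c T md)
    (hmd : ∀ v ∈ T, md v = md' v) : HasModes N A K β R c T md' := by
  intro v
  rw [h v]
  by_cases hv : v ∈ T
  · rw [if_pos hv, if_pos hv, hmd v hv]
  · rw [if_neg hv, if_neg hv]

theorem step_amp_eq_zero {adv : Fin n → List Bool} {o : (algorithm n K β R).Outcomes}
    (h : (algorithm n K β R).localAmp N c o = 0) :
    ((algorithm n K β R).step N adv c o).amp = 0 := by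
  funext x
  exact congrFun h _

/-- When only one outcome can occur, a constant potential works because the total weight is
conserved. -/
theorem preserved_of_unique {md : Fin n → Mode} {u : Fin n}
    (h0 : ∀ o : (algorithm n K β R).Outcomes, o ≠ plan T md u none →
      (algorithm n K β R).localAmp N c o = 0)
    (h : Planned N A K β R (t + 1) (stepPlan N A K β R c T md u none) φ) :
    Preserved N A K β R P t c φ := by
  refine ⟨fun _ => φ, fun o => ?_, ?_⟩
  · by_cases ho : o = plan T md u none
    · subst ho
      exact Or.inr (Or.inr h)
    · exact Or.inl (step_amp_eq_zero (h0 o ho))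
  · rw [← Finset.sum_mul, Algorithm.sum_weight_step]

/-- The critical offset is 1. Either the owner begins its turn there, or it has none in this slot
and the ideal schedule advances without a change of the sets. -/
theorem Quiet.preserved (hn : 2 ≤ n) (hR : 0 < R) (h : Quiet N A K β R t c φ) :
    Preserved N A K β R P t c φ := by
  classical
  obtain ⟨k, e, j, z, ht, he, hj0, hj1, hst, hin, hamp, hmsgs, hφ⟩ := h
  have hL := four_le_slotLength (n := n) (β := β) (R := R)
  have hpass : ∀ v, (baseModes n β R t (doneAt N A j) v).IsPassive := isPassive_baseModes _ _
  refine preserved_of_unique (u := owner n k) (fun o ho => localAmp_of_ne_plan hst hpass _ ho) ?_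
  have hsent : ∀ v i, sent N A K β R c (awakeAt N A j) (baseModes n β R t (doneAt N A j))
      (owner n k) none v i = none := by
    intro v i
    unfold sent
    split_ifs
    all_goals first | exact outgoing_baseModes (hin v i) _ | rfl
  obtain ⟨hin', hst', hmsgs'⟩ := stepPlan_of_silent hst hsent
  obtain ⟨hamp', hq⟩ := (algorithm n K β R).step_of_passive_vacuum
    (advice N A (blockLength n β) β) (T := awakeAt N A j)
    (o := plan (awakeAt N A j) (baseModes n β R t (doneAt N A j)) (owner n k) none)
    (fun v => by
      rw [nodeOp_of_isPassive hst (hpass v), if_pos]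
      simp [plan]) hamp
  rw [hq, add_zero] at hmsgs'
  by_cases hturn : e = 1 ∧ Turn N A k
  · obtain ⟨rfl, hturn⟩ := hturn
    obtain rfl : j = k := hj0 le_rfl
    refine Or.inr (Or.inl ⟨j, 2, firstBlock N A (blockLength n β) j,
      firstBlock N A (blockLength n β) j, 0, 0, 0, awakeAt N A j, false, z, by omega,
      Progress.start hn hR hturn hmsgs hmsgs'.le, ?_, fun v _ i => hin' v i,
      heard_none (hin' _) _, hamp', ?_⟩)
    · refine hst'.congr fun v hv => ?_
      by_cases hvu : v = owner n j
      · subst hvu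
        have hclock := (clock_eq_iff he (owner n j)).mpr ⟨rfl, rfl⟩
        rw [← ht] at hclock
        have hd := hturn.2
        simp only [turnModes, Function.update_self, baseModes, if_neg hd, nextMode, nodeState,
          heard_none (hin _), if_pos hclock, tick_mod, startBlock_eq hturn]
      · rw [turnModes, Function.update_of_ne hvu]
        exact nextMode_baseModes ht he (fun h => hvu h.2.1) (hin v) _
    · rw [penalty_zero]
      exact hφ
  · left
    have hst'' : HasModes N A K β R (stepPlan N A K β R c (awakeAt N A j)
        (baseModes n β R t (doneAt N A j)) (owner n k) none) (awakeAt N A j)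
        (baseModes n β R (t + 1) (doneAt N A j)) := by
      refine hst'.congr fun v hv => nextMode_baseModes ht he (fun h' => hturn ⟨h'.1, ?_⟩) (hin v) _
      obtain ⟨h1, h2, h3⟩ := h'
      obtain rfl : j = k := hj0 h1.le
      exact ⟨h2 ▸ hv, h2 ▸ h3⟩
    rw [← hmsgs'] at hmsgs
    rcases Nat.lt_or_ge (e + 1) (slotLength n β R) with hlt | hge
    · by_cases he1 : e = 1
      · have hnt : ¬Turn N A k := fun h => hturn ⟨he1, h⟩
        obtain rfl : j = k := hj0 he1.le
        refine ⟨j, e + 1, j + 1, z, by omega, hlt, by omega, fun _ => rfl, ?_, hin', hamp', ?_, ?_⟩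
        · rwa [awakeAt_succ_of_not_turn hnt, doneAt_succ_of_not_turn hnt]
        · rwa [awakeAt_succ_of_not_turn hnt, doneAt_succ_of_not_turn hnt]
        · rwa [awakeAt_succ_of_not_turn hnt]
      · exact ⟨k, e + 1, j, z, by omega, hlt, fun h => hj0 (by omega), fun h => hj1 (by omega),
          hst'', hin', hamp', hmsgs, hφ⟩
    · obtain rfl : j = k + 1 := hj1 (by omega)
      refine ⟨k + 1, 0, k + 1, z, ?_, by omega, fun _ => rfl, by omega, hst'', hin', hamp', hmsgs,
        hφ⟩
      rw [ht, Nat.succ_mul]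
      omega

theorem turnModes_isPassive {k B ptr a rep pos : ℕ} {v : Fin n} (hv : v ≠ owner n k) :
    (turnModes N A β R k t B ptr a rep pos v).IsPassive := by
  rw [turnModes, Function.update_of_ne hv]
  exact isPassive_baseModes _ _ _

theorem turnModes_owner {k B ptr a rep pos : ℕ} :
    turnModes N A β R k t B ptr a rep pos (owner n k) =
      .run (t % cycle n β R) B ptr a rep pos := by
  rw [turnModes, Function.update_self]

theorem outgoing_run_of_lt {v : Fin n} {τ B ptr a rep pos d : ℕ} (hpos : pos < 2 * 3 ^ a + 1)
    (inbox : Fin d → Option (Bits K)) (x : Option (Fin n × Bool)) (i : Fin d) :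
    outgoing β R (nodeState N A β v (.run τ B ptr a rep pos)) inbox x i = none := by
  simp only [outgoing, nodeState]
  rw [if_neg]
  omega

theorem nextMode_run_of_lt {v : Fin n} {τ B ptr a rep pos d : ℕ} (hpos : pos < 2 * 3 ^ a + 1)
    (inbox : Fin d → Option (Bits K)) (x : Option (Fin n × Bool)) :
    nextMode β R (nodeState N A β v (.run τ B ptr a rep pos)) inbox x =
      .run (tick n β R τ) B (heard inbox ptr) a rep (pos + 1) := by
  simp only [nextMode, nodeState]
  rw [if_pos hpos]

theorem Progress.lt_slotLength {k e B a rep pos msgs : ℕ} {found : Bool}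
    (h : Progress N A β R k e B a rep pos T found msgs) : e < slotLength n β R :=
  (Nat.lt_succ_self e).trans h.time_lt

theorem preserved_of_search {k e B ptr a rep pos : ℕ} {found : Bool} {z : ℂ}
    (ht : t = k * slotLength n β R + e)
    (hpr : Progress N A β R k e B a rep pos T found c.msgs)
    (hst : HasModes N A K β R c T (turnModes N A β R k t B ptr a rep pos))
    (hin : ∀ v, v ≠ owner n k → ∀ i, c.inbox v i = none)
    (hptr : heard (c.inbox (owner n k)) ptr = Progress.pointer N A β k B found)
    (hamp : c.amp = searchState N K β R k T B pos z)
    (hφ : penalty (asleep N β k T B).card (ports N β k B).card a rep + ((n : ℝ) - T.card) ≤ φ)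
    (hpos : pos < 2 * 3 ^ a + 1) : Preserved N A K β R P t c φ := by
  have huT : owner n k ∈ T := hpr.awake_subset hpr.turn.1
  have hpass : ∀ v, v ≠ owner n k → (turnModes N A β R k t B ptr a rep pos v).IsPassive :=
    fun v hv => turnModes_isPassive hv
  refine preserved_of_unique (fun o ho => localAmp_of_unitary hst huT turnModes_owner hpos hpass ho) ?_
  have hsent : ∀ v i, sent N A K β R c T (turnModes N A β R k t B ptr a rep pos)
      (owner n k) none v i = none := by
    intro v i
    unfold sent
    by_cases hvT : v ∈ T
    · rw [if_pos hvT]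
      by_cases hv : v = owner n k
      · subst hv
        rw [turnModes_owner]
        exact outgoing_run_of_lt hpos _ _ _
      · rw [turnModes, Function.update_of_ne hv]
        exact outgoing_baseModes (hin v hv i) _
    · rw [if_neg hvT]
  obtain ⟨hin', hst', hmsgs'⟩ := stepPlan_of_silent hst hsent
  obtain ⟨hamp', hq, _⟩ := stepPlan_search hst huT turnModes_owner hpos hpass
    hpr.ports_nonempty hamp
  refine Or.inr (Or.inl ⟨k, e + 1, B, Progress.pointer N A β k B found, a, rep, pos + 1, T, found,
    z, by omega, hpr.next hpos (by omega), ?_, fun v _ i => hin' v i, heard_none (hin' _) _,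
    hamp', hφ⟩)
  refine hst'.congr fun v hv => ?_
  by_cases hvu : v = owner n k
  · subst hvu
    rw [turnModes_owner, turnModes_owner, nextMode_run_of_lt hpos, hptr, tick_mod]
  · rw [turnModes, turnModes, Function.update_of_ne hvu, Function.update_of_ne hvu]
    exact nextMode_baseModes ht hpr.lt_slotLength (fun h => hvu h.2.1) (hin v hvu) _

/-- The woken node sets its clock to the received time and replies with its pointer, while the owner
spends the idle first round of its next search. The pointer thus arrives before the next
measurement. -/
theorem Waking.preserved (hK : cycle n β R ≤ 2 ^ K) (hβ : 2 ^ β ≤ 2 ^ K)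
    (h : Waking N A K β R t c φ) : Preserved N A K β R P t c φ := by
  obtain ⟨k, e, B, ptr, T, z, i, ht, hpr, htar, hiB, hiT, hst, hin, hamp, hφ⟩ := h
  have huT : owner n k ∈ T := hpr.awake_subset hpr.turn.1
  have hwu : N.peer (owner n k) i ≠ owner n k := N.peer_ne _ _
  have hwd : N.peer (owner n k) i ∉ doneAt N A k := fun h => htar (doneAt_subset k h)
  set w := N.peer (owner n k) i with hw
  set md := Function.update (turnModes N A β R k t B ptr 0 0 0) w (.wait 0) with hmd
  have hmdu : md (owner n k) = .run (t % cycle n β R) B ptr 0 0 0 := by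
    rw [hmd, Function.update_of_ne hwu.symm, turnModes_owner]
  have hmdw : md w = .wait 0 := by rw [hmd, Function.update_self]
  have hmdv : ∀ v, v ≠ owner n k → v ≠ w → md v = baseModes n β R t (doneAt N A k) v := by
    intro v hvu hvw
    rw [hmd, Function.update_of_ne hvw, turnModes, Function.update_of_ne hvu]
  have hpass : ∀ v, v ≠ owner n k → (md v).IsPassive := by
    intro v hv
    by_cases hvw : v = w
    · subst hvw; rw [hmdw]; trivial
    · rw [hmdv v hv hvw]; exact isPassive_baseModes _ _ _
  have hin0 : ∀ v, v ≠ w → ∀ j, c.inbox v j = none := by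
    intro v hv j
    rw [hin ⟨v, j⟩, if_neg]
    intro hq
    exact hv (congrArg Sigma.fst hq)
  have hinw : c.inbox w (N.flip ⟨owner n k, i⟩).2 = some (encode K (t % cycle n β R)) := by
    have := hin (N.flip ⟨owner n k, i⟩)
    rw [if_pos rfl] at this
    exact this
  refine preserved_of_unique (fun o ho => localAmp_of_unitary hst huT hmdu (by simp) hpass ho) ?_
  have hsent : ∀ q : Σ v, Fin (N.deg v), sent N A K β R c T md (owner n k) none q.1 q.2 =
      if q = N.flip ⟨owner n k, i⟩ then
        some (encode K (siblingBlock N A (blockLength n β) w)) else none := by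
    rintro ⟨v, j⟩
    unfold sent
    by_cases hvw : v = w
    · subst hvw
      rw [if_pos hiT, hmdw]
      simp only [outgoing, nodeState]
      rw [hin ⟨w, j⟩]
      split_ifs <;> rfl
    · rw [if_neg (fun hq => hvw (congrArg Sigma.fst hq))]
      by_cases hvT : v ∈ T
      · rw [if_pos hvT]
        by_cases hvu : v = owner n k
        · subst hvu
          rw [hmdu]
          exact outgoing_run_of_lt (by simp) _ _ _
        · rw [hmdv v hvu hvw]
          exact outgoing_baseModes (hin0 v hvw j) _
      · rw [if_neg hvT]
  obtain ⟨hin', hst', hmsgs'⟩ := stepPlan_of_single hst hsent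
  rw [N.flip_flip] at hin' hst'
  -- The idle round sends no quantum message, so the reply is the only message and the count of one
  -- per round persists.
  obtain ⟨hamp', _, hq⟩ := stepPlan_search hst huT hmdu (by simp) hpass hpr.ports_nonempty
    (z := z) hamp
  rw [hq rfl] at hmsgs'
  refine Or.inr (Or.inl ⟨k, e + 1, B, ptr, 0, 0, 1, T, true,
    z, by omega, hpr.next (by simp) (by omega), ?_, ?_, ?_, hamp', ?_⟩)
  · intro v
    rw [hst' v]
    by_cases hvT : v ∈ T
    · rw [if_pos hvT, if_pos hvT]
      congr 2
      by_cases hvu : v = owner n k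
      · subst hvu
        rw [hmdu, turnModes_owner, nextMode_run_of_lt (by simp),
          heard_none (hin0 _ hwu.symm), tick_mod]
      · rw [turnModes, Function.update_of_ne hvu]
        by_cases hvw : v = w
        · subst hvw
          have hheard : heard (c.inbox w) 0 = t % cycle n β R := by
            refine (heard_single hinw ?_ 0).trans
              (decode_encode ((Nat.mod_lt _ cycle_pos).trans_le hK))
            intro j hj
            rw [hin ⟨w, j⟩, if_neg]
            intro hq
            exact hj (eq_of_heq (Sigma.mk.inj hq).2)
          have hclock := (clock_eq_iff (β := β) (R := R) (k := k) hpr.lt_slotLength w).not.mpr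
            fun h => hvu h.2
          rw [← ht] at hclock
          rw [hmdw]
          simp only [nextMode, nodeState, hheard, if_neg hclock, tick_mod, baseModes, if_neg hwd]
        · rw [hmdv v hvu hvw]
          exact nextMode_baseModes ht hpr.lt_slotLength (fun h => hvu h.2.1) (hin0 v hvw) _
    · rw [if_neg hvT, if_neg hvT, if_neg]
      rintro rfl
      exact hvT huT
  · intro v hv j
    rw [hin' ⟨v, j⟩, if_neg]
    intro hq
    exact hv (congrArg Sigma.fst hq)
  · have h1 := hin' ⟨owner n k, i⟩
    rw [if_pos rfl] at h1
    rw [heard_single h1, decode_encode ((siblingBlock_lt β w).trans_le hβ), hw,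
      siblingBlock_eq hpr.turn htar, hiB]
    · rfl
    · intro j hj
      rw [hin' ⟨owner n k, j⟩, if_neg]
      intro hq
      exact hj (eq_of_heq (Sigma.mk.inj hq).2)
  · rw [penalty_zero]
    exact hφ

end WakeUp
end

/-! ### The measurement round and the properties of planned executions. -/

noncomputable section

namespace WakeUp

variable {n : ℕ} [NeZero n] {N : Network n} {A : Finset (Fin n)} {K β R : ℕ}
variable {c : (algorithm n K β R).Config N} {T : Finset (Fin n)} {t : ℕ} {φ P : ℝ}
variable {k e B ptr a rep : ℕ} {found : Bool} {z : ℂ}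

/-- The outcome of a measurement that finds the message at the port `i`. -/
def portOutcome (N : Network n) (T : Finset (Fin n)) (u : Fin n) (i : Fin (N.deg u)) :
    Option (Fin n × Bool) :=
  some (Fin.castLE (N.deg_le u) i, decide (N.peer u i ∉ T))

theorem portOutcome_injective {n : ℕ} {N : Network n} {T : Finset (Fin n)} (u : Fin n) : Function.Injective (portOutcome N T u) := by
  intro i j h
  simp only [portOutcome, Option.some.injEq, Prod.mk.injEq] at h
  exact Fin.castLE_injective _ h.1

theorem nextMode_measure_found {v j : Fin n} {τ d : ℕ} (inbox : Fin d → Option (Bits K)) :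
    nextMode β R (nodeState N A β v (.run τ B ptr a rep (2 * 3 ^ a + 1))) inbox (some (j, true)) =
      .run (tick n β R τ) B (heard inbox ptr) 0 0 0 := by
  simp only [nextMode, nodeState, lt_irrefl, if_false]

theorem nextMode_measure_failed {v j : Fin n} {τ d : ℕ} (inbox : Fin d → Option (Bits K)) :
    nextMode β R (nodeState N A β v (.run τ B ptr a rep (2 * 3 ^ a + 1))) inbox (some (j, false)) =
      failMode n β R (tick n β R τ) B (heard inbox ptr) a rep := by
  simp only [nextMode, nodeState, lt_irrefl, if_false]

/-- The measurement finds a sleeping node, which is woken up. -/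
theorem waking_of_found (ht : t = k * slotLength n β R + e)
    (hpr : Progress N A β R k e B a rep (2 * 3 ^ a + 1) T found c.msgs)
    (hst : HasModes N A K β R c T (turnModes N A β R k t B ptr a rep (2 * 3 ^ a + 1)))
    (hin : ∀ v, v ≠ owner n k → ∀ i, c.inbox v i = none)
    (hamp : c.amp = searchState N K β R k T B (2 * 3 ^ a + 1) z)
    {i : Fin (N.deg (owner n k))} (hi : i ∈ asleep N β k T B) :
    Waking N A K β R (t + 1) (stepPlan N A K β R c T
      (turnModes N A β R k t B ptr a rep (2 * 3 ^ a + 1)) (owner n k)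
      (portOutcome N T (owner n k) i)) ((n : ℝ) - T.card) := by
  have huT : owner n k ∈ T := hpr.awake_subset hpr.turn.1
  have hpass : ∀ v, v ≠ owner n k →
      (turnModes N A β R k t B ptr a rep (2 * 3 ^ a + 1) v).IsPassive :=
    fun v hv => turnModes_isPassive hv
  have hiT : N.peer (owner n k) i ∉ T := (Finset.mem_filter.mp hi).2
  have hiB : i.1 / blockLength n β = B := mem_block.mp (Finset.mem_filter.mp hi).1
  have hx : portOutcome N T (owner n k) i = some (Fin.castLE (N.deg_le _) i, true) := by
    simp [portOutcome, hiT]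
  have hsent : ∀ q : Σ v, Fin (N.deg v), sent N A K β R c T
      (turnModes N A β R k t B ptr a rep (2 * 3 ^ a + 1)) (owner n k)
      (portOutcome N T (owner n k) i) q.1 q.2 =
      if q = ⟨owner n k, i⟩ then some (encode K ((t + 1) % cycle n β R)) else none := by
    rintro ⟨v, j⟩
    unfold sent
    by_cases hvu : v = owner n k
    · subst hvu
      rw [if_pos huT, turnModes_owner, if_pos rfl, hx]
      simp only [outgoing, nodeState, tick_mod, le_refl, true_and]
      by_cases hj : j = i
      · subst hj
        rw [if_pos rfl, if_pos ⟨Fin.castLE (N.deg_le _) j, rfl, rfl⟩]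
      · rw [if_neg (c := (⟨owner n k, j⟩ : Σ v, Fin (N.deg v)) = ⟨owner n k, i⟩), if_neg]
        · rintro ⟨l, hl, hl'⟩
          simp only [Option.some.injEq, Prod.mk.injEq, and_true] at hl'
          subst hl'
          exact hj (Fin.ext hl.symm)
        · intro h
          exact hj (eq_of_heq (Sigma.mk.inj h).2)
    · rw [if_neg (c := (⟨v, j⟩ : Σ v, Fin (N.deg v)) = ⟨owner n k, i⟩)
        (fun h => hvu (congrArg Sigma.fst h))]
      split_ifs
      · rw [turnModes, Function.update_of_ne hvu]
        exact outgoing_baseModes (hin v hvu j) _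
      · rfl
  obtain ⟨hin', hst', hmsgs'⟩ := stepPlan_of_single hst hsent
  obtain ⟨hamp', hq⟩ := stepPlan_measure hst huT turnModes_owner hpass hamp
    (portOutcome N T (owner n k) i)
  rw [hq] at hmsgs'
  have hwT : N.peer (owner n k) i ∉ T := hiT
  refine ⟨k, e + 1, B, heard (c.inbox (owner n k)) ptr, insert (N.peer (owner n k) i) T, _, i,
    by omega, hpr.success hi (by omega), fun h => hiT (hpr.awake_subset h), hiB,
    Finset.mem_insert_self _ _, ?_, hin', hamp', ?_⟩
  · intro v
    rw [hst' v]
    have hflip : (N.flip ⟨owner n k, i⟩).1 = N.peer (owner n k) i := rfl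
    rw [hflip]
    by_cases hvw : v = N.peer (owner n k) i
    · subst hvw
      rw [if_neg hiT, if_pos rfl, if_pos (Finset.mem_insert_self _ _), Function.update_self]
    · rw [if_neg hvw, Function.update_of_ne hvw]
      by_cases hvT : v ∈ T
      · rw [if_pos hvT, if_pos (Finset.mem_insert_of_mem hvT)]
        congr 2
        by_cases hvu : v = owner n k
        · subst hvu
          rw [if_pos rfl, hx, turnModes_owner, turnModes_owner, nextMode_measure_found, tick_mod]
        · rw [turnModes, turnModes, Function.update_of_ne hvu, Function.update_of_ne hvu]
          exact nextMode_baseModes ht hpr.lt_slotLength (fun h => hvu h.2.1) (hin v hvu) _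
      · rw [if_neg hvT, if_neg]
        simp [hvw, hvT]
  · rw [Finset.card_insert_of_notMem hiT]
    push_cast
    linarith

/-- The search has found nothing. -/
theorem planned_of_failed (hP : P = (4 / 3) ^ R) (ht : t = k * slotLength n β R + e)
    (hpr : Progress N A β R k e B a rep (2 * 3 ^ a + 1) T found c.msgs)
    (hst : HasModes N A K β R c T (turnModes N A β R k t B ptr a rep (2 * 3 ^ a + 1)))
    (hin : ∀ v, v ≠ owner n k → ∀ i, c.inbox v i = none)
    (hptr : heard (c.inbox (owner n k)) ptr = Progress.pointer N A β k B found)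
    (hamp : c.amp = searchState N K β R k T B (2 * 3 ^ a + 1) z)
    {i : Fin (N.deg (owner n k))} (hiT : N.peer (owner n k) i ∈ T) :
    P ≤ (n : ℝ) - T.card +
        penalty (asleep N β k T B).card (ports N β k B).card a (rep + 1) ∨
      Planned N A K β R (t + 1) (stepPlan N A K β R c T
        (turnModes N A β R k t B ptr a rep (2 * 3 ^ a + 1)) (owner n k)
        (portOutcome N T (owner n k) i)) ((n : ℝ) - T.card +
          penalty (asleep N β k T B).card (ports N β k B).card a (rep + 1)) := by
  have huT : owner n k ∈ T := hpr.awake_subset hpr.turn.1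
  have hpass : ∀ v, v ≠ owner n k →
      (turnModes N A β R k t B ptr a rep (2 * 3 ^ a + 1) v).IsPassive :=
    fun v hv => turnModes_isPassive hv
  have hx : portOutcome N T (owner n k) i = some (Fin.castLE (N.deg_le _) i, false) := by
    simp [portOutcome, hiT]
  have hsent : ∀ v j, sent N A K β R c T
      (turnModes N A β R k t B ptr a rep (2 * 3 ^ a + 1)) (owner n k)
      (portOutcome N T (owner n k) i) v j = none := by
    intro v j
    unfold sent
    by_cases hvT : v ∈ T
    · rw [if_pos hvT]
      by_cases hvu : v = owner n k
      · subst hvu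
        rw [if_pos rfl, hx, turnModes_owner]
        simp [outgoing, nodeState]
      · rw [turnModes, Function.update_of_ne hvu]
        exact outgoing_baseModes (hin v hvu j) _
    · rw [if_neg hvT]
  obtain ⟨hin', hst', hmsgs'⟩ := stepPlan_of_silent hst hsent
  obtain ⟨hamp', hq⟩ := stepPlan_measure hst huT turnModes_owner hpass hamp
    (portOutcome N T (owner n k) i)
  rw [hq, add_zero] at hmsgs'
  have hmsgs : (stepPlan N A K β R c T (turnModes N A β R k t B ptr a rep (2 * 3 ^ a + 1))
      (owner n k) (portOutcome N T (owner n k) i)).msgs ≤ c.msgs + 1 := by omega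
  have hcard : (T.card : ℝ) ≤ n := by
    have := Finset.card_le_univ T
    rw [Fintype.card_fin] at this
    exact_mod_cast this
  have hmodes : ∀ {md' : Mode}, failMode n β R ((t + 1) % cycle n β R) B
      (Progress.pointer N A β k B found) a rep = md' →
      HasModes N A K β R (stepPlan N A K β R c T
        (turnModes N A β R k t B ptr a rep (2 * 3 ^ a + 1)) (owner n k)
        (portOutcome N T (owner n k) i)) T
        (Function.update (baseModes n β R (t + 1) (doneAt N A k)) (owner n k) md') := by
    rintro md' rfl
    refine hst'.congr fun v hv => ?_
    by_cases hvu : v = owner n k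
    · subst hvu
      rw [if_pos rfl, hx, turnModes_owner, Function.update_self, nextMode_measure_failed, tick_mod,
        hptr]
    · rw [turnModes, Function.update_of_ne hvu, Function.update_of_ne hvu]
      exact nextMode_baseModes ht hpr.lt_slotLength (fun h => hvu h.2.1) (hin v hvu) _
  by_cases hr : rep + 1 < R
  · right; right; left
    refine ⟨k, e + 1, B, Progress.pointer N A β k B found, a, rep + 1, 0, T, found, _, by omega,
      hpr.repeat_search hr hmsgs, hmodes (by simp [failMode, hr]), fun v _ j => hin' v j,
      heard_none (hin' _) _, hamp', by linarith⟩
  · by_cases hcrit : 0 < (asleep N β k T B).card ∧ Real.pi / 2 <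
      3 ^ (a + 1) * Grover.angle (asleep N β k T B).card (ports N β k B).card
    -- The only way to leave the plan: the last of `R` critical failures, where the penalty has
    -- reached `P`.
    · left
      rw [penalty, if_pos hcrit, hP, show R = rep + 1 from le_antisymm (not_lt.mp hr) hpr.rep_lt]
      linarith
    · right
      have hpen : penalty (asleep N β k T B).card (ports N β k B).card a (rep + 1) = 1 :=
        if_neg hcrit
      rw [hpen]
      by_cases ha : a < topLevel n β
      · right; left
        refine ⟨k, e + 1, B, Progress.pointer N A β k B found, a + 1, 0, 0, T, found, _, by omega,
          hpr.next_level hr ha hcrit hmsgs, hmodes (by simp [failMode, hr, ha]),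
          fun v _ j => hin' v j, heard_none (hin' _) _, hamp', ?_⟩
        rw [penalty_zero]
        linarith
      · have hempty := hpr.asleep_eq_empty ha hcrit
        by_cases hp : Progress.pointer N A β k B found = B
        · left
          have hT := hpr.eq_awakeAt_succ (hpr.mem_of_pointer_eq hempty hp)
          refine ⟨k, e + 1, k + 1, _, by omega, hpr.time_lt, fun h => ?_, fun _ => rfl, ?_, hin',
            hamp', ?_, ?_⟩
          · have := hpr.two_le
            omega
          · have hd : failMode n β R ((t + 1) % cycle n β R) B
                (Progress.pointer N A β k B found) a rep = .done := by
              simp [failMode, hr, ha, hp]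
            have := (hmodes hd).congr (md' := baseModes n β R (t + 1) (doneAt N A (k + 1))) ?_
            · rw [← hT]
              exact this
            · intro v _
              unfold baseModes
              rw [doneAt_succ_of_turn hpr.turn]
              by_cases hvu : v = owner n k
              · subst hvu
                simp
              · rw [Function.update_of_ne hvu]
                simp [Finset.mem_insert, hvu]
          · have h1 := hpr.finish_msgs hmsgs
            rw [← hT]
            exact h1
          · rw [← hT]
            linarith
        · right; left
          refine ⟨k, e + 1, Progress.pointer N A β k B found, Progress.pointer N A β k B found,
            0, 0, 0, T, false, _, by omega, hpr.next_block hempty hp hmsgs,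
            hmodes (by simp [failMode, hr, ha, hp]),
            fun v _ j => hin' v j, heard_none (hin' _) _, hamp', ?_⟩
          rw [penalty_zero]
          linarith

/-- The search amplitudes satisfy the supermartingale inequality. -/
theorem sum_penalty_le
    (hang : 0 < (asleep N β k T B).card →
      3 ^ a * Grover.angle (asleep N β k T B).card (ports N β k B).card ≤ Real.pi / 2) :
    ∑ i, searchAmplitude N β k T B ((2 * 3 ^ a + 1 - 2) / 4) i ^ 2 *
      (if i ∈ asleep N β k T B then 0
        else penalty (asleep N β k T B).card (ports N β k B).card a (rep + 1)) ≤
    (∑ i, searchAmplitude N β k T B ((2 * 3 ^ a + 1 - 2) / 4) i ^ 2) *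
      penalty (asleep N β k T B).card (ports N β k B).card a rep := by
  by_cases hcrit : 0 < (asleep N β k T B).card ∧ Real.pi / 2 <
      3 ^ (a + 1) * Grover.angle (asleep N β k T B).card (ports N β k B).card
  · rw [penalty, penalty, if_pos hcrit, if_pos hcrit]
    set q := (2 * 3 ^ a + 1 - 2) / 4 with hq
    have hq' : (2 * (q : ℝ) + 1) = 3 ^ a := by exact_mod_cast (exists_iterations a).2
    -- At the critical level `3 ^ a * θ` lies between `π / 6` and `π / 2`. A failure has conditional
    -- probability at most 3/4, which balances the growth of the penalty by 4/3.
    have key := Grover.sum_unmarked_le (ports N β k B) (fun i => N.peer (owner n k) i ∉ T) q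
      hcrit.1 (by
        have := hcrit.2
        rw [hq']
        change Real.pi / 6 ≤ 3 ^ a * Grover.angle (asleep N β k T B).card (ports N β k B).card
        rw [pow_succ] at this
        linarith) (by
        rw [hq']
        exact hang hcrit.1)
    have hF : ∑ i, searchAmplitude N β k T B q i ^ 2 *
        (if i ∈ asleep N β k T B then 0 else (4 / 3 : ℝ) ^ (rep + 1)) =
        (∑ i ∈ ports N β k B, if N.peer (owner n k) i ∉ T then 0 else
          Grover.amplitude (asleep N β k T B).card (ports N β k B).card q
            (N.peer (owner n k) i ∉ T) ^ 2) * (4 / 3 : ℝ) ^ (rep + 1) := by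
      rw [Finset.sum_mul]
      symm
      rw [← Finset.sum_subset (Finset.subset_univ (ports N β k B))]
      · refine Finset.sum_congr rfl fun i hi => ?_
        by_cases hT : N.peer (owner n k) i ∈ T <;> simp [searchAmplitude, hi, asleep, hT]
      · intro i _ hi
        simp [searchAmplitude, hi]
    have hS : ∑ i, searchAmplitude N β k T B q i ^ 2 =
        (∑ i ∈ ports N β k B, if N.peer (owner n k) i ∉ T then 0 else
          Grover.amplitude (asleep N β k T B).card (ports N β k B).card q
            (N.peer (owner n k) i ∉ T) ^ 2) +
        ∑ i ∈ ports N β k B, if N.peer (owner n k) i ∉ T then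
          Grover.amplitude (asleep N β k T B).card (ports N β k B).card q
            (N.peer (owner n k) i ∉ T) ^ 2 else 0 := by
      rw [← Finset.sum_add_distrib]
      symm
      rw [← Finset.sum_subset (Finset.subset_univ (ports N β k B))]
      · refine Finset.sum_congr rfl fun i hi => ?_
        by_cases hT : N.peer (owner n k) i ∈ T <;> simp [searchAmplitude, hi, hT]
      · intro i _ hi
        simp [searchAmplitude, hi]
    rw [hF, hS, pow_succ]
    have hW : (0 : ℝ) ≤ (4 / 3) ^ rep := by positivity
    have := mul_le_mul_of_nonneg_right key hW
    simp only [asleep] at this ⊢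
    linarith
  · rw [penalty, penalty, if_neg hcrit, if_neg hcrit, mul_one]
    refine Finset.sum_le_sum fun i _ => mul_le_of_le_one_right (sq_nonneg _) ?_
    split_ifs <;> norm_num

/-- The weights of the outcomes of the measurement at the end of a Grover search. -/
theorem weight_measure
    (hst : HasModes N A K β R c T (turnModes N A β R k t B ptr a rep (2 * 3 ^ a + 1)))
    (huT : owner n k ∈ T)
    (hamp : c.amp = searchState N K β R k T B (2 * 3 ^ a + 1) z) (x : Option (Fin n × Bool)) :
    (stepPlan N A K β R c T (turnModes N A β R k t B ptr a rep (2 * 3 ^ a + 1)) (owner n k)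
      x).amp = 0 ∧ (∀ i, x ≠ portOutcome N T (owner n k) i) ∨
    ∃ i, x = portOutcome N T (owner n k) i ∧
      (stepPlan N A K β R c T (turnModes N A β R k t B ptr a rep (2 * 3 ^ a + 1)) (owner n k)
        x).weight = ‖z‖ ^ 2 * searchAmplitude N β k T B ((2 * 3 ^ a + 1 - 2) / 4) i ^ 2 := by
  classical
  obtain ⟨hamp', _⟩ := stepPlan_measure hst huT turnModes_owner
    (fun v hv => turnModes_isPassive hv) hamp x
  change _ = (algorithm n K β R).vacuumState N (∑ i, if x = portOutcome N T (owner n k) i then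
    Algorithm.phase N T (owner n k) 2 i *
      (z * searchAmplitude N β k T B ((2 * 3 ^ a + 1 - 2) / 4) i) else 0) at hamp'
  by_cases hx : ∃ i, x = portOutcome N T (owner n k) i
  · obtain ⟨i, rfl⟩ := hx
    refine Or.inr ⟨i, rfl, ?_⟩
    rw [Algorithm.Config.weight, hamp', Algorithm.vacuumState, sum_norm_sq_superposition_unit,
      Finset.sum_eq_single i]
    · rw [if_pos rfl, norm_mul, norm_mul, mul_pow, mul_pow, Complex.norm_real, Real.norm_eq_abs,
        sq_abs]
      have : ‖Algorithm.phase N T (owner n k) 2 i‖ = 1 := by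
        unfold Algorithm.phase
        split_ifs <;> simp
      rw [this, one_pow, one_mul]
    · intro j _ hj
      exact if_neg fun h => hj (portOutcome_injective _ h).symm
    · simp
  · push Not at hx
    refine Or.inl ⟨?_, hx⟩
    rw [hamp', Finset.sum_eq_zero fun i _ => if_neg (hx i)]
    exact superposition_zero

theorem preserved_of_measure (hP : P = (4 / 3) ^ R) (ht : t = k * slotLength n β R + e)
    (hpr : Progress N A β R k e B a rep (2 * 3 ^ a + 1) T found c.msgs)
    (hst : HasModes N A K β R c T (turnModes N A β R k t B ptr a rep (2 * 3 ^ a + 1)))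
    (hin : ∀ v, v ≠ owner n k → ∀ i, c.inbox v i = none)
    (hptr : heard (c.inbox (owner n k)) ptr = Progress.pointer N A β k B found)
    (hamp : c.amp = searchState N K β R k T B (2 * 3 ^ a + 1) z)
    (hφ : penalty (asleep N β k T B).card (ports N β k B).card a rep + ((n : ℝ) - T.card) ≤ φ) :
    Preserved N A K β R P t c φ := by
  classical
  have huT : owner n k ∈ T := hpr.awake_subset hpr.turn.1
  set md := turnModes N A β R k t B ptr a rep (2 * 3 ^ a + 1) with hmd
  set adv := advice N A (blockLength n β) β with hadv
  set G := penalty (asleep N β k T B).card (ports N β k B).card a (rep + 1) with hG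
  set W := penalty (asleep N β k T B).card (ports N β k B).card a rep with hW
  set s : Fin (N.deg (owner n k)) → ℝ :=
    fun i => searchAmplitude N β k T B ((2 * 3 ^ a + 1 - 2) / 4) i ^ 2 with hs
  set o' : Fin (N.deg (owner n k)) → (algorithm n K β R).Outcomes :=
    fun i => plan T md (owner n k) (portOutcome N T (owner n k) i) with ho'
  have hplan : ∀ x, plan T md (owner n k) x (owner n k) = some x := by
    intro x
    simp [plan, huT, hmd, turnModes_owner]
  have hinj : Function.Injective o' := by
    intro i j h
    have := congrFun h (owner n k)
    simp only [ho', hplan, Option.some.injEq] at this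
    exact portOutcome_injective _ this
  have hzero : ∀ o, o ∉ Set.range o' → ((algorithm n K β R).step N adv c o).amp = 0 := by
    intro o ho
    by_cases h : ∃ x, o = plan T md (owner n k) x
    · obtain ⟨x, rfl⟩ := h
      rcases weight_measure hst huT hamp x with h | ⟨i, rfl, _⟩
      · exact h.1
      · exact absurd ⟨i, rfl⟩ ho
    · push Not at h
      exact step_amp_eq_zero (localAmp_of_forall_ne_plan hst huT turnModes_owner
        (fun v hv => turnModes_isPassive hv) h)
  have hweight : ∀ i, ((algorithm n K β R).step N adv c (o' i)).weight = ‖z‖ ^ 2 * s i := by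
    intro i
    rcases weight_measure hst huT hamp (portOutcome N T (owner n k) i) with h | ⟨j, hj, h⟩
    · exact absurd rfl (h.2 i)
    · obtain rfl := portOutcome_injective _ hj
      exact h
  have hsum : ∀ g : (algorithm n K β R).Outcomes → ℝ,
      ∑ o, ((algorithm n K β R).step N adv c o).weight * g o = ∑ i, ‖z‖ ^ 2 * s i * g (o' i) := by
    intro g
    symm
    refine Fintype.sum_of_injective o' hinj _ _ (fun o ho => ?_) fun i => by rw [hweight]
    rw [Algorithm.Config.weight_eq_zero (hzero o ho), zero_mul]
  -- A discovery lowers the number of sleepers by one and resets the penalty to 1, so the two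
  -- changes cancel and no additional term appears. A failure carries the penalty `G` after one more
  -- repetition.
  refine ⟨fun o => ((n : ℝ) - T.card) + if ∃ i ∈ asleep N β k T B, o = o' i then 0 else G,
    fun o => ?_, ?_⟩
  · by_cases ho : o ∈ Set.range o'
    · obtain ⟨i, rfl⟩ := ho
      have hiff : (∃ j ∈ asleep N β k T B, o' i = o' j) ↔ i ∈ asleep N β k T B :=
        ⟨fun ⟨j, hj, h⟩ => hinj h ▸ hj, fun h => ⟨i, h, rfl⟩⟩
      simp only [hiff]
      by_cases hi : i ∈ asleep N β k T B
      · right; right; right; right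
        rw [if_pos hi, add_zero]
        exact waking_of_found ht hpr hst hin hamp hi
      · rw [if_neg hi]
        by_cases hp : i ∈ ports N β k B
        · have hiT : N.peer (owner n k) i ∈ T := by
            by_contra h
            exact hi (Finset.mem_filter.mpr ⟨hp, h⟩)
          exact Or.inr (planned_of_failed hP ht hpr hst hin hptr hamp hiT)
        -- A port outside the block has amplitude zero, so this outcome does not occur.
        · left
          have h0 : ((algorithm n K β R).step N adv c (o' i)).weight = 0 := by
            rw [hweight]
            simp [hs, searchAmplitude, hp]
          unfold Algorithm.Config.weight at h0
          rw [Finset.sum_eq_zero_iff_of_nonneg fun _ _ => sq_nonneg _] at h0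
          funext x
          simpa using h0 x (Finset.mem_univ x)
    · exact Or.inl (hzero o ho)
  · have hc : c.weight = ‖z‖ ^ 2 * ∑ i, s i := by
      rw [← (algorithm n K β R).sum_weight_step N adv c, Finset.mul_sum]
      simpa using hsum fun _ => 1
    rw [hsum]
    have hiff : ∀ i, (∃ j ∈ asleep N β k T B, o' i = o' j) ↔ i ∈ asleep N β k T B := fun i =>
      ⟨fun ⟨j, hj, h⟩ => hinj h ▸ hj, fun h => ⟨i, h, rfl⟩⟩
    simp only [hiff]
    have key := mul_le_mul_of_nonneg_left (sum_penalty_le (rep := rep) hpr.angle_le) (sq_nonneg ‖z‖)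
    have h1 : ∑ i, ‖z‖ ^ 2 * s i * (((n : ℝ) - T.card) + if i ∈ asleep N β k T B then 0 else G) =
        ‖z‖ ^ 2 * (∑ i, s i) * ((n : ℝ) - T.card) +
          ‖z‖ ^ 2 * ∑ i, s i * if i ∈ asleep N β k T B then 0 else G := by
      simp only [mul_add, Finset.sum_add_distrib, Finset.mul_sum, Finset.sum_mul, mul_assoc]
    rw [h1]
    refine le_trans ?_ (mul_le_mul_of_nonneg_left hφ c.weight_nonneg)
    rw [hc]
    linarith

theorem Planned.preserved (hn : 2 ≤ n) (hR : 0 < R) (hK : cycle n β R ≤ 2 ^ K)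
    (hβ : 2 ^ β ≤ 2 ^ K) (h : Planned N A K β R t c φ) :
    Preserved N A K β R ((4 / 3) ^ R) t c φ := by
  rcases h with h | h | h
  · exact h.preserved hn hR
  · obtain ⟨k, e, B, ptr, a, rep, pos, T, found, z, ht, hpr, hst, hin, hptr, hamp, hφ⟩ := h
    rcases hpr.pos_le.lt_or_eq with hpos | rfl
    · exact preserved_of_search ht hpr hst hin hptr hamp hφ hpos
    · exact preserved_of_measure rfl ht hpr hst hin hptr hamp hφ
  · exact h.preserved hK hβ

theorem Planned.nonneg (h : Planned N A K β R t c φ) : 0 ≤ φ := by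
  have hcard : ∀ T : Finset (Fin n), (T.card : ℝ) ≤ n := by
    intro T
    have := Finset.card_le_univ T
    rw [Fintype.card_fin] at this
    exact_mod_cast this
  rcases h with h | h | h
  · obtain ⟨k, e, j, z, -, -, -, -, -, -, -, -, hφ⟩ := h
    linarith [hcard (awakeAt N A j)]
  · obtain ⟨k, e, B, ptr, a, rep, pos, T, found, z, ht, hpr, hst, hin, hptr, hamp, hφ⟩ := h
    linarith [hcard T, one_le_penalty (asleep N β k T B).card (ports N β k B).card a rep]
  · obtain ⟨k, e, B, ptr, T, z, i, ht, hpr, htar, hiB, hiT, hst, hin, hamp, hφ⟩ := h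
    linarith [hcard T]

theorem Planned.initial :
    Planned N A K β R 0 ((algorithm n K β R).initial N A (advice N A (blockLength n β) β))
      (1 + (n : ℝ)) := by
  left
  refine ⟨0, 0, 0, 1, by simp, by unfold slotLength; omega, fun _ => rfl, by omega, ?_,
    fun _ _ => rfl, ?_, ?_, ?_⟩
  · intro v
    have hv : v ∈ awakeAt N A 0 ↔ v ∈ A := Iff.rfl
    have hd : v ∉ doneAt N A 0 := by simp [mem_doneAt]
    by_cases h : v ∈ A
    · rw [if_pos (hv.mpr h), baseModes, if_neg hd, Nat.zero_mod, ← start_advice v (N.deg v)]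
      exact if_pos h
    · rw [if_neg (fun h' => h (hv.mp h'))]
      exact if_neg h
  · funext x
    simp only [Algorithm.initial, Algorithm.vacuumState, superposition]
    simp only [Finset.univ_unique, Finset.sum_singleton]
    rfl
  · simp [Algorithm.initial, awakeAt, doneAt]
  · simp [awakeAt]

/-- The nodes that are awake according to plan. -/
theorem Planned.state_ne_none (h : Planned N A K β R t c φ) {v : Fin n}
    (hv : v ∈ awakeAt N A (t / slotLength n β R)) : c.state v ≠ none := by
  rcases h with h | h | h
  · obtain ⟨k, e, j, z, ht, he, hj0, hj1, hst, -⟩ := h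
    have hk : t / slotLength n β R = k := by
      rw [ht, mul_comm, Nat.mul_add_div (by omega), Nat.div_eq_of_lt he, add_zero]
    rw [hk] at hv
    have hkj : k ≤ j := by
      by_cases he1 : e ≤ 1
      · exact (hj0 he1).ge
      · have := hj1 (by omega)
        omega
    rw [hst v, if_pos (awakeAt_mono hkj hv)]
    simp
  · obtain ⟨k, e, B, ptr, a, rep, pos, T, found, z, ht, hpr, hst, -⟩ := h
    have he := hpr.lt_slotLength
    have hk : t / slotLength n β R = k := by
      rw [ht, mul_comm, Nat.mul_add_div (by omega), Nat.div_eq_of_lt he, add_zero]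
    rw [hk] at hv
    rw [hst v, if_pos (hpr.awake_subset hv)]
    simp
  · obtain ⟨k, e, B, ptr, T, z, i, ht, hpr, htar, hiB, hiT, hst, -⟩ := h
    have he := hpr.lt_slotLength
    have hk : t / slotLength n β R = k := by
      rw [ht, mul_comm, Nat.mul_add_div (by omega), Nat.div_eq_of_lt he, add_zero]
    rw [hk] at hv
    rw [hst v, if_pos (hpr.awake_subset hv)]
    simp

theorem doneAt_mono {j j' : ℕ} (h : j ≤ j') : doneAt N A j ⊆ doneAt N A j' := by
  intro w hw
  obtain ⟨i, hi, h'⟩ := mem_doneAt.mp hw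
  exact mem_doneAt.mpr ⟨i, hi.trans_le h, h'⟩

/-- During a turn the owner is not yet done, contrary to the hypothesis. So the configuration is
quiet, and there the nodes that are done have terminated. -/
theorem Planned.allHalted (h : Planned N A K β R t c φ)
    (hdone : ∀ v, v ∈ doneAt N A (t / slotLength n β R)) : c.AllHalted := by
  rcases h with h | h | h
  · obtain ⟨k, e, j, z, ht, he, hj0, hj1, hst, -⟩ := h
    have hk : t / slotLength n β R = k := by
      rw [ht, mul_comm, Nat.mul_add_div (by omega), Nat.div_eq_of_lt he, add_zero]
    rw [hk] at hdone
    have hkj : k ≤ j := by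
      by_cases he1 : e ≤ 1
      · exact (hj0 he1).ge
      · have := hj1 (by omega)
        omega
    intro v
    have hv := doneAt_mono hkj (hdone v)
    refine ⟨_, (hst v).trans (if_pos (doneAt_subset j hv)), ?_⟩
    simp [nodeState, baseModes, hv]
  · obtain ⟨k, e, B, ptr, a, rep, pos, T, found, z, ht, hpr, -⟩ := h
    have he := hpr.lt_slotLength
    have hk : t / slotLength n β R = k := by
      rw [ht, mul_comm, Nat.mul_add_div (by omega), Nat.div_eq_of_lt he, add_zero]
    rw [hk] at hdone
    exact absurd (hdone _) hpr.turn.2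
  · obtain ⟨k, e, B, ptr, T, z, i, ht, hpr, -⟩ := h
    have he := hpr.lt_slotLength
    have hk : t / slotLength n β R = k := by
      rw [ht, mul_comm, Nat.mul_add_div (by omega), Nat.div_eq_of_lt he, add_zero]
    rw [hk] at hdone
    exact absurd (hdone _) hpr.turn.2

/-- The owner is not counted as done during its turn, which leaves room for the unfinished pass
below `3 n` full ones. -/
theorem Progress.msgs_le_total {msgs pos : ℕ}
    (h : Progress N A β R k e B a rep pos T found msgs) :
    msgs ≤ fullCost R (topLevel n β + 1) * (3 * n) := by
  have h1 := h.msgs_le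
  have h2 := h.cost_lt_full
  have h3 : T.card ≤ n := by simpa using Finset.card_le_univ T
  have h4 : (doneAt N A k).card < n := by
    simpa using Finset.card_lt_univ_of_notMem h.turn.2
  have h5 : fullCost R (topLevel n β + 1) * (2 * T.card + (doneAt N A k).card + 1) ≤
      fullCost R (topLevel n β + 1) * (3 * n) := Nat.mul_le_mul_left _ (by omega)
  rw [Nat.mul_succ] at h5
  omega

theorem Planned.msgs_le (h : Planned N A K β R t c φ) :
    c.msgs ≤ fullCost R (topLevel n β + 1) * (3 * n) := by
  rcases h with h | h | h
  · obtain ⟨k, e, j, z, -, -, -, -, -, -, -, hm, -⟩ := h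
    have h3 : (awakeAt N A j).card ≤ n := by simpa using Finset.card_le_univ (awakeAt N A j)
    have h4 : (doneAt N A j).card ≤ n := by simpa using Finset.card_le_univ (doneAt N A j)
    have h5 : fullCost R (topLevel n β + 1) * (2 * (awakeAt N A j).card + (doneAt N A j).card) ≤
      fullCost R (topLevel n β + 1) * (3 * n) := Nat.mul_le_mul_left _ (by omega)
    omega
  · obtain ⟨k, e, B, ptr, a, rep, pos, T, found, z, ht, hpr, -⟩ := h
    exact hpr.msgs_le_total
  · obtain ⟨k, e, B, ptr, T, z, i, ht, hpr, -⟩ := h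
    exact hpr.msgs_le_total

/-- With high probability, everything goes as planned in the first `r` rounds. -/
theorem prob_planned_ge (hn : 2 ≤ n) (hR : 0 < R) (hK : cycle n β R ≤ 2 ^ K)
    (hβ : 2 ^ β ≤ 2 ^ K) (r : ℕ) :
    1 - (1 + (n : ℝ)) / (4 / 3) ^ R ≤
      (algorithm n K β R).prob N A (advice N A (blockLength n β) β) r fun h =>
        ∀ j ≤ r, ∃ φ, Planned N A K β R j
          ((algorithm n K β R).run N A (advice N A (blockLength n β) β) (h.take j)) φ := by
  have := (algorithm n K β R).continuationWeight_ge (N := N) (advice N A (blockLength n β) β)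
    (Planned N A K β R) (K := (4 / 3) ^ R) (by positivity) (fun _ _ _ h => h.nonneg)
    (fun _ _ _ h => h.preserved hn hR hK hβ) r 0 _ _ Planned.initial
  rw [Algorithm.weight_initial, one_mul] at this
  simp only [zero_add] at this
  exact this

end WakeUp
end

/-! ### Choice of the parameters. -/

noncomputable section

namespace WakeUp

theorem half_le_log {n : ℕ} (hn : 2 ≤ n) : 1 / 2 ≤ Real.log n := by
  have h1 : Real.log 2 ≤ Real.log n := Real.log_le_log (by norm_num) (by exact_mod_cast hn)
  have := Real.log_two_gt_d9
  linarith

theorem two_pow_mul_blockLength_le {n β : ℕ} (hβ : 2 ^ β ≤ n) : 2 ^ β * blockLength n β ≤ 2 * n := by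
  have := Nat.mul_div_le n (2 ^ β)
  rw [blockLength, mul_add, mul_one]
  omega

theorem cycle_le {n β R : ℕ} {κ : ℝ} (hn : 2 ≤ n) (hβ : 2 ^ β ≤ n) (hR : (R : ℝ) ≤ κ * Real.log n) :
    (cycle n β R : ℝ) ≤ (60 * κ + 4) * n ^ 2 * Real.log n := by
  have h1 : slotLength n β R ≤ 60 * R * n + 4 := by
    have := Nat.mul_le_mul_left (30 * R) (two_pow_mul_blockLength_le hβ)
    unfold slotLength
    linarith
  have h2 : (slotLength n β R : ℝ) ≤ 60 * R * n + 4 := by exact_mod_cast h1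
  have hlog := half_le_log hn
  have hn' : (2 : ℝ) ≤ n := by exact_mod_cast hn
  have h3 : (n : ℝ) * slotLength n β R ≤ n * (60 * (κ * Real.log n) * n + 4) := by
    refine mul_le_mul_of_nonneg_left (h2.trans ?_) (by linarith)
    have := mul_le_mul_of_nonneg_right hR (show (0 : ℝ) ≤ 60 * n by linarith)
    linarith
  have h4 : (4 : ℝ) * n ≤ 4 * n ^ 2 * Real.log n := by nlinarith
  rw [cycle, Nat.cast_mul]
  linarith

/-- `3 n` charges of at most `10 R √ℓ` each, where `2 ^ β ≤ n` ensures `ℓ ≤ 4 n / 2 ^ β` despite the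
rounding. -/
theorem fullCost_mul_le {n β R : ℕ} {κ : ℝ} (hβ : 2 ^ β ≤ n)
    (hR : (R : ℝ) ≤ κ * Real.log n) :
    ((fullCost R (topLevel n β + 1) * (3 * n) : ℕ) : ℝ) ≤
      60 * κ * √((n : ℝ) ^ 3 / 2 ^ β) * Real.log n := by
  have h1 : (blockLength n β : ℝ) ≤ 2 ^ 2 * (n / 2 ^ β) := by
    rw [← mul_div_assoc, le_div_iff₀ (by positivity)]
    have : (2 : ℝ) ^ β * blockLength n β ≤ 2 * n := by
      exact_mod_cast two_pow_mul_blockLength_le hβ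
    have hn : (0 : ℝ) ≤ n := Nat.cast_nonneg n
    linarith
  have h2 : √(blockLength n β : ℝ) ≤ 2 * √((n : ℝ) / 2 ^ β) := by
    refine (Real.sqrt_le_sqrt h1).trans ?_
    rw [Real.sqrt_mul (by positivity), Real.sqrt_sq (by norm_num)]
  have h3 : √((n : ℝ) ^ 3 / 2 ^ β) = n * √((n : ℝ) / 2 ^ β) := by
    rw [show (n : ℝ) ^ 3 / 2 ^ β = n ^ 2 * (n / 2 ^ β) by ring, Real.sqrt_mul (by positivity),
      Real.sqrt_sq (by positivity)]
  rw [h3]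
  push_cast
  calc (fullCost R (topLevel n β + 1) : ℝ) * (3 * n)
      ≤ 10 * R * √(blockLength n β : ℝ) * (3 * n) :=
        mul_le_mul_of_nonneg_right (fullCost_topLevel_le n β R) (by positivity)
    _ ≤ 10 * R * (2 * √((n : ℝ) / 2 ^ β)) * (3 * n) := by gcongr
    _ ≤ 10 * (κ * Real.log n) * (2 * √((n : ℝ) / 2 ^ β)) * (3 * n) := by gcongr
    _ = _ := by ring

theorem exists_repetitions (c : ℕ) : ∃ κ : ℝ, 0 < κ ∧ ∀ n : ℕ, 2 ≤ n →
    ∃ R : ℕ, 0 < R ∧ (R : ℝ) ≤ κ * Real.log n ∧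
      (1 + (n : ℝ)) / (4 / 3) ^ R ≤ 1 / (n : ℝ) ^ c := by
  have h43 : 0 < Real.log (4 / 3) := Real.log_pos (by norm_num)
  set δ : ℝ := (c + 2) / Real.log (4 / 3) with hδ
  have hδ0 : 0 < δ := by positivity
  -- By the choice of `δ`, `(4 / 3) ^ R ≥ n ^ (c + 2) ≥ n ^ c * (1 + n)`. Rounding up costs at most
  -- `1 ≤ 2 log n`, hence `δ + 2`.
  refine ⟨δ + 2, by linarith, fun n hn => ⟨⌈δ * Real.log n⌉₊, ?_, ?_, ?_⟩⟩
  · have := half_le_log hn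
    exact Nat.ceil_pos.mpr (by positivity)
  · have := half_le_log hn
    have := Nat.ceil_lt_add_one (show 0 ≤ δ * Real.log n by positivity)
    linarith
  · have hn' : (2 : ℝ) ≤ n := by exact_mod_cast hn
    have h1 : (n : ℝ) ^ (c + 2) ≤ (4 / 3) ^ ⌈δ * Real.log n⌉₊ := by
      rw [← Real.log_le_log_iff (by positivity) (by positivity), Real.log_pow, Real.log_pow]
      have h2 := mul_le_mul_of_nonneg_right (Nat.le_ceil (δ * Real.log n)) h43.le
      have h3 : δ * Real.log n * Real.log (4 / 3) = (c + 2) * Real.log n := by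
        rw [hδ]; field_simp
      push_cast
      linarith
    rw [div_le_div_iff₀ (by positivity) (by positivity), one_mul]
    refine le_trans ?_ h1
    rw [pow_add, mul_comm]
    exact mul_le_mul_of_nonneg_left (by nlinarith) (by positivity)

theorem max_floor_eq (α : ℕ) : max ⌊((α : ℝ) - 1) / 2⌋ 0 = (((α - 1) / 2 : ℕ) : ℤ) := by
  cases α with
  | zero =>
    have : ⌊(((0 : ℕ) : ℝ) - 1) / 2⌋ = -1 := by
      rw [Int.floor_eq_iff]
      norm_num
    rw [this]
    rfl
  | succ α =>
    have : ⌊(((α + 1 : ℕ) : ℝ) - 1) / 2⌋ = ((α / 2 : ℕ) : ℤ) := by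
      obtain ⟨j, hj⟩ : ∃ j, α / 2 = j := ⟨_, rfl⟩
      have h1 : (2 : ℝ) * j ≤ α := by exact_mod_cast (by omega : 2 * j ≤ α)
      have h2 : (α : ℝ) + 1 ≤ 2 * j + 2 := by exact_mod_cast (by omega : α + 1 ≤ 2 * j + 2)
      rw [hj, Int.floor_eq_iff, Int.cast_natCast]
      push_cast
      constructor <;> linarith
    rw [this, Nat.add_sub_cancel]
    exact max_eq_left (Int.natCast_nonneg _)

theorem two_pow_le_of_le_logb {n α : ℕ} (hn : 1 ≤ n) (h : (α : ℝ) ≤ Real.logb 2 n) : 2 ^ α ≤ n := by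
  rw [Real.le_logb_iff_rpow_le (by norm_num) (by exact_mod_cast hn), Real.rpow_natCast] at h
  exact_mod_cast h

/-- The wake-up algorithm with suitable parameters. -/
theorem prob_success_ge {n c β K R : ℕ} [NeZero n] {κ : ℝ} (hκ : 0 < κ) (hn : 2 ≤ n)
    (hβ : 2 ^ β ≤ n) (hR0 : 0 < R) (hR : (R : ℝ) ≤ κ * Real.log n)
    (hP : (1 + (n : ℝ)) / (4 / 3) ^ R ≤ 1 / (n : ℝ) ^ c) (hK : cycle n β R ≤ 2 ^ K)
    (hK' : 2 ^ β ≤ 2 ^ K) (N : Network n) (A : Finset (Fin n)) (hA : A.Nonempty) (t : ℕ)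
    (ht : (120 * κ + 8) * (max (N.awakeDist A) 1 : ℕ) * (n : ℝ) ^ 2 * Real.log n ≤ t) :
    1 - 1 / (n : ℝ) ^ c ≤
      (algorithm n K β R).prob N A (advice N A (blockLength n β) β) t fun h =>
        ((algorithm n K β R).run N A (advice N A (blockLength n β) β)
          (h.take ⌊(120 * κ + 8) * (N.awakeDist A : ℝ) * (n : ℝ) ^ 2 * Real.log n⌋₊)).AllAwake ∧
        ((algorithm n K β R).run N A (advice N A (blockLength n β) β)
          (h.take ⌊(120 * κ + 8) * (max (N.awakeDist A) 1 : ℕ) * (n : ℝ) ^ 2 *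
            Real.log n⌋₊)).AllHalted ∧
        (((algorithm n K β R).run N A (advice N A (blockLength n β) β) h).msgs : ℝ) ≤
          (120 * κ + 8) * √((n : ℝ) ^ 3 / 2 ^ β) * Real.log n := by
  have hlog := half_le_log hn
  have hC := cycle_le hn hβ hR
  have hL : 0 < slotLength n β R := by unfold slotLength; omega
  set ρ := N.awakeDist A with hρ
  set M : ℝ := (n : ℝ) ^ 2 * Real.log n with hM
  have hM0 : 0 ≤ M := by positivity
  -- All nodes are awake after `ρ` cycles and have had their turn after one more. The bound `ρ + 1 ≤
  -- 2 max ρ 1` turns the constant `60 κ + 4` of a cycle into `120 κ + 8`.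
  have hmax : (ρ : ℝ) + 1 ≤ 2 * (max ρ 1 : ℕ) := by
    exact_mod_cast (by omega : ρ + 1 ≤ 2 * max ρ 1)
  have hcy : (0 : ℝ) ≤ cycle n β R := Nat.cast_nonneg _
  have hawake : ρ * n * slotLength n β R ≤
      ⌊(120 * κ + 8) * (ρ : ℝ) * (n : ℝ) ^ 2 * Real.log n⌋₊ := by
    refine Nat.le_floor ?_
    have h1 : ((ρ * n * slotLength n β R : ℕ) : ℝ) = ρ * cycle n β R := by
      rw [cycle]; push_cast; ring
    rw [h1]
    have h2 := mul_le_mul_of_nonneg_left hC (Nat.cast_nonneg (α := ℝ) ρ)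
    have h3 : 0 ≤ (60 * κ + 4) * (ρ : ℝ) * M := by positivity
    rw [hM] at h3
    linarith
  have hhalt : (ρ + 1) * n * slotLength n β R ≤
      ⌊(120 * κ + 8) * (max ρ 1 : ℕ) * (n : ℝ) ^ 2 * Real.log n⌋₊ := by
    refine Nat.le_floor ?_
    have h1 : (((ρ + 1) * n * slotLength n β R : ℕ) : ℝ) = (ρ + 1) * cycle n β R := by
      rw [cycle]; push_cast; ring
    rw [h1]
    have h2 := mul_le_mul_of_nonneg_right hmax hcy
    have h3 := mul_le_mul_of_nonneg_left hC
      (show (0 : ℝ) ≤ 2 * (max ρ 1 : ℕ) by positivity)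
    linarith
  have ht2 : ⌊(120 * κ + 8) * (max ρ 1 : ℕ) * (n : ℝ) ^ 2 * Real.log n⌋₊ ≤ t :=
    Nat.floor_le_of_le ht
  have ht1 : ⌊(120 * κ + 8) * (ρ : ℝ) * (n : ℝ) ^ 2 * Real.log n⌋₊ ≤ t := by
    refine (Nat.floor_le_floor ?_).trans ht2
    gcongr
    exact le_max_left _ _
  refine le_trans (by linarith) ((prob_planned_ge (N := N) (A := A) hn hR0 hK hK' t).trans ?_)
  rw [Algorithm.prob_eq_continuationWeight, Algorithm.prob_eq_continuationWeight]
  refine Algorithm.continuationWeight_mono _ _ _ _ _ fun l hl h => ⟨?_, ?_, ?_⟩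
  · obtain ⟨φ, hφ⟩ := h _ ht1
    intro v
    refine hφ.state_ne_none (awakeAt_mono ?_ (mem_awakeAt_awakeDist hA v))
    rwa [Nat.le_div_iff_mul_le hL]
  · obtain ⟨φ, hφ⟩ := h _ ht2
    refine hφ.allHalted fun v => doneAt_mono ?_ (mem_doneAt_awakeDist hA v)
    rwa [Nat.le_div_iff_mul_le hL]
  · obtain ⟨φ, hφ⟩ := h t le_rfl
    rw [← hl, List.take_length] at hφ
    have h1 : (_ : ℝ) ≤ _ := Nat.cast_le.mpr hφ.msgs_le
    refine h1.trans ((fullCost_mul_le hβ hR).trans ?_)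
    have : 0 ≤ (60 * κ + 8) * (√((n : ℝ) ^ 3 / 2 ^ β) * Real.log n) := by positivity
    linarith

end WakeUp
end

theorem theorem1 :
    -- the exponent `c` of the success probability; the constants depend only on it
    ∀ c : ℕ, ∃ (C : ℝ) (b : ℕ), 0 < C ∧
    ∀ (n α : ℕ), 1 ≤ n → (α : ℝ) ≤ Real.logb 2 n →
    -- the algorithm, with messages of `b ⌈log₂ n⌉` bits or qubits, and the oracle
    ∃ (𝒜 : Algorithm n (b * Nat.clog 2 n))
      (oracle : Network n → Finset (Fin n) → Fin n → List Bool),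
    (∀ N A v, (oracle N A v).length ≤ α) ∧
    ∀ (N : Network n) (A : Finset (Fin n)), A.Nonempty →
    ∀ t : ℕ, C * (max (N.awakeDist A) 1 : ℕ) * (n : ℝ) ^ 2 * Real.log n ≤ t →
    1 - 1 / (n : ℝ) ^ c ≤ 𝒜.prob N A (oracle N A) t fun h =>
      -- all nodes are awake in time
      (𝒜.run N A (oracle N A)
        (h.take ⌊C * (N.awakeDist A : ℝ) * (n : ℝ) ^ 2 * Real.log n⌋₊)).AllAwake ∧
      -- all nodes terminate in time
      (𝒜.run N A (oracle N A)
        (h.take ⌊C * (max (N.awakeDist A) 1 : ℕ) * (n : ℝ) ^ 2 * Real.log n⌋₊)).AllHalted ∧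
      -- the number of messages during all `t` rounds
      ((𝒜.run N A (oracle N A) h).msgs : ℝ) ≤
        C * √((n : ℝ) ^ 3 / (2 : ℝ) ^ (max ⌊((α : ℝ) - 1) / 2⌋ 0)) * Real.log n := by
  intro c
  obtain ⟨κ, hκ, hrep⟩ := WakeUp.exists_repetitions c
  -- A message must hold a clock value, which is below `(60 κ + 4) n² log n`. For `n ≥ 2` the
  -- constant is at most `n ^ m` and the logarithm at most `n`, so `m + 3` times `⌈log₂ n⌉` bits
  -- suffice.
  obtain ⟨m, hm⟩ := pow_unbounded_of_one_lt (60 * κ + 4) (show (1 : ℝ) < 2 by norm_num)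
  refine ⟨120 * κ + 8, m + 3, by positivity, fun n α hn hα => ?_⟩
  have : NeZero n := ⟨by omega⟩
  rcases hn.lt_or_eq with hn2 | rfl
  · obtain ⟨R, hR0, hR, hP⟩ := hrep n hn2
    have hβ : 2 ^ ((α - 1) / 2) ≤ n :=
      (Nat.pow_le_pow_right (by norm_num) (by omega)).trans (WakeUp.two_pow_le_of_le_logb hn hα)
    have hclog : n ≤ 2 ^ Nat.clog 2 n := Nat.le_pow_clog (by norm_num) n
    have hpow : n ^ (m + 3) ≤ 2 ^ ((m + 3) * Nat.clog 2 n) := by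
      rw [mul_comm, pow_mul]
      exact Nat.pow_le_pow_left hclog _
    refine ⟨WakeUp.algorithm n _ ((α - 1) / 2) R,
      fun N A => WakeUp.advice N A (WakeUp.blockLength n ((α - 1) / 2)) ((α - 1) / 2),
      fun N A v => ?_, fun N A hA t ht => ?_⟩
    · rw [WakeUp.length_advice]
      omega
    · rw [WakeUp.max_floor_eq, zpow_natCast]
      refine WakeUp.prob_success_ge hκ hn2 hβ hR0 hR hP (le_trans ?_ hpow)
        (hβ.trans ((Nat.le_self_pow (by omega) n).trans hpow)) N A hA t ht
      have hn' : (2 : ℝ) ≤ n := by exact_mod_cast hn2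
      have h1 : (60 * κ + 4) ≤ (n : ℝ) ^ m := hm.le.trans (by gcongr)
      have h2 : Real.log n ≤ n := (Real.log_le_sub_one_of_pos (by linarith)).trans (by linarith)
      have h3 : (WakeUp.cycle n ((α - 1) / 2) R : ℝ) ≤ (n : ℝ) ^ (m + 3) := by
        refine (WakeUp.cycle_le hn2 hβ hR).trans ?_
        rw [show (n : ℝ) ^ (m + 3) = n ^ m * n ^ 2 * n by ring]
        have := WakeUp.half_le_log hn2
        gcongr
      exact_mod_cast h3
  -- For `n = 1` the required probability is `1 - 1 = 0`, so nothing has to be shown about the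
  -- execution.
  · refine ⟨WakeUp.algorithm 1 _ 0 0, fun _ _ _ => [], fun _ _ _ => Nat.zero_le _,
      fun N A _ t _ => ?_⟩
    rw [Algorithm.prob_eq_continuationWeight]
    exact le_trans (by simp) (Algorithm.continuationWeight_nonneg _ _ _ _ _)
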